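/- **Conventions.** A *computable metric space* $\mathbb{X}=(X,d,(x_i)_{i\in\mathbb{N}})$ is a complete metric space with a dense sequence of *basic points* $x_i$ such that $(i,j)\mapsto d(x_i,x_j)$ is computable. A *Cauchy name* of $y\in\mathbb{X}$ is an $h\in\mathbb{N}^{\mathbb{N}}$ with $d(x_{h(j)},x_{h(i)})\le 2^{-i}$ for all $j\ge i$ and $\lim_i x_{h(i)}=y$. For $S\subseteq\mathbb{X}$, a function $f\colon S\to\mathbb{Y}$ is *computable* if some partial computable map $F\colon{\subseteq}\,\mathbb{N}^{\mathbb{N}}\to\mathbb{N}^{\mathbb{N}}$ is defined on all Cauchy names of all points $x\in S$ and maps each Cauchy name of $x$ to a Cauchy name of $f(x)$. A function $f\colon S\to(-\infty,\infty]$ is *lower semicomputable* if $f=\sup_n g(n,\cdot)$ for a computable $g\colon\mathbb{N}\times S\to\mathbb{R}$. A set is *effectively open* if it is the union of a computable set of basic open balls (balls with basic centres and positive rational radii), and *effectively closed* if its complement is effectively open. Products carry the maximum metric and the pairs of basic points. Let $\mathcal{M}(\mathbb{X})$ be the space of finite Borel measures on $\mathbb{X}$. Let $(f_i)_{i\in\mathbb{N}}$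 be a natural enumeration of the closure under $\max$, $\min$ and rational linear combinations of the constant $\mathbf 1$ and the bump functions that are equal to $1$ where $d(x_k,\cdot)\le r$, to $0$ where $d(x_k,\cdot)\geq s$, and to $(s-d(x_k,\cdot))/(s-r)$ in between ($x_k$ a basic point, $0<r<s$ rational). Cauchy names and basic balls in $\mathcal{M}(\mathbb{X})$ refer to the metric $$d(\mu,\nu)=\sum_i 2^{-i}\Bigl(1-\exp\bigl(-\bigl|\textstyle\int f_i\,d\mu-\int f_i\,d\nu\bigr|\bigr)\Bigr),$$ the basic points being the finite sums $q_1\delta_{x_{k_1}}+\dots+q_n\delta_{x_{k_n}}$ with positive rational $q_j$. Let $\mathbb{A}$ and $\mathbb{X}$ be computable metric spaces and let $K\subseteq\mathbb{A}\times\mathcal{M}(\mathbb{X})$. A *uniform Schnorr integral test restricted to $K$* is a family $\{t^a_\mu\}_{(a,\mu)\in K}$ of functions $t^a_\mu\colon\mathbb{X}\to[0,\infty]$ such that 1. $(a,\mu,x)\mapsto t^a_\mu(x)$ is lower semicomputable on $\{(a,\mu,x):(a,\mu)\in K,\ x\in\mathbb{X}\}$; 2. $\int t^a_\mu\,d\mu<\infty$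 for all $(a,\mu)\in K$; 3. $(a,\mu)\mapsto\int t^a_\mu\,d\mu$ is a computable map $K\to\mathbb{R}$. A *uniform Schnorr integral test* is such a test for $K=\mathbb{A}\times\mathcal{M}(\mathbb{X})$. A point $x\in\mathbb{X}$ is *uniformly Schnorr $\mu$-random relative to the oracle $a$* if $t^a_\mu(x)<\infty$ for every uniform Schnorr integral test $t$. **Theorem.** Let $\mathbb{A}$ and $\mathbb{X}$ be computable metric spaces and let $K\subseteq\mathbb{A}\times\mathcal{M}(\mathbb{X})$ be effectively closed. For all $(a,\mu)\in K$ and all $x\in\mathbb{X}$, the point $x$ is uniformly Schnorr $\mu$-random relative to the oracle $a$ if and only if $t^a_\mu(x)<\infty$ for every uniform Schnorr integral test $\{t^a_\mu\}_{(a,\mu)\in K}$ restricted to $K$. -/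

import Mathlib

open MeasureTheory Filter Topology Set
open scoped NNReal ENNReal

noncomputable section

namespace UniformSchnorr

/-! ## Partial computable functionals on Baire space -/

/-- The first `k` values of `h`. -/
def initSeg (h : ℕ → ℕ) (k : ℕ) : List ℕ := (List.range k).map h

/-- `F` is a partial computable map from (a subset of) Baire space to Baire space.  The function
`run σ n` is the answer on input `n` of an oracle machine which is run for `|σ|` steps and sees only
the finite part `σ` of the oracle (`none` if there is no answer yet).  Then `g = F h` if and only if
for every `n` the machine with oracle `h` eventually answers `g n`; in particular `h` is in the
domain of `F` if and only if the machine answers every `n`. -/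
def PartialComputable (F : (ℕ → ℕ) →. (ℕ → ℕ)) : Prop :=
  ∃ run : List ℕ → ℕ → Option ℕ, Computable₂ run ∧
    (∀ σ τ n m, σ <+: τ → run σ n = some m → run τ n = some m) ∧
    ∀ h g, g ∈ F h ↔ ∀ n, ∃ k, run (initSeg h k) n = some (g n)

/-! ## Computable metric spaces -/

/-- The positive rational number with code `n`; every positive rational has a code. -/
def posRat (n : ℕ) : ℝ≥0 := ((n.unpair.1 : ℝ≥0) + 1) / ((n.unpair.2 : ℝ≥0) + 1)

/-- The rational number with code `n`; every rational has a code. -/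
def rat (n : ℕ) : ℝ :=
  ((n.unpair.1.unpair.1 : ℝ) - (n.unpair.1.unpair.2 : ℝ)) / ((n.unpair.2 : ℝ) + 1)

/-- The data on which Cauchy names and basic balls depend: a distance function and a sequence of
basic points. -/
class MetricPresentation (X : Type*) where
  /-- the distance -/
  d : X → X → ℝ
  /-- the sequence of basic points -/
  pt : ℕ → X

open MetricPresentation

/-- `h` is a Cauchy name for `y`. -/
def IsCauchyName {X : Type*} [MetricPresentation X] (h : ℕ → ℕ) (y : X) : Prop :=
  (∀ i j, i ≤ j → d (pt (h j) : X) (pt (h i)) ≤ (1 / 2 : ℝ) ^ i) ∧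
    Tendsto (fun i => d (pt (h i)) y) atTop (𝓝 0)

instance : MetricPresentation ℕ := ⟨dist, id⟩

instance : MetricPresentation ℝ := ⟨dist, rat⟩

instance {X Y : Type*} [MetricPresentation X] [MetricPresentation Y] :
    MetricPresentation (X × Y) where
  d p q := max (d p.1 q.1) (d p.2 q.2)
  pt n := (pt n.unpair.1, pt n.unpair.2)

/-- A computable sequence of real numbers: rational approximations with error control can be
computed uniformly in `n`. -/
def ComputableRealSeq (f : ℕ → ℝ) : Prop :=
  ∃ c : ℕ → ℕ → ℕ, Computable₂ c ∧ ∀ n, IsCauchyName (c n) (f n)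

/-- A computable metric space: a complete metric space with a dense sequence of basic points, whose
mutual distances are uniformly computable. -/
class ComputableMetricSpace (X : Type*) [MetricSpace X] where
  /-- the sequence of basic points -/
  basicPt : ℕ → X
  complete : CompleteSpace X
  dense : DenseRange basicPt
  computable_dist :
    ComputableRealSeq fun n => dist (basicPt n.unpair.1) (basicPt n.unpair.2)

instance {X : Type*} [MetricSpace X] [ComputableMetricSpace X] : MetricPresentation X :=
  ⟨dist, ComputableMetricSpace.basicPt⟩

/-- The `n`-th basic open ball. -/
def basicBall {X : Type*} [MetricPresentation X] (n : ℕ) : Set X :=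
  {y | d y (pt n.unpair.1) < posRat n.unpair.2}

/-- Effectively open sets: unions of computable sets of basic open balls. -/
def EffectivelyOpen {X : Type*} [MetricPresentation X] (U : Set X) : Prop :=
  ∃ I : Set ℕ, ComputablePred (· ∈ I) ∧ U = ⋃ n ∈ I, basicBall n

/-- Effectively closed sets. -/
def EffectivelyClosed {X : Type*} [MetricPresentation X] (C : Set X) : Prop :=
  EffectivelyOpen Cᶜ

/-- The restriction of `f` to `S` is a computable function `S → Y`. -/
def ComputableFunOn {X Y : Type*} [MetricPresentation X] [MetricPresentation Y]
    (f : X → Y) (S : Set X) : Prop :=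
  ∃ F : (ℕ → ℕ) →. (ℕ → ℕ), PartialComputable F ∧
    ∀ x ∈ S, ∀ h, IsCauchyName h x → ∃ g ∈ F h, IsCauchyName g (f x)

/-- The restriction of `f` to `S` is lower semicomputable: it is the supremum of a computable
sequence of computable real-valued functions on `S`. -/
def LowerSemicomputableOn {X : Type*} [MetricPresentation X] (f : X → EReal) (S : Set X) : Prop :=
  ∃ g : ℕ × X → ℝ, ComputableFunOn g (univ ×ˢ S) ∧ ∀ x ∈ S, f x = ⨆ n, (g (n, x) : EReal)

/-! ## The space of finite Borel measures -/

theorem exists_posRat {q : ℚ} (hq : 0 < q) : ∃ n, (posRat n : ℝ) = q := by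
  have hn : 0 < q.num := Rat.num_pos.2 hq
  refine ⟨Nat.pair (q.num.toNat - 1) (q.den - 1), ?_⟩
  have h1 : ((q.num.toNat - 1 : ℕ) : ℝ) + 1 = q.num := by
    have : (((q.num.toNat - 1 : ℕ) : ℤ) + 1) = q.num := by omega
    exact_mod_cast congrArg (Int.cast : ℤ → ℝ) this
  have h2 : ((q.den - 1 : ℕ) : ℝ) + 1 = q.den := by
    have : (q.den - 1 : ℕ) + 1 = q.den := by have := q.den_pos; omega
    exact_mod_cast this
  rw [posRat, Nat.unpair_pair, NNReal.coe_div, NNReal.coe_add, NNReal.coe_add, NNReal.coe_natCast,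
    NNReal.coe_natCast, NNReal.coe_one, h1, h2]
  exact_mod_cast (Rat.num_div_den q)

theorem exists_rat (q : ℚ) : ∃ n, rat n = q := by
  refine ⟨Nat.pair (Nat.pair q.num.toNat (-q.num).toNat) (q.den - 1), ?_⟩
  have h1 : ((q.num.toNat : ℕ) : ℝ) - ((-q.num).toNat : ℕ) = q.num := by
    have : ((q.num.toNat : ℕ) : ℤ) - ((-q.num).toNat : ℕ) = q.num := by omega
    exact_mod_cast congrArg (Int.cast : ℤ → ℝ) this
  have h2 : ((q.den - 1 : ℕ) : ℝ) + 1 = q.den := by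
    have : (q.den - 1 : ℕ) + 1 = q.den := by have := q.den_pos; omega
    exact_mod_cast this
  simp only [rat, Nat.unpair_pair]
  rw [h1, h2]
  exact_mod_cast (Rat.num_div_den q)

theorem posRat_eq (n : ℕ) : ∃ q : ℚ, 0 < q ∧ (posRat n : ℝ) = q :=
  ⟨((n.unpair.1 : ℚ) + 1) / ((n.unpair.2 : ℚ) + 1), by positivity, by simp [posRat]⟩

theorem rat_eq (n : ℕ) : ∃ q : ℚ, rat n = q :=
  ⟨((n.unpair.1.unpair.1 : ℚ) - (n.unpair.1.unpair.2 : ℚ)) / ((n.unpair.2 : ℚ) + 1),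
    by simp [rat]⟩

section Measures

variable {X : Type*} [MetricPresentation X]

/-- The basic bump function with centre `c` and radii `r < s`: it is `1` on the closed ball of
radius `r`, `0` outside the ball of radius `s`, and linear in the distance in between. -/
def bump (c : X) (r s : ℝ) (y : X) : ℝ :=
  if d c y ≤ r then 1 else if d c y ≤ s then (s - d c y) / (s - r) else 0

/-- The basic functions: the closure of the basic bump functions and the constant `1` under
maxima, minima and rational linear combinations. -/
inductive IsBasicFun : (X → ℝ) → Prop
  | one : IsBasicFun fun _ => 1
  | bump (i : ℕ) (r s : ℚ) : 0 < r → r < s → IsBasicFun (bump (pt i) r s)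
  | max {f g : X → ℝ} : IsBasicFun f → IsBasicFun g → IsBasicFun fun y => max (f y) (g y)
  | min {f g : X → ℝ} : IsBasicFun f → IsBasicFun g → IsBasicFun fun y => min (f y) (g y)
  | lin (p q : ℚ) {f g : X → ℝ} : IsBasicFun f → IsBasicFun g →
      IsBasicFun fun y => p * f y + q * g y

/-- Evaluation of terms for basic functions in Polish notation, with a stack.  A symbol is a pair
(kind, parameter), the kinds being the constant `1`, a bump function, the maximum, the minimum and a
rational linear combination.  An operation with too few arguments is ignored. -/
def polishStack : List (ℕ × ℕ) → List (X → ℝ)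
  | [] => []
  | (0, _) :: w => (fun _ => 1) :: polishStack w
  | (1, m) :: w =>
      bump (pt m.unpair.1) (posRat m.unpair.2.unpair.1)
        (posRat m.unpair.2.unpair.1 + posRat m.unpair.2.unpair.2) :: polishStack w
  | (2, _) :: w =>
      match polishStack w with
      | f :: g :: l => (fun y => max (f y) (g y)) :: l
      | l => l
  | (3, _) :: w =>
      match polishStack w with
      | f :: g :: l => (fun y => min (f y) (g y)) :: l
      | l => l
  | (_ + 4, m) :: w =>
      match polishStack w with
      | f :: g :: l => (fun y => rat m.unpair.1 * f y + rat m.unpair.2 * g y) :: l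
      | l => l

/-- The enumeration `f_0, f_1, …` of the basic functions. -/
def basicFun (n : ℕ) : X → ℝ :=
  (polishStack (Denumerable.ofNat (List (ℕ × ℕ)) n)).headD fun _ => 1

theorem isBasicFun_of_mem (w : List (ℕ × ℕ)) :
    ∀ f ∈ (polishStack w : List (X → ℝ)), IsBasicFun f := by
  fun_induction polishStack (X := X) w with
  | case1 => simp
  | case2 _ w ih => simpa using ⟨IsBasicFun.one, ih⟩
  | case3 m w ih =>
    obtain ⟨q, hq, h⟩ := posRat_eq m.unpair.2.unpair.1
    obtain ⟨q', hq', h'⟩ := posRat_eq m.unpair.2.unpair.2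
    have := IsBasicFun.bump (X := X) m.unpair.1 q (q + q') hq (by linarith)
    rw [Rat.cast_add, ← h, ← h'] at this
    simpa using ⟨this, ih⟩
  | case4 _ w f g l h ih => 
    simp only [h, List.mem_cons, forall_eq_or_imp] at ih ⊢
    exact ⟨ih.1.max ih.2.1, ih.2.2⟩
  | case5 _ w h ih => exact ih
  | case6 _ w f g l h ih =>
    simp only [h, List.mem_cons, forall_eq_or_imp] at ih ⊢
    exact ⟨ih.1.min ih.2.1, ih.2.2⟩
  | case7 _ w h ih => exact ih
  | case8 _ m w f g l h ih =>
    simp only [h, List.mem_cons, forall_eq_or_imp] at ih ⊢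
    obtain ⟨q, hq⟩ := rat_eq m.unpair.1
    obtain ⟨q', hq'⟩ := rat_eq m.unpair.2
    rw [hq, hq']
    exact ⟨ih.1.lin q q' ih.2.1, ih.2.2⟩
  | case9 _ m w h ih => exact ih

theorem IsBasicFun.exists_stack {f : X → ℝ} (hf : IsBasicFun f) :
    ∃ w, ∀ v, polishStack (w ++ v) = f :: polishStack v := by
  induction hf with
  | one => exact ⟨[(0, 0)], fun v => by simp [polishStack]⟩
  | bump i r s hr hs =>
    obtain ⟨a, ha⟩ := exists_posRat hr
    obtain ⟨b, hb⟩ := exists_posRat (sub_pos.2 hs)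
    refine ⟨[(1, Nat.pair i (Nat.pair a b))], fun v => ?_⟩
    simp [polishStack, ha, hb]
  | max _ _ h1 h2 =>
    obtain ⟨w1, h1⟩ := h1
    obtain ⟨w2, h2⟩ := h2
    exact ⟨(2, 0) :: (w1 ++ w2), fun v => by simp [polishStack, h1, h2]⟩
  | min _ _ h1 h2 =>
    obtain ⟨w1, h1⟩ := h1
    obtain ⟨w2, h2⟩ := h2
    exact ⟨(3, 0) :: (w1 ++ w2), fun v => by simp [polishStack, h1, h2]⟩
  | lin p q _ _ h1 h2 =>
    obtain ⟨w1, h1⟩ := h1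
    obtain ⟨w2, h2⟩ := h2
    obtain ⟨a, ha⟩ := exists_rat p
    obtain ⟨b, hb⟩ := exists_rat q
    exact ⟨(4, Nat.pair a b) :: (w1 ++ w2), fun v => by simp [polishStack, h1, h2, ha, hb]⟩

/-- The enumeration runs exactly through the basic functions. -/
theorem isBasicFun_iff (f : X → ℝ) : IsBasicFun f ↔ ∃ n, basicFun n = f := by
  constructor
  · intro hf
    obtain ⟨w, hw⟩ := hf.exists_stack
    refine ⟨Encodable.encode w, ?_⟩
    have := hw []
    rw [List.append_nil] at this
    simp [basicFun, this]
  · rintro ⟨n, rfl⟩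
    have := isBasicFun_of_mem (X := X) (Denumerable.ofNat (List (ℕ × ℕ)) n)
    unfold basicFun
    cases h : (polishStack (Denumerable.ofNat (List (ℕ × ℕ)) n) : List (X → ℝ)) with
    | nil => exact IsBasicFun.one
    | cons f l => rw [h] at this; exact this f (by simp)

variable [MeasurableSpace X]

/-- The unit point mass at `c`. -/
def pointMass (c : X) : FiniteMeasure X := ⟨Measure.dirac c, inferInstance⟩

/-- The basic measures: finite sums of point masses at basic points with positive rational
weights. -/
def basicMeasure (n : ℕ) : FiniteMeasure X :=
  ((Denumerable.ofNat (List (ℕ × ℕ)) n).map fun p =>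
    posRat p.1 • pointMass (pt p.2 : X)).sum

/-- The distance of finite measures, through the integrals of the basic functions. -/
def measureDist (μ ν : FiniteMeasure X) : ℝ :=
  ∑' i : ℕ, (1 / 2 : ℝ) ^ i *
    (1 - Real.exp (-|(∫ x, basicFun i x ∂(μ : Measure X)) - ∫ x, basicFun i x ∂(ν : Measure X)|))

instance : MetricPresentation (FiniteMeasure X) := ⟨measureDist, basicMeasure⟩

end Measures

/-! ## Uniform Schnorr integral tests -/

section Tests

variable {A X : Type*} [MetricSpace A] [ComputableMetricSpace A]
  [MetricSpace X] [ComputableMetricSpace X] [MeasurableSpace X]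

/-- `t` is a uniform Schnorr integral test. -/
structure IsUniformSchnorrTest (t : A → FiniteMeasure X → X → ℝ≥0∞) : Prop where
  lowerSemicomputable :
    LowerSemicomputableOn (fun p : A × FiniteMeasure X × X => (t p.1 p.2.1 p.2.2 : EReal)) univ
  integral_lt_top : ∀ (a : A) (μ : FiniteMeasure X), ∫⁻ x, t a μ x ∂(μ : Measure X) < ∞
  computable_integral :
    ComputableFunOn
      (fun p : A × FiniteMeasure X => (∫⁻ x, t p.1 p.2 x ∂(p.2 : Measure X)).toReal) univ

/-- `x` is uniformly Schnorr `μ`-random relative to the oracle `a`. -/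
def UniformlySchnorrRandom (a : A) (μ : FiniteMeasure X) (x : X) : Prop :=
  ∀ t : A → FiniteMeasure X → X → ℝ≥0∞, IsUniformSchnorrTest t → t a μ x < ∞

/-- `t` is a uniform Schnorr integral test restricted to `K`; only the values `t a μ x` with
`(a, μ) ∈ K` matter. -/
structure IsUniformSchnorrTestOn (K : Set (A × FiniteMeasure X))
    (t : A → FiniteMeasure X → X → ℝ≥0∞) : Prop where
  lowerSemicomputable :
    LowerSemicomputableOn (fun p : A × FiniteMeasure X × X => (t p.1 p.2.1 p.2.2 : EReal))
      {p | (p.1, p.2.1) ∈ K}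
  integral_lt_top : ∀ (a : A) (μ : FiniteMeasure X), (a, μ) ∈ K →
    ∫⁻ x, t a μ x ∂(μ : Measure X) < ∞
  computable_integral :
    ComputableFunOn
      (fun p : A × FiniteMeasure X => (∫⁻ x, t p.1 p.2 x ∂(p.2 : Measure X)).toReal) K

end Tests

end UniformSchnorr

end

open UniformSchnorr

noncomputable section

namespace UniformSchnorr

set_option linter.unusedSectionVars false

open MetricPresentation

/-! ## Computability on lists and bounded search -/

section Computability

variable {α β γ σ : Type*} [Primcodable α] [Primcodable β] [Primcodable γ] [Primcodable σ]

-- One direction is restriction of tests. For the other, a test `t` restricted to `K` has to be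
-- replaced by a test `t'` defined for all `(a, μ)` that is infinite wherever `t` is infinite over
-- `K`. Two obstacles arise: the lower semicomputable extension of `t` off `K` may have infinite
-- integral, and the integral of `t` is a computable function on `K` only.
--
-- The second obstacle is removed by normalization. With `m` the mass of `μ`, `s = √m` and `I = ∫ t
-- dμ`, the function `(s t + 1/s) / (1 + I)` has integral exactly `s`, which is computable for every
-- measure (`lintegral_normalized`). It is still lower semicomputable on `K`, because `I` is
-- computable there (`lt_normalized_iff`), and infinite where `t` is. The null measure causes the
-- square root: the integral `s` tends to `0` with the mass, as it must, while `1/s` makes the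
-- function infinite at `μ = 0`.
--
-- For the first obstacle, a lower semicomputable function on `K × X` is the supremum of the
-- functions `c_k · min (u_k (a, μ)) (b_k x)`, where `u_k` and `b_k` are bump functions, hence
-- defined and computable everywhere (`exists_bumpFamily`, by way of `SemiDecOn.exists_balls`). The
-- integrals `I_n` of the finite maxima are computable everywhere
-- (`BumpFamily.realComputableOn_integral`): for rational `u_k` the maxima are basic functions,
-- whose integrals are computable from a name of `μ`.
--
-- Off `K` the construction is throttled (`BumpFamily.exists_test`). The factor `u_k` is cut down
-- continuously to `0` as soon as `I_{k+1}` exceeds the target integral `F = s` by `2^{-k}`, or as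
-- soon as `(a, μ)` is seen to have left `K`, which is a semidecidable event since `K` is
-- effectively closed (`EffectivelyClosed.exists_exit`). On `K` no cut takes place and the integral
-- is `F`. In general the integral is the limit of an increasing computable sequence, and it is also
-- computable from above: each `(a, μ)` either lies in `K`, where after stage `n` the sequence
-- cannot exceed its current value and `F + 2^{-n}`, or is found to be outside, after which the
-- sequence is constant. Both alternatives give correct upper bounds, so membership in `K` need not
-- be decided.

theorem computable_and {f g : α → Bool} (hf : Computable f) (hg : Computable g) :
    Computable fun a => f a && g a :=
  (Primrec.and.to_comp).comp hf hg

theorem computable_or {f g : α → Bool} (hf : Computable f) (hg : Computable g) :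
    Computable fun a => f a || g a :=
  (Primrec.or.to_comp).comp hf hg

theorem computable_any_range {n : α → ℕ} {f : α → ℕ → Bool} (hn : Computable n)
    (hf : Computable₂ f) : Computable fun a => (List.range (n a)).any (f a) := by
  refine (Computable.nat_rec (h := fun a p => p.2 || f a p.1) hn (Computable.const false)
    (computable_or (Computable.snd.comp Computable.snd)
      (hf.comp Computable.fst (Computable.fst.comp Computable.snd))).to₂).of_eq fun a => ?_
  induction n a with
  | zero => rfl
  | succ k ih => simp only [List.range_succ, List.any_append, ih]; simp

theorem computable_all_range {n : α → ℕ} {f : α → ℕ → Bool} (hn : Computable n)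
    (hf : Computable₂ f) : Computable fun a => (List.range (n a)).all (f a) := by
  refine (Computable.nat_rec (h := fun a p => p.2 && f a p.1) hn (Computable.const true)
    (computable_and (Computable.snd.comp Computable.snd)
      (hf.comp Computable.fst (Computable.fst.comp Computable.snd))).to₂).of_eq fun a => ?_
  induction n a with
  | zero => rfl
  | succ k ih => simp only [List.range_succ, List.all_append, ih]; simp

theorem computable_find_range {n : α → ℕ} {f : α → ℕ → Bool} (hn : Computable n)
    (hf : Computable₂ f) : Computable fun a => (List.range (n a)).find? (f a) := by
  have hstep : Computable₂ fun (a : α) (p : ℕ × Option ℕ) =>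
      Option.casesOn (motive := fun _ => Option ℕ) p.2 (bif f a p.1 then some p.1 else none)
        (fun m => some m) := by
    refine Computable.option_casesOn (Computable.snd.comp Computable.snd) ?_
      (Computable.option_some.comp Computable.snd).to₂
    exact Computable.cond (hf.comp Computable.fst (Computable.fst.comp Computable.snd))
      (Computable.option_some.comp (Computable.fst.comp Computable.snd)) (Computable.const none)
  refine (Computable.nat_rec hn (Computable.const none) hstep).of_eq fun a => ?_
  induction n a with
  | zero => rfl
  | succ k ih =>
    simp only [List.range_succ, List.find?_append]
    rw [← ih]
    cases hk : (Nat.rec (motive := fun _ => Option ℕ) none (fun y IH =>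
      Option.casesOn (motive := fun _ => Option ℕ) IH (bif f a y then some y else none)
        (fun m => some m)) k) <;> cases h : f a k <;> simp [h]

/-- A right fold is a left fold of the reversed list, and this one is a recursion on the number of
entries already consumed. -/
theorem computable_list_foldr {l : α → List β} {b : α → σ} {f : α → β → σ → σ} (hl : Computable l)
    (hb : Computable b) (hf : Computable fun p : α × β × σ => f p.1 p.2.1 p.2.2) :
    Computable fun a => (l a).foldr (f a) (b a) := by
  have hstep : Computable₂ fun (a : α) (p : ℕ × σ) =>
      Option.casesOn (motive := fun _ => σ) ((l a).reverse[p.1]?) p.2 (fun x => f a x p.2) := by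
    refine Computable.option_casesOn (Computable.list_getElem?.comp
      (Computable.list_reverse.comp (hl.comp Computable.fst))
      (Computable.fst.comp Computable.snd)) (Computable.snd.comp Computable.snd) ?_
    exact (hf.comp (Computable.pair (Computable.fst.comp Computable.fst)
      (Computable.pair Computable.snd (Computable.snd.comp
        (Computable.snd.comp Computable.fst))))).to₂
  refine (Computable.nat_rec (Computable.list_length.comp hl) hb hstep).of_eq fun a => ?_
  have key : ∀ (r : List β) (k : ℕ), k ≤ r.length →
      (Nat.rec (motive := fun _ => σ) (b a) (fun y IH =>
        Option.casesOn (motive := fun _ => σ) (r[y]?) IH (fun x => f a x IH)) k) =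
      (r.take k).foldl (fun s x => f a x s) (b a) := by
    intro r k hk
    induction k with
    | zero => simp
    | succ k ih =>
      have hk' : k < r.length := hk
      simp only [ih hk'.le, List.getElem?_eq_getElem hk', List.take_succ_eq_append_getElem hk',
        List.foldl_append, List.foldl_cons, List.foldl_nil]
  have := key (l a).reverse (l a).length (by simp)
  rw [List.take_of_length_le (by simp), List.foldl_reverse] at this
  exact this

end Computability

/-! ## Semidecidable predicates with an oracle -/

section SemiDec

@[simp] theorem length_initSeg (h : ℕ → ℕ) (k : ℕ) : (initSeg h k).length = k := by
  simp [initSeg]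

theorem initSeg_prefix (h : ℕ → ℕ) {k l : ℕ} (hkl : k ≤ l) : initSeg h k <+: initSeg h l := by
  obtain ⟨m, rfl⟩ := Nat.exists_eq_add_of_le hkl
  simp [initSeg, List.range_add]

theorem getElem?_initSeg (h : ℕ → ℕ) {i k : ℕ} (hi : i < k) : (initSeg h k)[i]? = some (h i) := by
  simp [initSeg, hi]

theorem take_initSeg (h : ℕ → ℕ) {k l : ℕ} (hkl : k ≤ l) : (initSeg h l).take k = initSeg h k := by
  have := List.prefix_iff_eq_take.1 (initSeg_prefix h hkl)
  simpa using this.symm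

theorem map_initSeg (h : ℕ → ℕ) (k : ℕ) (f : ℕ → ℕ) :
    (initSeg h k).map f = initSeg (fun i => f (h i)) k := by
  simp [initSeg]

/-- A predicate of a parameter and an oracle is semidecidable if an oracle machine halts exactly
where it is true. -/
def SemiDec {α : Type*} [Primcodable α] (Q : α → (ℕ → ℕ) → Prop) : Prop :=
  ∃ R : List ℕ → α → Bool, Computable₂ R ∧
    (∀ σ τ a, σ <+: τ → R σ a = true → R τ a = true) ∧
    ∀ a h, Q a h ↔ ∃ k, R (initSeg h k) a = true

variable {α β : Type*} [Primcodable α] [Primcodable β]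

theorem SemiDec.of_eq {Q Q' : α → (ℕ → ℕ) → Prop} (hQ : SemiDec Q)
    (h : ∀ a g, Q' a g ↔ Q a g) : SemiDec Q' := by
  have : Q' = Q := by ext a g; exact h a g
  rwa [this]

theorem SemiDec.of_computable {p : α → Bool} (hp : Computable p) :
    SemiDec fun a _ => p a = true :=
  ⟨fun _ a => p a, (hp.comp Computable.snd).to₂, fun _ _ _ _ h => h, fun _ _ => by simp⟩

theorem SemiDec.reindex {Q : α → (ℕ → ℕ) → Prop} (hQ : SemiDec Q) {f : β → α}
    (hf : Computable f) : SemiDec fun b h => Q (f b) h := by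
  obtain ⟨R, hR, hm, h⟩ := hQ
  exact ⟨fun σ b => R σ (f b), hR.comp Computable.fst (hf.comp Computable.snd),
    fun σ τ b => hm σ τ (f b), fun b g => h (f b) g⟩

theorem SemiDec.and {Q Q' : α → (ℕ → ℕ) → Prop} (hQ : SemiDec Q) (hQ' : SemiDec Q') :
    SemiDec fun a h => Q a h ∧ Q' a h := by
  obtain ⟨R, hR, hm, h⟩ := hQ
  obtain ⟨R', hR', hm', h'⟩ := hQ'
  refine ⟨fun σ a => R σ a && R' σ a, computable_and hR hR', ?_, ?_⟩
  · intro σ τ a hst hx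
    simp only [Bool.and_eq_true] at hx ⊢
    exact ⟨hm σ τ a hst hx.1, hm' σ τ a hst hx.2⟩
  · intro a g
    simp only [h, h', Bool.and_eq_true]
    constructor
    · rintro ⟨⟨k, hk⟩, l, hl⟩
      exact ⟨max k l, hm _ _ _ (initSeg_prefix g (le_max_left k l)) hk,
        hm' _ _ _ (initSeg_prefix g (le_max_right k l)) hl⟩
    · rintro ⟨k, hk, hl⟩
      exact ⟨⟨k, hk⟩, k, hl⟩

theorem SemiDec.or {Q Q' : α → (ℕ → ℕ) → Prop} (hQ : SemiDec Q) (hQ' : SemiDec Q') :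
    SemiDec fun a h => Q a h ∨ Q' a h := by
  obtain ⟨R, hR, hm, h⟩ := hQ
  obtain ⟨R', hR', hm', h'⟩ := hQ'
  refine ⟨fun σ a => R σ a || R' σ a, computable_or hR hR', ?_, ?_⟩
  · intro σ τ a hst hx
    simp only [Bool.or_eq_true] at hx ⊢
    exact hx.imp (hm σ τ a hst) (hm' σ τ a hst)
  · intro a g
    simp only [h, h', Bool.or_eq_true, exists_or]

theorem SemiDec.ex {Q : α → ℕ → (ℕ → ℕ) → Prop} (hQ : SemiDec fun p : α × ℕ => Q p.1 p.2) :
    SemiDec fun a h => ∃ m, Q a m h := by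
  obtain ⟨R, hR, hm, h⟩ := hQ
  -- The length of the prefix also bounds the search for `m`, which makes the search finite and
  -- keeps it monotone in `σ`.
  refine ⟨fun σ a => (List.range σ.length).any fun m => R σ (a, m), ?_, ?_, ?_⟩
  · refine computable_any_range (Computable.list_length.comp Computable.fst) ?_
    exact hR.comp (Computable.fst.comp Computable.fst)
      (Computable.pair (Computable.snd.comp Computable.fst) Computable.snd)
  · intro σ τ a hst hx
    simp only [List.any_eq_true, List.mem_range] at hx ⊢
    obtain ⟨m, hm1, hm2⟩ := hx
    exact ⟨m, hm1.trans_le hst.length_le, hm _ _ _ hst hm2⟩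
  · intro a g
    simp only [List.any_eq_true, List.mem_range, length_initSeg]
    constructor
    · rintro ⟨m, hm'⟩
      obtain ⟨k, hk⟩ := (h (a, m) g).1 hm'
      exact ⟨max k (m + 1), m, by simp, hm _ _ _ (initSeg_prefix g (le_max_left _ _)) hk⟩
    · rintro ⟨k, m, -, hk⟩
      exact ⟨m, (h (a, m) g).2 ⟨k, hk⟩⟩

theorem SemiDec.exList {Q : α → List ℕ → (ℕ → ℕ) → Prop}
    (hQ : SemiDec fun p : α × List ℕ => Q p.1 p.2) : SemiDec fun a h => ∃ l, Q a l h := by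
  have h1 : SemiDec fun (p : α × ℕ) h => Q p.1 (Denumerable.ofNat (List ℕ) p.2) h :=
    hQ.reindex (f := fun p : α × ℕ => (p.1, Denumerable.ofNat (List ℕ) p.2))
      (Computable.pair Computable.fst ((Computable.ofNat (List ℕ)).comp Computable.snd))
  refine (SemiDec.ex (Q := fun a m h => Q a (Denumerable.ofNat (List ℕ) m) h) h1).of_eq
    fun a h => ⟨?_, fun ⟨m, hm⟩ => ⟨_, hm⟩⟩
  rintro ⟨l, hl⟩
  exact ⟨Encodable.encode l, by simpa using hl⟩

theorem SemiDec.ball {Q : α → ℕ → (ℕ → ℕ) → Prop} (hQ : SemiDec fun p : α × ℕ => Q p.1 p.2)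
    {n : α → ℕ} (hn : Computable n) : SemiDec fun a h => ∀ i < n a, Q a i h := by
  obtain ⟨R, hR, hm, h⟩ := hQ
  refine ⟨fun σ a => (List.range (n a)).all fun m => R σ (a, m), ?_, ?_, ?_⟩
  · refine computable_all_range (hn.comp Computable.snd) ?_
    exact hR.comp (Computable.fst.comp Computable.fst)
      (Computable.pair (Computable.snd.comp Computable.fst) Computable.snd)
  · intro σ τ a hst hx
    simp only [List.all_eq_true, List.mem_range] at hx ⊢
    exact fun i hi => hm _ _ _ hst (hx i hi)
  · intro a g
    simp only [List.all_eq_true, List.mem_range]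
    constructor
    · intro hx
      choose! k hk using fun i hi => (h (a, i) g).1 (hx i hi)
      exact ⟨(Finset.range (n a)).sup k, fun i hi => hm _ _ _ (initSeg_prefix g
        (Finset.le_sup (f := k) (Finset.mem_range.2 hi))) (hk i hi)⟩
    · rintro ⟨k, hk⟩ i hi
      exact (h (a, i) g).2 ⟨k, hk i hi⟩

/-- A query beyond the end of the prefix counts as not yet accepted; a longer prefix resolves it, so
monotonicity is preserved. -/
theorem SemiDec.oracle {Q : α → ℕ → (ℕ → ℕ) → Prop} (hQ : SemiDec fun p : α × ℕ => Q p.1 p.2)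
    {n : α → ℕ} (hn : Computable n) : SemiDec fun a h => Q a (h (n a)) h := by
  obtain ⟨R, hR, hm, h⟩ := hQ
  refine ⟨fun σ a => Option.casesOn (motive := fun _ => Bool) (σ[n a]?) false
    fun m => R σ (a, m), ?_, ?_, ?_⟩
  · refine Computable.option_casesOn (Computable.list_getElem?.comp Computable.fst
      (hn.comp Computable.snd)) (Computable.const false) ?_
    exact hR.comp (Computable.fst.comp Computable.fst)
      (Computable.pair (Computable.snd.comp Computable.fst) Computable.snd)
  · intro σ τ a hst hx
    cases hs : σ[n a]? with
    | none => simp [hs] at hx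
    | some m =>
      have : τ[n a]? = some m := by
        obtain ⟨r, rfl⟩ := hst
        rw [List.getElem?_append_left (List.getElem?_eq_some_iff.1 hs).1, hs]
      simp only [hs, this] at hx ⊢
      exact hm _ _ _ hst hx
  · intro a g
    rw [h (a, g (n a)) g]
    constructor
    · rintro ⟨k, hk⟩
      refine ⟨max k (n a + 1), ?_⟩
      beta_reduce
      rw [getElem?_initSeg g (lt_max_of_lt_right (Nat.lt_succ_self _))]
      exact hm _ _ _ (initSeg_prefix g (le_max_left _ _)) hk
    · rintro ⟨k, hk⟩
      beta_reduce at hk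
      by_cases hn' : n a < k
      · rw [getElem?_initSeg g hn'] at hk
        exact ⟨k, hk⟩
      · rw [List.getElem?_eq_none (by simpa using hn')] at hk
        simp at hk

theorem SemiDec.comap {Q : α → (ℕ → ℕ) → Prop} (hQ : SemiDec Q) {f : α → ℕ → ℕ}
    (hf : Primrec₂ f) : SemiDec fun a h => Q a fun i => f a (h i) := by
  obtain ⟨R, hR, hm, h⟩ := hQ
  refine ⟨fun σ a => R (σ.map (f a)) a, ?_, ?_, ?_⟩
  · have h1 : Primrec fun p : List ℕ × α => p.1.map (f p.2) :=
      Primrec.list_map Primrec.fst (hf.comp (Primrec.snd.comp Primrec.fst) Primrec.snd).to₂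
    exact hR.comp h1.to_comp Computable.snd
  · intro σ τ a hst hx
    exact hm _ _ _ (hst.map _) hx
  · intro a g
    simp only [map_initSeg]
    exact h a _

/-- A semidecidable predicate without oracle can be enumerated in stages. -/
theorem SemiDec.exists_stage {Q : α → Prop} (hQ : SemiDec fun a _ => Q a) :
    ∃ R : α → ℕ → Bool, Computable₂ R ∧ ∀ a, Q a ↔ ∃ s, R a s = true := by
  obtain ⟨R, hR, -, h⟩ := hQ
  -- Since `Q` ignores the oracle, the zero oracle serves as well as any other, and the length of
  -- its prefix is the stage.
  refine ⟨fun a s => R (List.replicate s 0) a, ?_, fun a => ?_⟩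
  · have h1 : Primrec fun p : α × ℕ => List.replicate p.2 0 := by
      refine (Primrec.list_map (f := fun p : α × ℕ => List.range p.2) (g := fun _ _ => 0)
        (Primrec.list_range.comp Primrec.snd) (Primrec.const 0).to₂).of_eq fun p => ?_
      simp
    exact hR.comp h1.to_comp Computable.fst
  · have := h a fun _ => 0
    simpa [initSeg] using this

end SemiDec

/-! ## Computable families of rational numbers -/

section RatFamily

variable {α β : Type*} [Primcodable α] [Primcodable β]

/-- A family of reals is computably rational if codes of its members as rational numbers can be
computed. -/
def RatFamily (f : α → ℝ) : Prop := ∃ c : α → ℕ, Computable c ∧ ∀ a, rat (c a) = f a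

/-- The code of `(x - y) / (z + 1)`. -/
def mkRat (x y z : ℕ) : ℕ := Nat.pair (Nat.pair x y) z

theorem rat_mkRat (x y z : ℕ) : rat (mkRat x y z) = ((x : ℝ) - y) / ((z : ℝ) + 1) := by
  simp [rat, mkRat]

/-- Arithmetic on rationals is thereby reduced to natural numbers: positive part, negative part and
denominator minus one. -/
theorem ratFamily_iff (f : α → ℝ) : RatFamily f ↔ ∃ x y z : α → ℕ,
    Computable x ∧ Computable y ∧ Computable z ∧
      ∀ a, f a = ((x a : ℝ) - y a) / ((z a : ℝ) + 1) := by
  constructor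
  · rintro ⟨c, hc, h⟩
    have hu : Computable fun a => (c a).unpair := Computable.unpair.comp hc
    have hu1 : Computable fun a => (c a).unpair.1.unpair :=
      Computable.unpair.comp (Computable.fst.comp hu)
    exact ⟨_, _, _, Computable.fst.comp hu1, Computable.snd.comp hu1, Computable.snd.comp hu,
      fun a => (h a).symm⟩
  · rintro ⟨x, y, z, hx, hy, hz, h⟩
    refine ⟨fun a => mkRat (x a) (y a) (z a), ?_, fun a => by rw [rat_mkRat, h]⟩
    exact (Primrec₂.natPair.to_comp).comp ((Primrec₂.natPair.to_comp).comp hx hy) hz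

theorem nat_add' {f g : α → ℕ} (hf : Computable f) (hg : Computable g) :
    Computable fun a => f a + g a := (Primrec.nat_add.to_comp).comp hf hg

theorem nat_mul' {f g : α → ℕ} (hf : Computable f) (hg : Computable g) :
    Computable fun a => f a * g a := (Primrec.nat_mul.to_comp).comp hf hg

theorem RatFamily.reindex {f : α → ℝ} (hf : RatFamily f) {g : β → α} (hg : Computable g) :
    RatFamily fun b => f (g b) := by
  obtain ⟨c, hc, h⟩ := hf
  exact ⟨fun b => c (g b), hc.comp hg, fun b => h _⟩

theorem RatFamily.code : RatFamily rat := ⟨id, Computable.id, fun _ => rfl⟩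

theorem RatFamily.rat {f : α → ℕ} (hf : Computable f) : RatFamily fun a => rat (f a) :=
  RatFamily.code.reindex hf

theorem RatFamily.nat {f : α → ℕ} (hf : Computable f) : RatFamily fun a => (f a : ℝ) :=
  (ratFamily_iff _).2 ⟨f, fun _ => 0, fun _ => 0, hf, Computable.const 0, Computable.const 0,
    fun a => by simp⟩

theorem RatFamily.const (q : ℚ) : RatFamily fun _ : α => (q : ℝ) := by
  obtain ⟨n, hn⟩ := exists_rat q
  exact ⟨fun _ => n, Computable.const n, fun _ => hn⟩

theorem RatFamily.one : RatFamily fun _ : α => (1 : ℝ) := by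
  simpa using RatFamily.const (α := α) 1

theorem RatFamily.zero : RatFamily fun _ : α => (0 : ℝ) := by
  simpa using RatFamily.const (α := α) 0

theorem RatFamily.neg {f : α → ℝ} (hf : RatFamily f) : RatFamily fun a => -f a := by
  obtain ⟨x, y, z, hx, hy, hz, h⟩ := (ratFamily_iff f).1 hf
  exact (ratFamily_iff _).2 ⟨y, x, z, hy, hx, hz, fun a => by rw [h, ← neg_div, neg_sub]⟩

theorem RatFamily.add {f g : α → ℝ} (hf : RatFamily f) (hg : RatFamily g) :
    RatFamily fun a => f a + g a := by
  obtain ⟨x, y, z, hx, hy, hz, h⟩ := (ratFamily_iff f).1 hf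
  obtain ⟨x', y', z', hx', hy', hz', h'⟩ := (ratFamily_iff g).1 hg
  -- Denominators are stored minus one, and `(z + 1) (z' + 1) - 1 = z z' + z + z'`.
  refine (ratFamily_iff _).2 ⟨fun a => x a * (z' a + 1) + x' a * (z a + 1),
    fun a => y a * (z' a + 1) + y' a * (z a + 1), fun a => z a * z' a + z a + z' a, ?_, ?_, ?_, ?_⟩
  · exact nat_add' (nat_mul' hx (Computable.succ.comp hz')) (nat_mul' hx' (Computable.succ.comp hz))
  · exact nat_add' (nat_mul' hy (Computable.succ.comp hz')) (nat_mul' hy' (Computable.succ.comp hz))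
  · exact nat_add' (nat_add' (nat_mul' hz hz') hz) hz'
  · intro a
    have h1 : (z a : ℝ) + 1 ≠ 0 := by positivity
    have h2 : (z' a : ℝ) + 1 ≠ 0 := by positivity
    have h3 : (z a : ℝ) * z' a + z a + z' a + 1 = (z a + 1) * (z' a + 1) := by ring
    rw [h, h']
    push_cast
    rw [h3]
    field_simp
    ring

theorem RatFamily.mul {f g : α → ℝ} (hf : RatFamily f) (hg : RatFamily g) :
    RatFamily fun a => f a * g a := by
  obtain ⟨x, y, z, hx, hy, hz, h⟩ := (ratFamily_iff f).1 hf
  obtain ⟨x', y', z', hx', hy', hz', h'⟩ := (ratFamily_iff g).1 hg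
  refine (ratFamily_iff _).2 ⟨fun a => x a * x' a + y a * y' a,
    fun a => x a * y' a + y a * x' a, fun a => z a * z' a + z a + z' a, ?_, ?_, ?_, ?_⟩
  · exact nat_add' (nat_mul' hx hx') (nat_mul' hy hy')
  · exact nat_add' (nat_mul' hx hy') (nat_mul' hy hx')
  · exact nat_add' (nat_add' (nat_mul' hz hz') hz) hz'
  · intro a
    have h1 : (z a : ℝ) + 1 ≠ 0 := by positivity
    have h2 : (z' a : ℝ) + 1 ≠ 0 := by positivity
    have h3 : (z a : ℝ) * z' a + z a + z' a + 1 = (z a + 1) * (z' a + 1) := by ring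
    rw [h, h']
    push_cast
    rw [h3]
    field_simp
    ring

theorem RatFamily.sub {f g : α → ℝ} (hf : RatFamily f) (hg : RatFamily g) :
    RatFamily fun a => f a - g a := by
  simpa [sub_eq_add_neg] using hf.add hg.neg

theorem RatFamily.inv_nat_succ {f : α → ℕ} (hf : Computable f) :
    RatFamily fun a => ((f a : ℝ) + 1)⁻¹ :=
  (ratFamily_iff _).2 ⟨fun _ => 1, fun _ => 0, f, Computable.const 1, Computable.const 0, hf,
    fun a => by simp⟩

theorem RatFamily.posRat {f : α → ℕ} (hf : Computable f) :
    RatFamily fun a => (posRat (f a) : ℝ) := by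
  have hu := Computable.unpair.comp hf
  refine (ratFamily_iff _).2 ⟨fun a => (f a).unpair.1 + 1, fun _ => 0, fun a => (f a).unpair.2,
    Computable.succ.comp (Computable.fst.comp hu), Computable.const 0, Computable.snd.comp hu,
    fun a => by simp [UniformSchnorr.posRat]⟩

theorem RatFamily.inv_posRat {f : α → ℕ} (hf : Computable f) :
    RatFamily fun a => (UniformSchnorr.posRat (f a) : ℝ)⁻¹ := by
  have hu := Computable.unpair.comp hf
  refine (ratFamily_iff _).2 ⟨fun a => (f a).unpair.2 + 1, fun _ => 0, fun a => (f a).unpair.1,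
    Computable.succ.comp (Computable.snd.comp hu), Computable.const 0, Computable.fst.comp hu,
    fun a => by simp [UniformSchnorr.posRat]⟩

/-- Clearing the positive denominators and moving the subtracted parts across leaves an inequality
of natural numbers. -/
theorem RatFamily.computable_lt {f g : α → ℝ} (hf : RatFamily f) (hg : RatFamily g) :
    Computable fun a => decide (f a < g a) := by
  obtain ⟨x, y, z, hx, hy, hz, h⟩ := (ratFamily_iff f).1 hf
  obtain ⟨x', y', z', hx', hy', hz', h'⟩ := (ratFamily_iff g).1 hg
  have hlt : Computable₂ fun m n : ℕ => decide (m < n) := by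
    have : Primrec fun p : ℕ × ℕ => decide (p.1 < p.2) := PrimrecPred.decide Primrec.nat_lt
    exact this.to_comp
  refine (hlt.comp (nat_add' (nat_mul' hx (Computable.succ.comp hz'))
    (nat_mul' hy' (Computable.succ.comp hz))) (nat_add' (nat_mul' hx' (Computable.succ.comp hz))
    (nat_mul' hy (Computable.succ.comp hz')))).of_eq fun a => ?_
  rw [decide_eq_decide, h, h', div_lt_div_iff₀ (by positivity) (by positivity)]
  rw [← Nat.cast_lt (α := ℝ)]
  push_cast
  constructor <;> intro hh <;> nlinarith

theorem SemiDec.lt {f g : α → ℝ} (hf : RatFamily f) (hg : RatFamily g) :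
    SemiDec fun a _ => f a < g a :=
  (SemiDec.of_computable (hf.computable_lt hg)).of_eq fun a _ => by simp

theorem RatFamily.max {f g : α → ℝ} (hf : RatFamily f) (hg : RatFamily g) :
    RatFamily fun a => max (f a) (g a) := by
  have hd := hf.computable_lt hg
  obtain ⟨c, hc, h⟩ := hf
  obtain ⟨c', hc', h'⟩ := hg
  refine ⟨fun a => bif decide (f a < g a) then c' a else c a, Computable.cond hd hc' hc,
    fun a => ?_⟩
  by_cases hh : f a < g a
  · simp [hh, h', hh.le]
  · simp [hh, h, not_lt.1 hh]

theorem RatFamily.min {f g : α → ℝ} (hf : RatFamily f) (hg : RatFamily g) :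
    RatFamily fun a => min (f a) (g a) := by
  have := (hf.neg.max hg.neg).neg
  simpa [max_neg_neg] using this

theorem RatFamily.abs {f : α → ℝ} (hf : RatFamily f) : RatFamily fun a => |f a| := by
  simpa [abs_eq_max_neg] using hf.max hf.neg

theorem RatFamily.sum {f : α → ℕ → ℝ} (hf : RatFamily fun p : α × ℕ => f p.1 p.2) {n : α → ℕ}
    (hn : Computable n) : RatFamily fun a => ∑ i ∈ Finset.range (n a), f a i := by
  obtain ⟨c, hc, h⟩ := hf
  -- Addition is carried out on codes, so that the recursion for the sum has natural numbers as its
  -- values.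
  obtain ⟨p, hp, hadd⟩ := (RatFamily.code.reindex Computable.fst).add
    (RatFamily.code.reindex (Computable.snd (α := ℕ) (β := ℕ)))
  obtain ⟨o, ho⟩ := exists_rat 0
  refine ⟨fun a => Nat.rec o (fun k s => p (s, c (a, k))) (n a),
    Computable.nat_rec (h := fun a q => p (q.2, c (a, q.1))) hn (Computable.const o) ?_, fun a => ?_⟩
  · exact hp.comp (Computable.pair (Computable.snd.comp Computable.snd)
      (hc.comp (Computable.pair Computable.fst (Computable.fst.comp Computable.snd))))
  · beta_reduce
    induction n a with
    | zero => simpa using ho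
    | succ k ih =>
      rw [Finset.sum_range_succ, hadd]
      beta_reduce
      rw [ih, h]

theorem RatFamily.pow {f : α → ℝ} (hf : RatFamily f) {n : α → ℕ} (hn : Computable n) :
    RatFamily fun a => f a ^ n a := by
  obtain ⟨c, hc, h⟩ := hf
  obtain ⟨p, hp, hmul⟩ := (RatFamily.code.reindex Computable.fst).mul
    (RatFamily.code.reindex (Computable.snd (α := ℕ) (β := ℕ)))
  obtain ⟨o, ho⟩ := exists_rat 1
  refine ⟨fun a => Nat.rec o (fun k s => p (s, c a)) (n a),
    Computable.nat_rec (h := fun a q => p (q.2, c a)) hn (Computable.const o) ?_, fun a => ?_⟩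
  · exact hp.comp (Computable.pair (Computable.snd.comp Computable.snd) (hc.comp Computable.fst))
  · beta_reduce
    induction n a with
    | zero => simpa using ho
    | succ k ih =>
      rw [hmul]
      beta_reduce
      rw [ih, pow_succ, h]

theorem RatFamily.half_pow {n : α → ℕ} (hn : Computable n) :
    RatFamily fun a => (1 / 2 : ℝ) ^ n a := by
  have := (RatFamily.const (α := α) (1 / 2)).pow hn
  simpa using this

end RatFamily

theorem exists_rat_btwn' {x y : ℝ} (h : x < y) : ∃ n, x < rat n ∧ rat n < y := by
  obtain ⟨q, h1, h2⟩ := exists_rat_btwn h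
  obtain ⟨n, hn⟩ := exists_rat q
  exact ⟨n, by rwa [hn], by rwa [hn]⟩

/-! ## Predicates and real functions on presented spaces -/

section SemiDecOn

variable {α β : Type*} [Primcodable α] [Primcodable β]
  {Y Z : Type*} [MetricPresentation Y] [MetricPresentation Z]

/-- The predicate `P` is semidecidable from a parameter and a Cauchy name of a point of `S`. -/
def SemiDecOn (S : Set Z) (P : α → Z → Prop) : Prop :=
  ∃ Q, SemiDec Q ∧ ∀ z ∈ S, ∀ h, IsCauchyName h z → ∀ a, P a z ↔ Q a h

variable {S : Set Z} {P P' : α → Z → Prop}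

theorem SemiDecOn.congr (hP : SemiDecOn S P) (h : ∀ z ∈ S, ∀ a, P' a z ↔ P a z) :
    SemiDecOn S P' := by
  obtain ⟨Q, hQ, hh⟩ := hP
  exact ⟨Q, hQ, fun z hz g hg a => (h z hz a).trans (hh z hz g hg a)⟩

theorem SemiDecOn.mono {T : Set Z} (hP : SemiDecOn S P) (h : T ⊆ S) : SemiDecOn T P := by
  obtain ⟨Q, hQ, hh⟩ := hP
  exact ⟨Q, hQ, fun z hz => hh z (h hz)⟩

theorem SemiDec.on {p : α → Prop} (hp : SemiDec fun a _ => p a) :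
    SemiDecOn S fun a _ => p a :=
  ⟨_, hp, fun _ _ _ _ _ => Iff.rfl⟩

theorem SemiDecOn.and (hP : SemiDecOn S P) (hP' : SemiDecOn S P') :
    SemiDecOn S fun a z => P a z ∧ P' a z := by
  obtain ⟨Q, hQ, h⟩ := hP
  obtain ⟨Q', hQ', h'⟩ := hP'
  exact ⟨_, hQ.and hQ', fun z hz g hg a => and_congr (h z hz g hg a) (h' z hz g hg a)⟩

theorem SemiDecOn.or (hP : SemiDecOn S P) (hP' : SemiDecOn S P') :
    SemiDecOn S fun a z => P a z ∨ P' a z := by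
  obtain ⟨Q, hQ, h⟩ := hP
  obtain ⟨Q', hQ', h'⟩ := hP'
  exact ⟨_, hQ.or hQ', fun z hz g hg a => or_congr (h z hz g hg a) (h' z hz g hg a)⟩

theorem SemiDecOn.reindex (hP : SemiDecOn S P) {f : β → α} (hf : Computable f) :
    SemiDecOn S fun b z => P (f b) z := by
  obtain ⟨Q, hQ, h⟩ := hP
  exact ⟨_, hQ.reindex hf, fun z hz g hg b => h z hz g hg (f b)⟩

theorem SemiDecOn.ex {P : α → ℕ → Z → Prop} (hP : SemiDecOn S fun p : α × ℕ => P p.1 p.2) :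
    SemiDecOn S fun a z => ∃ m, P a m z := by
  obtain ⟨Q, hQ, h⟩ := hP
  exact ⟨_, SemiDec.ex (Q := fun a m => Q (a, m)) hQ,
    fun z hz g hg a => exists_congr fun m => h z hz g hg (a, m)⟩

theorem SemiDecOn.exList {P : α → List ℕ → Z → Prop}
    (hP : SemiDecOn S fun p : α × List ℕ => P p.1 p.2) :
    SemiDecOn S fun a z => ∃ l, P a l z := by
  obtain ⟨Q, hQ, h⟩ := hP
  exact ⟨_, SemiDec.exList (Q := fun a m => Q (a, m)) hQ,
    fun z hz g hg a => exists_congr fun m => h z hz g hg (a, m)⟩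

theorem SemiDecOn.ball {P : α → ℕ → Z → Prop} (hP : SemiDecOn S fun p : α × ℕ => P p.1 p.2)
    {n : α → ℕ} (hn : Computable n) : SemiDecOn S fun a z => ∀ i < n a, P a i z := by
  obtain ⟨Q, hQ, h⟩ := hP
  exact ⟨_, SemiDec.ball (Q := fun a m => Q (a, m)) hQ hn,
    fun z hz g hg a => forall₂_congr fun m _ => h z hz g hg (a, m)⟩

theorem SemiDecOn.exLT {P : α → ℕ → Z → Prop} (hP : SemiDecOn S fun p : α × ℕ => P p.1 p.2)
    {n : α → ℕ} (hn : Computable n) : SemiDecOn S fun a z => ∃ i < n a, P a i z := by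
  have hd : SemiDec fun (p : α × ℕ) _ => (p.2 : ℝ) < (n p.1 : ℝ) :=
    SemiDec.lt (RatFamily.nat Computable.snd) (RatFamily.nat (hn.comp Computable.fst))
  refine (SemiDecOn.ex (P := fun a i z => (i : ℝ) < (n a : ℝ) ∧ P a i z) (hd.on.and hP)).congr
    fun z _ a => by simp

theorem SemiDecOn.comap (hP : SemiDecOn S P) {f : Y → Z} {φ : ℕ → ℕ} (hφ : Primrec φ)
    (hf : ∀ h y, IsCauchyName h y → IsCauchyName (fun i => φ (h i)) (f y)) :
    SemiDecOn (f ⁻¹' S) fun a y => P a (f y) := by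
  obtain ⟨Q, hQ, h⟩ := hP
  exact ⟨_, hQ.comap (f := fun _ => φ) (hφ.comp Primrec.snd),
    fun y hy g hg a => h (f y) hy _ (hf g y hg) a⟩

/-- The real functions `f a` on `S` are computable uniformly in the parameter `a`, in terms of the
rational cuts. -/
def RealComputableOn (S : Set Z) (f : α → Z → ℝ) : Prop :=
  SemiDecOn S (fun (p : α × ℕ) z => rat p.2 < f p.1 z) ∧
    SemiDecOn S fun (p : α × ℕ) z => f p.1 z < rat p.2

variable {f g : α → Z → ℝ}

theorem RealComputableOn.congr (hf : RealComputableOn S f) (h : ∀ z ∈ S, ∀ a, g a z = f a z) :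
    RealComputableOn S g :=
  ⟨hf.1.congr fun z hz a => by rw [h z hz], hf.2.congr fun z hz a => by rw [h z hz]⟩

theorem RealComputableOn.mono {T : Set Z} (hf : RealComputableOn S f) (h : T ⊆ S) :
    RealComputableOn T f :=
  ⟨hf.1.mono h, hf.2.mono h⟩

theorem RealComputableOn.reindex (hf : RealComputableOn S f) {k : β → α} (hk : Computable k) :
    RealComputableOn S fun b => f (k b) :=
  ⟨hf.1.reindex (f := fun p : β × ℕ => (k p.1, p.2))
      (Computable.pair (hk.comp Computable.fst) Computable.snd),
    hf.2.reindex (f := fun p : β × ℕ => (k p.1, p.2))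
      (Computable.pair (hk.comp Computable.fst) Computable.snd)⟩

theorem RealComputableOn.comap (hf : RealComputableOn S f) {k : Y → Z} {φ : ℕ → ℕ}
    (hφ : Primrec φ) (hk : ∀ h y, IsCauchyName h y → IsCauchyName (fun i => φ (h i)) (k y)) :
    RealComputableOn (k ⁻¹' S) fun a y => f a (k y) :=
  ⟨hf.1.comap hφ hk, hf.2.comap hφ hk⟩

theorem RealComputableOn.rat_lt (hf : RealComputableOn S f) {r : α → ℝ} (hr : RatFamily r) :
    SemiDecOn S fun a z => r a < f a z := by
  obtain ⟨c, hc, h⟩ := hr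
  exact (hf.1.reindex (Computable.pair Computable.id hc)).congr fun z _ a => by simp [h]

theorem RealComputableOn.lt_rat (hf : RealComputableOn S f) {r : α → ℝ} (hr : RatFamily r) :
    SemiDecOn S fun a z => f a z < r a := by
  obtain ⟨c, hc, h⟩ := hr
  exact (hf.2.reindex (Computable.pair Computable.id hc)).congr fun z _ a => by simp [h]

theorem RealComputableOn.of_rat {r : α → ℝ} (hr : RatFamily r) :
    RealComputableOn S fun a _ => r a :=
  ⟨(SemiDec.lt (RatFamily.rat Computable.snd) (hr.reindex Computable.fst)).on,
    (SemiDec.lt (hr.reindex Computable.fst) (RatFamily.rat Computable.snd)).on⟩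

theorem RealComputableOn.neg (hf : RealComputableOn S f) :
    RealComputableOn S fun a z => -f a z := by
  have hn : RatFamily fun p : α × ℕ => -rat p.2 := (RatFamily.rat Computable.snd).neg
  exact ⟨((hf.reindex Computable.fst).lt_rat hn).congr fun z _ a => by rw [lt_neg],
    ((hf.reindex Computable.fst).rat_lt hn).congr fun z _ a => by rw [neg_lt]⟩

theorem RealComputableOn.max (hf : RealComputableOn S f) (hg : RealComputableOn S g) :
    RealComputableOn S fun a z => max (f a z) (g a z) :=
  ⟨(hf.1.or hg.1).congr fun _ _ _ => lt_max_iff, (hf.2.and hg.2).congr fun _ _ _ => max_lt_iff⟩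

theorem RealComputableOn.min (hf : RealComputableOn S f) (hg : RealComputableOn S g) :
    RealComputableOn S fun a z => min (f a z) (g a z) :=
  ⟨(hf.1.and hg.1).congr fun _ _ _ => lt_min_iff, (hf.2.or hg.2).congr fun _ _ _ => min_lt_iff⟩

theorem lt_add_iff_exists_rat {p x y : ℝ} :
    p < x + y ↔ ∃ m n, (rat m < x ∧ rat n < y) ∧ p < rat m + rat n := by
  constructor
  · intro h
    obtain ⟨m, h1, h2⟩ := exists_rat_btwn' (x := x - (x + y - p) / 2) (y := x) (by linarith)
    obtain ⟨n, h3, h4⟩ := exists_rat_btwn' (x := y - (x + y - p) / 2) (y := y) (by linarith)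
    exact ⟨m, n, ⟨h2, h4⟩, by linarith⟩
  · rintro ⟨m, n, ⟨h1, h2⟩, h3⟩
    linarith

theorem SemiDecOn.rat_lt_add (hf : SemiDecOn S (fun (p : α × ℕ) z => rat p.2 < f p.1 z))
    (hg : SemiDecOn S (fun (p : α × ℕ) z => rat p.2 < g p.1 z)) :
    SemiDecOn S (fun (p : α × ℕ) z => rat p.2 < f p.1 z + g p.1 z) := by
  have h1 : SemiDecOn S fun (p : ((α × ℕ) × ℕ) × ℕ) z =>
      (rat p.1.2 < f p.1.1.1 z ∧ rat p.2 < g p.1.1.1 z) ∧ rat p.1.1.2 < rat p.1.2 + rat p.2 := by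
    have c1 : Computable fun p : ((α × ℕ) × ℕ) × ℕ => p.1.1.1 :=
      Computable.fst.comp (Computable.fst.comp Computable.fst)
    have c2 : Computable fun p : ((α × ℕ) × ℕ) × ℕ => p.1.2 := Computable.snd.comp Computable.fst
    have c3 : Computable fun p : ((α × ℕ) × ℕ) × ℕ => p.1.1.2 :=
      Computable.snd.comp (Computable.fst.comp Computable.fst)
    exact ((hf.reindex (c1.pair c2)).and (hg.reindex (c1.pair Computable.snd))).and
      (SemiDec.lt (RatFamily.rat c3)
        ((RatFamily.rat c2).add (RatFamily.rat Computable.snd))).on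
  exact (SemiDecOn.ex (SemiDecOn.ex (P := fun (p : (α × ℕ) × ℕ) n z => _) h1)).congr
    fun _ _ _ => lt_add_iff_exists_rat

/-- The upper cut of `f` is the lower cut of `-f`; hence closure properties need a proof for lower
cuts only. -/
theorem RealComputableOn.of_neg_lt {f : α → Z → ℝ}
    (h1 : SemiDecOn S (fun (p : α × ℕ) z => rat p.2 < f p.1 z))
    (h2 : SemiDecOn S (fun (p : α × ℕ) z => rat p.2 < -f p.1 z)) : RealComputableOn S f := by
  refine ⟨h1, ?_⟩
  obtain ⟨c, hc, h⟩ := (RatFamily.rat (Computable.snd (α := α) (β := ℕ))).neg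
  exact (h2.reindex (Computable.pair Computable.fst hc)).congr fun z _ p => by
    simp only [h, neg_lt_neg_iff]

theorem RealComputableOn.add (hf : RealComputableOn S f) (hg : RealComputableOn S g) :
    RealComputableOn S fun a z => f a z + g a z :=
  .of_neg_lt (hf.1.rat_lt_add hg.1) ((SemiDecOn.rat_lt_add (f := fun a z => -f a z)
    (g := fun a z => -g a z) hf.neg.1 hg.neg.1).congr fun z _ a => by
    rw [neg_add])

theorem RealComputableOn.sub (hf : RealComputableOn S f) (hg : RealComputableOn S g) :
    RealComputableOn S fun a z => f a z - g a z :=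
  (hf.add hg.neg).congr fun _ _ _ => sub_eq_add_neg _ _

/-- The real `x` is enclosed between two rationals and `y ↦ r * y` is bounded below by its values at
the ends; this avoids a case distinction on the sign of `r`. -/
theorem lt_mul_iff_exists_rat {p r x : ℝ} :
    p < r * x ↔ ∃ m n, (rat m < x ∧ x < rat n) ∧ p < Min.min (r * rat m) (r * rat n) := by
  constructor
  · intro h
    -- The summand `1` covers `r = 0` and makes `|r| * ε` strictly smaller than `r * x - p`.
    set ε := (r * x - p) / (|r| + 1) with hε
    have h0 : 0 < |r| + 1 := by positivity
    have hε0 : 0 < ε := div_pos (by linarith) h0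
    have h1 : (|r| + 1) * ε = r * x - p := by rw [hε]; field_simp
    obtain ⟨m, h2, h3⟩ := exists_rat_btwn' (x := x - ε) (y := x) (by linarith)
    obtain ⟨n, h4, h5⟩ := exists_rat_btwn' (x := x) (y := x + ε) (by linarith)
    have key : ∀ y, |y - x| < ε → p < r * y := by
      intro y hy
      have h6 : |r * (y - x)| ≤ |r| * ε := by
        rw [abs_mul]; exact mul_le_mul_of_nonneg_left hy.le (abs_nonneg r)
      have := (abs_le.1 h6).1
      nlinarith
    exact ⟨m, n, ⟨h3, h4⟩, lt_min (key _ (by rw [abs_lt]; constructor <;> linarith))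
      (key _ (by rw [abs_lt]; constructor <;> linarith))⟩
  · rintro ⟨m, n, ⟨h1, h2⟩, h3⟩
    have h4 := lt_min_iff.1 h3
    rcases le_total 0 r with hr | hr
    · exact h4.1.trans_le (mul_le_mul_of_nonneg_left h1.le hr)
    · exact h4.2.trans_le (mul_le_mul_of_nonpos_left h2.le hr)

theorem RealComputableOn.rat_mul (hf : RealComputableOn S f) {r : α → ℝ} (hr : RatFamily r) :
    RealComputableOn S fun a z => r a * f a z := by
  have c1 : Computable fun p : ((α × ℕ) × ℕ) × ℕ => p.1.1.1 :=
    Computable.fst.comp (Computable.fst.comp Computable.fst)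
  have c2 : Computable fun p : ((α × ℕ) × ℕ) × ℕ => p.1.2 := Computable.snd.comp Computable.fst
  have c3 : Computable fun p : ((α × ℕ) × ℕ) × ℕ => p.1.1.2 :=
    Computable.snd.comp (Computable.fst.comp Computable.fst)
  have key : ∀ r : α → ℝ, RatFamily r →
      SemiDecOn S fun (p : α × ℕ) z => rat p.2 < r p.1 * f p.1 z := by
    intro r hr
    have hr1 := hr.reindex c1
    have h1 : SemiDecOn S fun (p : ((α × ℕ) × ℕ) × ℕ) z =>
        (rat p.1.2 < f p.1.1.1 z ∧ f p.1.1.1 z < rat p.2) ∧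
          rat p.1.1.2 < Min.min (r p.1.1.1 * rat p.1.2) (r p.1.1.1 * rat p.2) :=
      ((hf.1.reindex (c1.pair c2)).and (hf.2.reindex (c1.pair Computable.snd))).and
        (SemiDec.lt (RatFamily.rat c3) ((hr1.mul (RatFamily.rat c2)).min
          (hr1.mul (RatFamily.rat Computable.snd)))).on
    exact (SemiDecOn.ex (SemiDecOn.ex (P := fun (p : (α × ℕ) × ℕ) n z => _) h1)).congr
      fun _ _ _ => lt_mul_iff_exists_rat
  exact .of_neg_lt (key r hr) ((key _ hr.neg).congr fun z _ a => by rw [neg_mul])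

/-- The maximum of `0` and the first `n` values of `f`. -/
def maxUpTo (f : ℕ → ℝ) : ℕ → ℝ
  | 0 => 0
  | n + 1 => Max.max (f n) (maxUpTo f n)

theorem lt_maxUpTo {f : ℕ → ℝ} {n : ℕ} {p : ℝ} : p < maxUpTo f n ↔ p < 0 ∨ ∃ i < n, p < f i := by
  induction n with
  | zero => simp [maxUpTo]
  | succ n ih =>
    rw [maxUpTo, lt_max_iff, ih]
    simp only [Nat.exists_lt_succ_right]
    rw [or_comm (a := p < f n), or_assoc]

theorem maxUpTo_lt {f : ℕ → ℝ} {n : ℕ} {p : ℝ} : maxUpTo f n < p ↔ 0 < p ∧ ∀ i < n, f i < p := by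
  induction n with
  | zero => simp [maxUpTo]
  | succ n ih =>
    rw [maxUpTo, max_lt_iff, ih]
    simp only [Nat.forall_lt_succ_right]
    tauto

theorem maxUpTo_le {f : ℕ → ℝ} {n : ℕ} {p : ℝ} (h0 : 0 ≤ p) (h : ∀ i < n, f i ≤ p) :
    maxUpTo f n ≤ p := by
  by_contra! hlt
  rcases lt_maxUpTo.1 hlt with h1 | ⟨i, hi, h1⟩
  · linarith
  · linarith [h i hi]

theorem maxUpTo_nonneg (f : ℕ → ℝ) (n : ℕ) : 0 ≤ maxUpTo f n := by
  by_contra! h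
  linarith [(maxUpTo_lt.1 h).1]

theorem le_maxUpTo (f : ℕ → ℝ) {i n : ℕ} (h : i < n) : f i ≤ maxUpTo f n := by
  by_contra! h'
  exact lt_irrefl _ ((maxUpTo_lt.1 h').2 i h)

theorem maxUpTo_mono (f : ℕ → ℝ) : Monotone (maxUpTo f) :=
  fun _ _ h => maxUpTo_le (maxUpTo_nonneg _ _) fun _ hi => le_maxUpTo f (hi.trans_le h)

theorem RealComputableOn.maxUpTo {f : α → ℕ → Z → ℝ}
    (hf : RealComputableOn S fun p : α × ℕ => f p.1 p.2) {n : α → ℕ} (hn : Computable n) :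
    RealComputableOn S fun a z => maxUpTo (fun i => f a i z) (n a) := by
  have c1 : Computable fun p : (α × ℕ) × ℕ => (p.1.1, p.2) :=
    (Computable.fst.comp Computable.fst).pair Computable.snd
  have c2 : Computable fun p : (α × ℕ) × ℕ => p.1.2 := Computable.snd.comp Computable.fst
  have hc : RatFamily fun p : α × ℕ => rat p.2 := RatFamily.rat Computable.snd
  have hn' : Computable fun p : α × ℕ => n p.1 := hn.comp Computable.fst
  have q1 := (hf.reindex c1).rat_lt (RatFamily.rat c2)
  have q2 := (hf.reindex c1).lt_rat (RatFamily.rat c2)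
  have h1 := SemiDecOn.exLT (P := fun (p : α × ℕ) i z => rat p.2 < f p.1 i z) q1 hn'
  have h2 := SemiDecOn.ball (P := fun (p : α × ℕ) i z => f p.1 i z < rat p.2) q2 hn'
  exact ⟨((SemiDec.lt hc RatFamily.zero).on.or h1).congr fun _ _ _ => lt_maxUpTo,
    ((SemiDec.lt RatFamily.zero hc).on.and h2).congr fun _ _ _ => maxUpTo_lt⟩

end SemiDecOn

/-! ## Presented spaces with a distance that is computable on basic points -/

section Effective

/-- The distance is a pseudometric. -/
class PseudoMetricPresentation (Z : Type*) [MetricPresentation Z] : Prop where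
  d_self (x : Z) : d x x = 0
  d_comm (x y : Z) : d x y = d y x
  d_triangle (x y z : Z) : d x z ≤ d x y + d y z

/-- The basic points are dense and their mutual distances are computable. -/
class EffectivePresentation (Z : Type*) [MetricPresentation Z] : Prop
    extends PseudoMetricPresentation Z where
  dense (z : Z) (ε : ℝ) : 0 < ε → ∃ i, d (pt i) z < ε
  lt_d : SemiDec fun (p : (ℕ × ℕ) × ℕ) _ => rat p.2 < d (pt p.1.1 : Z) (pt p.1.2)
  d_lt : SemiDec fun (p : (ℕ × ℕ) × ℕ) _ => d (pt p.1.1 : Z) (pt p.1.2) < rat p.2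

open PseudoMetricPresentation EffectivePresentation

variable {Z : Type*} [MetricPresentation Z]

section Pseudo

variable [PseudoMetricPresentation Z]

theorem d_nonneg (x y : Z) : 0 ≤ d x y := by
  have h1 := d_triangle x y x
  rw [d_self, d_comm y x] at h1
  linarith

theorem IsCauchyName.d_le {h : ℕ → ℕ} {z : Z} (hz : IsCauchyName h z) (i : ℕ) :
    d (pt (h i)) z ≤ (1 / 2 : ℝ) ^ i := by
  have h1 : Tendsto (fun j => (1 / 2 : ℝ) ^ i + d (pt (h j)) z) atTop (𝓝 ((1 / 2 : ℝ) ^ i + 0)) :=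
    tendsto_const_nhds.add hz.2
  rw [add_zero] at h1
  refine ge_of_tendsto h1 (eventually_atTop.2 ⟨i, fun j hj => ?_⟩)
  have h2 := d_triangle (pt (h i)) (pt (h j)) z
  rw [d_comm (pt (h i)) (pt (h j))] at h2
  linarith [hz.1 i j hj]

/-- The spare factor `1/2` pays for the detour through `z`: two errors of at most `2^{-(i+1)}` add
up to `2^{-i}`. -/
theorem isCauchyName_of_le {h : ℕ → ℕ} {z : Z}
    (hz : ∀ i, d (pt (h i)) z ≤ (1 / 2 : ℝ) ^ (i + 1)) : IsCauchyName h z := by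
  refine ⟨fun i j hij => ?_, ?_⟩
  · have h1 := d_triangle (pt (h j)) z (pt (h i))
    rw [d_comm z] at h1
    have h2 : (1 / 2 : ℝ) ^ (j + 1) ≤ (1 / 2 : ℝ) ^ (i + 1) :=
      pow_le_pow_of_le_one (by norm_num) (by norm_num) (by omega)
    have h3 : (1 / 2 : ℝ) ^ (i + 1) = (1 / 2 : ℝ) ^ i / 2 := by rw [pow_succ]; ring
    linarith [hz i, hz j]
  · have h1 : Tendsto (fun i : ℕ => (1 / 2 : ℝ) ^ (i + 1)) atTop (𝓝 0) :=
      (tendsto_pow_atTop_nhds_zero_of_lt_one (by norm_num) (by norm_num)).comp (tendsto_add_atTop_nat 1)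
    exact squeeze_zero (fun i => d_nonneg _ _) hz h1

theorem exists_half_pow_lt {ε : ℝ} (h : 0 < ε) : ∃ i : ℕ, (1 / 2 : ℝ) ^ i < ε :=
  exists_pow_lt_of_lt_one h (by norm_num)

end Pseudo

instance : PseudoMetricPresentation ℝ where
  d_self := dist_self
  d_comm := dist_comm
  d_triangle := dist_triangle

-- Computable real functions: functionals on names versus rational cuts

variable {α : Type*} [Primcodable α]

/-- Many witnesses may be valid, but an answer once given must not change when more of the oracle is
read. The machine therefore returns to the shortest prefix on which the bounded search succeeds and
answers with the least witness found there. -/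
theorem SemiDec.choose {Q : ℕ → ℕ → (ℕ → ℕ) → Prop} (hQ : SemiDec fun p : ℕ × ℕ => Q p.1 p.2) :
    ∃ F, PartialComputable F ∧ ∀ h, (∀ i, ∃ c, Q i c h) → ∃ g ∈ F h, ∀ i, Q i (g i) h := by
  obtain ⟨R, hR, hm, hh⟩ := hQ
  let att : List ℕ → ℕ → Option ℕ := fun σ i => (List.range σ.length).find? fun c => R σ (i, c)
  let stage : List ℕ → ℕ → Option ℕ := fun σ i =>
    (List.range (σ.length + 1)).find? fun k => (att (σ.take k) i).isSome
  let run : List ℕ → ℕ → Option ℕ := fun σ i => (stage σ i).bind fun k => att (σ.take k) i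
  have hatt : Computable₂ att := by
    refine computable_find_range (Computable.list_length.comp Computable.fst) ?_
    exact hR.comp (Computable.fst.comp Computable.fst)
      (Computable.pair (Computable.snd.comp Computable.fst) Computable.snd)
  have htake : Computable fun p : (List ℕ × ℕ) × ℕ => att (p.1.1.take p.2) p.1.2 :=
    hatt.comp ((Primrec.list_take.to_comp).comp Computable.snd
      (Computable.fst.comp Computable.fst)) (Computable.snd.comp Computable.fst)
  have hstage : Computable₂ stage :=
    computable_find_range (Computable.succ.comp (Computable.list_length.comp Computable.fst))
      ((Primrec.option_isSome.to_comp).comp htake)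
  have hrun : Computable₂ run := Computable.option_bind hstage htake
  have hrun_mono : ∀ σ τ i m, σ <+: τ → run σ i = some m → run τ i = some m := by
    intro σ τ i m hst hs
    obtain ⟨k, hk, hkm⟩ := Option.bind_eq_some_iff.1 hs
    have hk' := List.mem_of_find?_eq_some hk
    have htk : ∀ j ≤ σ.length, τ.take j = σ.take j := by
      intro j hj
      obtain ⟨r, rfl⟩ := hst
      rw [List.take_append_of_le_length hj]
    obtain ⟨r, hr⟩ := hst
    have hlen : τ.length = σ.length + r.length := by rw [← hr]; simp
    have e1 : stage τ i = some k := by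
      have e2 : stage τ i = ((List.range (σ.length + 1)).find? fun k =>
          (att (τ.take k) i).isSome).or (((List.range r.length).map (σ.length + 1 + ·)).find? fun k =>
            (att (τ.take k) i).isSome) := by
        rw [← List.find?_append, ← List.range_add]
        simp only [stage, hlen]
        congr 2
        ring
      have e3 : ((List.range (σ.length + 1)).find? fun k => (att (τ.take k) i).isSome) =
          stage σ i := by
        have : ∀ l : List ℕ, (∀ x ∈ l, x ≤ σ.length) →
            (l.find? fun k => (att (τ.take k) i).isSome) =
              l.find? fun k => (att (σ.take k) i).isSome := by
          intro l hl
          induction l with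
          | nil => rfl
          | cons x l ih =>
            simp only [List.find?_cons, htk x (hl x (by simp)),
              ih fun y hy => hl y (by simp [hy])]
        exact this _ fun x hx => by rw [List.mem_range] at hx; omega
      rw [e2, e3, hk]
      rfl
    change (stage τ i).bind _ = _
    rw [e1]
    simp only [Option.bind_some]
    rw [List.mem_range] at hk'
    rw [htk k (by omega)]
    exact hkm
  let F : (ℕ → ℕ) →. (ℕ → ℕ) := fun h =>
    ⟨∃ g : ℕ → ℕ, ∀ n, ∃ k, run (initSeg h k) n = some (g n), fun hg => hg.choose⟩
  have hF : ∀ h g, g ∈ F h ↔ ∀ n, ∃ k, run (initSeg h k) n = some (g n) := by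
    intro h g
    constructor
    · rintro ⟨hg, rfl⟩
      exact hg.choose_spec
    · intro hg
      refine ⟨⟨g, hg⟩, ?_⟩
      funext n
      have hg' : ∃ g : ℕ → ℕ, ∀ n, ∃ k, run (initSeg h k) n = some (g n) := ⟨g, hg⟩
      obtain ⟨k, hk⟩ := hg'.choose_spec n
      obtain ⟨l, hl⟩ := hg n
      have h1 := hrun_mono _ _ _ _ (initSeg_prefix h (le_max_left k l)) hk
      have h2 := hrun_mono _ _ _ _ (initSeg_prefix h (le_max_right k l)) hl
      rw [h1] at h2
      exact Option.some.inj h2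
  refine ⟨F, ⟨run, hrun, hrun_mono, hF⟩, fun h hc => ?_⟩
  have hex : ∀ i, ∃ c, (∃ k, run (initSeg h k) i = some c) ∧ Q i c h := by
    intro i
    obtain ⟨c, hc⟩ := hc i
    obtain ⟨k, hk⟩ := (hh (i, c) h).1 hc
    -- Long enough for `c` to be accepted and to lie within the range of the search.
    set K := max k (c + 1) with hK
    have h1 : R (initSeg h K) (i, c) = true := hm _ _ _ (initSeg_prefix h (le_max_left _ _)) hk
    have h2 : (att ((initSeg h K).take K) i).isSome := by
      rw [take_initSeg h le_rfl, List.find?_isSome]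
      exact ⟨c, by simp [hK], h1⟩
    have h3 : (stage (initSeg h K) i).isSome := by
      rw [List.find?_isSome]
      exact ⟨K, by simp, h2⟩
    obtain ⟨s, hs⟩ := Option.isSome_iff_exists.1 h3
    have hs1 := List.find?_some hs
    have hs2 := List.mem_of_find?_eq_some hs
    rw [List.mem_range, length_initSeg] at hs2
    obtain ⟨m, hm'⟩ := Option.isSome_iff_exists.1 hs1
    refine ⟨m, ⟨K, ?_⟩, ?_⟩
    · change (stage _ i).bind _ = _
      rw [hs]
      exact hm'
    · rw [take_initSeg h (by omega)] at hm'
      have h4 : R (initSeg h s) (i, m) = true := by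
        simpa using List.find?_some (p := fun c => R (initSeg h s) (i, c)) hm'
      exact (hh (i, m) h).2 ⟨s, h4⟩
  choose g hg1 hg2 using hex
  exact ⟨g, (hF h g).2 hg1, hg2⟩

theorem RealComputableOn.computableFunOn {S : Set Z} {f : Z → ℝ}
    (hf : RealComputableOn S fun (_ : Unit) z => f z) : ComputableFunOn f S := by
  have h1 : SemiDecOn S fun (p : ℕ × ℕ) z => rat p.2 - (1 / 2 : ℝ) ^ (p.1 + 1) < f z ∧
      f z < rat p.2 + (1 / 2 : ℝ) ^ (p.1 + 1) := by
    have hp : RatFamily fun p : ℕ × ℕ => (1 / 2 : ℝ) ^ (p.1 + 1) :=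
      RatFamily.half_pow (Computable.succ.comp Computable.fst)
    have hc : RatFamily fun p : ℕ × ℕ => rat p.2 := RatFamily.rat Computable.snd
    have hf' := hf.reindex (k := fun _ : ℕ × ℕ => ()) (Computable.const ())
    exact (hf'.rat_lt (hc.sub hp)).and (hf'.lt_rat (hc.add hp))
  obtain ⟨Q, hQ, h⟩ := h1
  obtain ⟨F, hF, hF'⟩ := SemiDec.choose (Q := fun i c => Q (i, c)) hQ
  refine ⟨F, hF, fun z hz g hg => ?_⟩
  obtain ⟨k, hk, hk'⟩ := hF' g fun i => by
    have hp : 0 < (1 / 2 : ℝ) ^ (i + 1) := by positivity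
    obtain ⟨c, hc1, hc2⟩ := exists_rat_btwn' (x := f z - (1 / 2 : ℝ) ^ (i + 1))
      (y := f z + (1 / 2 : ℝ) ^ (i + 1)) (by linarith)
    exact ⟨c, (h z hz g hg (i, c)).1 ⟨by linarith, by linarith⟩⟩
  refine ⟨k, hk, isCauchyName_of_le fun i => ?_⟩
  have := (h z hz g hg (i, k i)).2 (hk' i)
  change dist (rat (k i)) (f z) ≤ _
  rw [Real.dist_eq, abs_le]
  constructor <;> linarith [this.1, this.2]

/-- Entry `i` of the output name is within `2^{-i}` of the value, so a strict rational inequality is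
confirmed by some entry with room to spare. Which stage produced the entry is irrelevant, because
answers are stable. -/
theorem ComputableFunOn.realComputableOn {S : Set Z} {f : Z → ℝ} (hf : ComputableFunOn f S) :
    RealComputableOn S fun (_ : Unit) z => f z := by
  obtain ⟨F, ⟨run, hrun, hmono, hF⟩, h⟩ := hf
  have h0 : SemiDec fun (p : ℕ × ℕ) h => ∃ k, run (initSeg h k) p.1 = some p.2 := by
    refine ⟨fun σ p => decide (run σ p.1 = some p.2), ?_, fun σ τ p hst hs => ?_, fun p h => ?_⟩
    · have : Computable₂ fun a b : Option ℕ => decide (a = b) := by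
        have : Primrec fun p : Option ℕ × Option ℕ => decide (p.1 = p.2) :=
          PrimrecPred.decide Primrec.eq
        exact this.to_comp
      exact this.comp (hrun.comp Computable.fst (Computable.fst.comp Computable.snd))
        (Computable.option_some.comp (Computable.snd.comp Computable.snd))
    · simp only [decide_eq_true_eq] at hs ⊢
      exact hmono _ _ _ _ hst hs
    · simp
  have hval : ∀ z ∈ S, ∀ h, IsCauchyName h z → ∀ i m, (∃ k, run (initSeg h k) i = some m) →
      |rat m - f z| ≤ (1 / 2 : ℝ) ^ i := by
    rintro z hz g hg i m ⟨k, hk⟩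
    obtain ⟨g', hg', hn⟩ := h z hz g hg
    obtain ⟨l, hl⟩ := (hF g g').1 hg' i
    have h1 := hmono _ _ _ _ (initSeg_prefix g (le_max_left k l)) hk
    have h2 := hmono _ _ _ _ (initSeg_prefix g (le_max_right k l)) hl
    rw [h1] at h2
    rw [Option.some.inj h2]
    exact hn.d_le i
  have hex : ∀ z ∈ S, ∀ h, IsCauchyName h z → ∀ i, ∃ m, ∃ k, run (initSeg h k) i = some m := by
    intro z hz g hg i
    obtain ⟨g', hg', -⟩ := h z hz g hg
    exact ⟨g' i, (hF g g').1 hg' i⟩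
  have c1 : Computable fun p : ((Unit × ℕ) × ℕ) × ℕ => (p.1.2, p.2) :=
    (Computable.snd.comp Computable.fst).pair Computable.snd
  have r1 : RatFamily fun p : ((Unit × ℕ) × ℕ) × ℕ => rat p.2 := RatFamily.rat Computable.snd
  have r2 : RatFamily fun p : ((Unit × ℕ) × ℕ) × ℕ => (1 / 2 : ℝ) ^ p.1.2 :=
    RatFamily.half_pow (Computable.snd.comp Computable.fst)
  have r3 : RatFamily fun p : ((Unit × ℕ) × ℕ) × ℕ => rat p.1.1.2 :=
    RatFamily.rat (Computable.snd.comp (Computable.fst.comp Computable.fst))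
  constructor
  · have h1 : SemiDec fun (p : ((Unit × ℕ) × ℕ) × ℕ) h =>
        (∃ k, run (initSeg h k) p.1.2 = some p.2) ∧ rat p.1.1.2 < rat p.2 - (1 / 2 : ℝ) ^ p.1.2 :=
      (h0.reindex c1).and (SemiDec.lt r3 (r1.sub r2))
    have h2 := SemiDec.ex (α := (Unit × ℕ) × ℕ) (Q := fun p m h =>
      (∃ k, run (initSeg h k) p.2 = some m) ∧ rat p.1.2 < rat m - (1 / 2 : ℝ) ^ p.2) h1
    have h3 := SemiDec.ex (α := Unit × ℕ) (Q := fun p i h => ∃ m,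
      (∃ k, run (initSeg h k) i = some m) ∧ rat p.2 < rat m - (1 / 2 : ℝ) ^ i) h2
    refine ⟨_, h3,
      fun z hz g hg p => ⟨fun hp => ?_, ?_⟩⟩
    · obtain ⟨i, hi⟩ := exists_half_pow_lt (ε := (f z - rat p.2) / 2) (by linarith)
      obtain ⟨m, hm⟩ := hex z hz g hg i
      have := abs_le.1 (hval z hz g hg i m hm)
      exact ⟨i, m, hm, by linarith [this.1]⟩
    · rintro ⟨i, m, hm, hlt⟩
      have := abs_le.1 (hval z hz g hg i m hm)
      have hlt' : rat p.2 < rat m - (1 / 2 : ℝ) ^ i := hlt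
      linarith [this.2]
  · have h1 : SemiDec fun (p : ((Unit × ℕ) × ℕ) × ℕ) h =>
        (∃ k, run (initSeg h k) p.1.2 = some p.2) ∧ rat p.2 + (1 / 2 : ℝ) ^ p.1.2 < rat p.1.1.2 :=
      (h0.reindex c1).and (SemiDec.lt (r1.add r2) r3)
    have h2 := SemiDec.ex (α := (Unit × ℕ) × ℕ) (Q := fun p m h =>
      (∃ k, run (initSeg h k) p.2 = some m) ∧ rat m + (1 / 2 : ℝ) ^ p.2 < rat p.1.2) h1
    have h3 := SemiDec.ex (α := Unit × ℕ) (Q := fun p i h => ∃ m,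
      (∃ k, run (initSeg h k) i = some m) ∧ rat m + (1 / 2 : ℝ) ^ i < rat p.2) h2
    refine ⟨_, h3,
      fun z hz g hg p => ⟨fun hp => ?_, ?_⟩⟩
    · obtain ⟨i, hi⟩ := exists_half_pow_lt (ε := (rat p.2 - f z) / 2) (by linarith)
      obtain ⟨m, hm⟩ := hex z hz g hg i
      have := abs_le.1 (hval z hz g hg i m hm)
      exact ⟨i, m, hm, by linarith [this.2]⟩
    · rintro ⟨i, m, hm, hlt⟩
      have := abs_le.1 (hval z hz g hg i m hm)
      have hlt' : rat m + (1 / 2 : ℝ) ^ i < rat p.2 := hlt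
      linarith [this.1]

end Effective

section Effective

open PseudoMetricPresentation EffectivePresentation

variable {α : Type*} [Primcodable α]
  {Y Z : Type*} [MetricPresentation Y] [MetricPresentation Z]

/-! ## Names of pairs -/

theorem isCauchyName_prod [PseudoMetricPresentation Y] [PseudoMetricPresentation Z] {h : ℕ → ℕ}
    {p : Y × Z} : IsCauchyName h p ↔ IsCauchyName (fun i => (h i).unpair.1) p.1 ∧
      IsCauchyName (fun i => (h i).unpair.2) p.2 := by
  constructor
  · rintro ⟨h1, h2⟩
    refine ⟨⟨fun i j hij => (le_max_left _ _).trans (h1 i j hij), ?_⟩,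
      ⟨fun i j hij => (le_max_right _ _).trans (h1 i j hij), ?_⟩⟩
    · exact squeeze_zero (fun _ => d_nonneg _ _) (fun _ => le_max_left _ _) h2
    · exact squeeze_zero (fun _ => d_nonneg _ _) (fun _ => le_max_right _ _) h2
  · rintro ⟨h1, h2⟩
    refine ⟨fun i j hij => max_le (h1.1 i j hij) (h2.1 i j hij), ?_⟩
    have := h1.2.max h2.2
    rwa [max_self] at this

instance : PseudoMetricPresentation ℕ where
  d_self := dist_self
  d_comm := dist_comm
  d_triangle := dist_triangle

instance [PseudoMetricPresentation Y] [PseudoMetricPresentation Z] :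
    PseudoMetricPresentation (Y × Z) where
  d_self p := by
    change max (d p.1 p.1) (d p.2 p.2) = 0
    rw [d_self, d_self, max_self]
  d_comm p q := by
    change max (d p.1 q.1) (d p.2 q.2) = max (d q.1 p.1) (d q.2 p.2)
    rw [d_comm p.1, d_comm p.2]
  d_triangle p q r := max_le
    ((d_triangle p.1 q.1 r.1).trans (add_le_add (le_max_left _ _) (le_max_left _ _)))
    ((d_triangle p.2 q.2 r.2).trans (add_le_add (le_max_right _ _) (le_max_right _ _)))

/-- Distinct naturals are at distance at least `1`, while entry `1` has error at most `1/2`. Entry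
`0`, with tolerance `1`, would not suffice. -/
theorem IsCauchyName.eq_of_nat {h : ℕ → ℕ} {n : ℕ} (hn : IsCauchyName h n) : h 1 = n := by
  have h1 : dist (h 1) n ≤ (1 / 2 : ℝ) ^ 1 := hn.d_le 1
  by_contra hne
  rw [Nat.dist_eq] at h1
  have h2 : (1 : ℤ) ≤ |(h 1 : ℤ) - n| := Int.one_le_abs (by omega)
  have h3 : (1 : ℝ) ≤ |(h 1 : ℝ) - n| := by exact_mod_cast h2
  norm_num at h1
  linarith

theorem isCauchyName_const (n : ℕ) : IsCauchyName (fun _ => n) n := by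
  refine isCauchyName_of_le fun i => ?_
  change dist n n ≤ _
  rw [dist_self]
  positivity

/-- The natural number is read off from entry `1` of the name of the pair and becomes the parameter;
in the converse `RealComputableOn.curry` it is supplied as a constant name. -/
theorem RealComputableOn.uncurry [PseudoMetricPresentation Z] {S : Set Z} {f : ℕ → Z → ℝ}
    (hf : RealComputableOn S f) :
    RealComputableOn (univ ×ˢ S) fun (_ : Unit) (p : ℕ × Z) => f p.1 p.2 := by
  have key : ∀ P : ℕ × ℕ → Z → Prop, SemiDecOn S P → SemiDecOn (univ ×ˢ S)
      fun (q : Unit × ℕ) (p : ℕ × Z) => P (p.1, q.2) p.2 := by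
    rintro P ⟨Q, hQ, h⟩
    have h1 := hQ.comap (f := fun _ m => m.unpair.2)
      ((Primrec.snd.comp (Primrec.unpair.comp Primrec.snd)).to₂)
    have h2 : SemiDec fun (p : (Unit × ℕ) × ℕ) h =>
        Q (p.2.unpair.1, p.1.2) fun i => (h i).unpair.2 :=
      h1.reindex (f := fun p : (Unit × ℕ) × ℕ => (p.2.unpair.1, p.1.2))
        ((Computable.fst.comp (Computable.unpair.comp Computable.snd)).pair
          (Computable.snd.comp Computable.fst))
    have h3 := SemiDec.oracle (Q := fun (p : Unit × ℕ) m h =>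
      Q (m.unpair.1, p.2) fun i => (h i).unpair.2) h2 (n := fun _ => 1) (Computable.const 1)
    refine ⟨_, h3, fun p hp g hg q => ?_⟩
    obtain ⟨hg1, hg2⟩ := isCauchyName_prod.1 hg
    rw [hg1.eq_of_nat]
    exact h p.2 hp.2 _ hg2 (p.1, q.2)
  exact ⟨key _ hf.1, key _ hf.2⟩

theorem RealComputableOn.curry [PseudoMetricPresentation Z] {S : Set Z} {f : ℕ × Z → ℝ}
    (hf : RealComputableOn (univ ×ˢ S) fun (_ : Unit) p => f p) :
    RealComputableOn S fun n z => f (n, z) := by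
  have key : ∀ P : Unit × ℕ → ℕ × Z → Prop, SemiDecOn (univ ×ˢ S) P →
      SemiDecOn S fun (q : ℕ × ℕ) z => P ((), q.2) (q.1, z) := by
    rintro P ⟨Q, hQ, h⟩
    have h1 : SemiDec fun (q : ℕ × ℕ) h => Q ((), q.2) h :=
      hQ.reindex (f := fun q : ℕ × ℕ => ((), q.2)) ((Computable.const ()).pair Computable.snd)
    have h2 := h1.comap (f := fun q m => Nat.pair q.1 m)
      (Primrec₂.natPair.comp (Primrec.fst.comp Primrec.fst) Primrec.snd).to₂
    refine ⟨_, h2, fun z hz g hg q => h (q.1, z) ⟨trivial, hz⟩ _ ?_ _⟩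
    rw [isCauchyName_prod]
    simp only [Nat.unpair_pair]
    exact ⟨isCauchyName_const _, hg⟩
  exact ⟨key _ hf.1, key _ hf.2⟩

/-! ## Distances to basic points and bump functions -/

/-- The cases cannot be decided from a name of `y`, whereas `max`, `min` and rational multiples are
computable and continuous. -/
theorem bump_eq (c : Z) {r s : ℝ} (hrs : r < s) (y : Z) :
    bump c r s y = max 0 (min 1 ((s - r)⁻¹ * (s - d c y))) := by
  have h0 : 0 < s - r := by linarith
  unfold bump
  split_ifs with h1 h2
  · rw [min_eq_left, max_eq_right zero_le_one]
    rw [← inv_mul_cancel₀ h0.ne']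
    exact mul_le_mul_of_nonneg_left (by linarith) (by positivity)
  · have h3 : (s - r)⁻¹ * (s - d c y) ≤ 1 := by
      rw [← inv_mul_cancel₀ h0.ne']
      exact mul_le_mul_of_nonneg_left (by linarith) (by positivity)
    rw [min_eq_right h3, max_eq_right (mul_nonneg (by positivity) (by linarith)), div_eq_inv_mul]
  · rw [max_eq_left]
    exact (min_le_right _ _).trans (mul_nonpos_of_nonneg_of_nonpos (by positivity) (by linarith))

theorem bump_nonneg (c : Z) {r s : ℝ} (hrs : r < s) (y : Z) : 0 ≤ bump c r s y := by
  rw [bump_eq c hrs]; exact le_max_left _ _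

theorem bump_le_one (c : Z) {r s : ℝ} (hrs : r < s) (y : Z) : bump c r s y ≤ 1 := by
  rw [bump_eq c hrs]; exact max_le zero_le_one (min_le_left _ _)

theorem bump_eq_zero {c : Z} {r s : ℝ} {y : Z} (hrs : r < s) (h : s ≤ d c y) :
    bump c r s y = 0 := by
  rw [bump_eq c hrs, max_eq_left]
  exact (min_le_right _ _).trans
    (mul_nonpos_of_nonneg_of_nonpos (inv_nonneg.2 (by linarith)) (by linarith))

theorem bump_eq_one {c : Z} {r s : ℝ} {y : Z} (h : d c y ≤ r) : bump c r s y = 1 := by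
  rw [bump, if_pos h]

variable [EffectivePresentation Z]

theorem realComputableOn_d : RealComputableOn (univ : Set Z) fun (i : ℕ) z => d (pt i) z := by
  have c1 : Computable fun p : ((ℕ × ℕ) × ℕ) × ℕ => (p.2, p.1.1.1) :=
    Computable.snd.pair (Computable.fst.comp (Computable.fst.comp Computable.fst))
  have r0 : RatFamily fun p : (ℕ × ℕ) × ℕ => (1 / 2 : ℝ) ^ p.2 :=
    RatFamily.half_pow Computable.snd
  have r1 : RatFamily fun p : (ℕ × ℕ) × ℕ => rat p.1.2 :=
    RatFamily.rat (Computable.snd.comp Computable.fst)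
  obtain ⟨k, hk, hk'⟩ := r1.add r0
  obtain ⟨l, hl, hl'⟩ := r1.sub r0
  have h1 : SemiDec fun (p : ((ℕ × ℕ) × ℕ) × ℕ) _ =>
      rat (k p.1) < d (pt p.2 : Z) (pt p.1.1.1) :=
    (lt_d (Z := Z)).reindex (f := fun p : ((ℕ × ℕ) × ℕ) × ℕ => ((p.2, p.1.1.1), k p.1))
      (c1.pair (hk.comp Computable.fst))
  have h2 : SemiDec fun (p : ((ℕ × ℕ) × ℕ) × ℕ) _ =>
      d (pt p.2 : Z) (pt p.1.1.1) < rat (l p.1) :=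
    (d_lt (Z := Z)).reindex (f := fun p : ((ℕ × ℕ) × ℕ) × ℕ => ((p.2, p.1.1.1), l p.1))
      (c1.pair (hl.comp Computable.fst))
  have h3 := SemiDec.ex (Q := fun (p : ℕ × ℕ) i h =>
    rat (k (p, i)) < d (pt (h i) : Z) (pt p.1)) (SemiDec.oracle (Q := fun (p : (ℕ × ℕ) × ℕ) m _ =>
    rat (k p) < d (pt m : Z) (pt p.1.1)) h1 (n := fun p => p.2) Computable.snd)
  have h4 := SemiDec.ex (Q := fun (p : ℕ × ℕ) i h =>
    d (pt (h i) : Z) (pt p.1) < rat (l (p, i))) (SemiDec.oracle (Q := fun (p : (ℕ × ℕ) × ℕ) m _ =>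
    d (pt m : Z) (pt p.1.1) < rat (l p)) h2 (n := fun p => p.2) Computable.snd)
  have key : ∀ h (z : Z), IsCauchyName h z → ∀ i j,
      |d (pt (h i) : Z) (pt j) - d (pt j) z| ≤ (1 / 2 : ℝ) ^ i := by
    intro h z hz i j
    have h5 := hz.d_le i
    have h6 := d_triangle (pt (h i)) z (pt j)
    have h7 := d_triangle z (pt (h i)) (pt j)
    rw [d_comm z (pt j)] at h6 h7
    rw [d_comm z (pt (h i))] at h7
    rw [abs_le]
    constructor <;> linarith
  refine ⟨⟨_, h3, fun z _ h hz p => ?_⟩, ⟨_, h4, fun z _ h hz p => ?_⟩⟩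
  · simp only [hk']
    constructor
    · intro hp
      obtain ⟨i, hi⟩ := exists_half_pow_lt (ε := (d (pt p.1) z - rat p.2) / 2) (by linarith)
      exact ⟨i, by linarith [(abs_le.1 (key h z hz i p.1)).1]⟩
    · rintro ⟨i, hi⟩
      linarith [(abs_le.1 (key h z hz i p.1)).2]
  · simp only [hl']
    constructor
    · intro hp
      obtain ⟨i, hi⟩ := exists_half_pow_lt (ε := (rat p.2 - d (pt p.1) z) / 2) (by linarith)
      exact ⟨i, by linarith [(abs_le.1 (key h z hz i p.1)).2]⟩
    · rintro ⟨i, hi⟩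
      linarith [(abs_le.1 (key h z hz i p.1)).1]

theorem realComputableOn_bump {i : α → ℕ} {r s : α → ℕ} (hi : Computable i) (hr : Computable r)
    (hs : Computable s) : RealComputableOn (univ : Set Z) fun a z =>
      bump (pt (i a)) (posRat (r a)) (posRat (r a) + posRat (s a)) z := by
  have h1 : RealComputableOn (univ : Set Z) fun (a : α) _ => (0 : ℝ) := .of_rat .zero
  have h2 : RealComputableOn (univ : Set Z) fun (a : α) _ => (1 : ℝ) := .of_rat .one
  have h3 : RealComputableOn (univ : Set Z) fun a _ => (posRat (r a) : ℝ) + posRat (s a) :=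
    .of_rat ((RatFamily.posRat hr).add (RatFamily.posRat hs))
  refine (h1.max (h2.min ((h3.sub (realComputableOn_d.reindex hi)).rat_mul
    (RatFamily.inv_posRat hs)))).congr fun z _ a => ?_
  have h4 : (0 : ℝ) < posRat (s a) := by
    obtain ⟨q, hq, hq'⟩ := posRat_eq (s a)
    rw [hq']; exact_mod_cast hq
  rw [bump_eq _ (by linarith), add_sub_cancel_left]

/-! ## From names to basic balls -/

theorem posRat_pos (n : ℕ) : (0 : ℝ) < posRat n := by
  obtain ⟨q, hq, hq'⟩ := posRat_eq n
  rw [hq']; exact_mod_cast hq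

theorem exists_posRat_lt {ε : ℝ} (h : 0 < ε) : ∃ n, (posRat n : ℝ) < ε := by
  obtain ⟨q, hq1, hq2⟩ := exists_rat_btwn h
  obtain ⟨n, hn⟩ := exists_posRat (q := q) (by exact_mod_cast hq1)
  exact ⟨n, by rwa [hn]⟩

theorem exists_pos_forall_lt {u : ℕ → ℝ} {n : ℕ} (h : ∀ i < n, 0 < u i) :
    ∃ δ > 0, ∀ i < n, δ ≤ u i := by
  induction n with
  | zero => exact ⟨1, one_pos, by simp⟩
  | succ n ih =>
    obtain ⟨δ, h1, h2⟩ := ih fun i hi => h i (by omega)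
    refine ⟨min δ (u n), lt_min h1 (h n (by omega)), fun i hi => ?_⟩
    rcases Nat.lt_succ_iff_lt_or_eq.1 hi with h3 | rfl
    · exact (min_le_left _ _).trans (h2 i h3)
    · exact min_le_right _ _

/-- The finitely many strict inequalities leave a common slack `δ`, and basic points within `δ` of
`z` may follow the entries of `σ`. -/
theorem exists_isCauchyName_extending {σ : List ℕ} {z : Z}
    (h1 : ∀ j < σ.length, ∀ i < j,
      d (pt (σ.getD j 0) : Z) (pt (σ.getD i 0)) < (1 / 2 : ℝ) ^ i)
    (h2 : ∀ i < σ.length, d z (pt (σ.getD i 0)) < (1 / 2 : ℝ) ^ i) :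
    ∃ g, IsCauchyName g z ∧ initSeg g σ.length = σ := by
  obtain ⟨δ, hδ, hδ'⟩ := exists_pos_forall_lt
    (u := fun i => (1 / 2 : ℝ) ^ i - d z (pt (σ.getD i 0))) (n := σ.length)
    fun i hi => by linarith [h2 i hi]
  choose t ht using fun i : ℕ => dense z (min δ ((1 / 2 : ℝ) ^ (i + 1)))
    (lt_min hδ (by positivity))
  have ht1 : ∀ i, d (pt (t i)) z ≤ δ := fun i => (ht i).le.trans (min_le_left _ _)
  have ht2 : IsCauchyName t z :=
    isCauchyName_of_le fun i => (ht i).le.trans (min_le_right _ _)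
  refine ⟨fun i => if i < σ.length then σ.getD i 0 else t i, ⟨fun i j hij => ?_, ?_⟩, ?_⟩
  · beta_reduce
    rcases hij.eq_or_lt with rfl | hij'
    · rw [d_self]; positivity
    by_cases hj : j < σ.length
    · rw [if_pos hj, if_pos (hij.trans_lt hj)]
      exact (h1 j hj i hij').le
    · rw [if_neg hj]
      by_cases hi : i < σ.length
      · rw [if_pos hi]
        linarith [d_triangle (pt (t j)) z (pt (σ.getD i 0)), hδ' i hi, ht1 j]
      · rw [if_neg hi]
        exact ht2.1 i j hij
  · refine ht2.2.congr' (eventually_atTop.2 ⟨σ.length, fun i hi => ?_⟩)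
    beta_reduce
    rw [if_neg (not_lt.2 hi)]
  · apply List.ext_getElem (by simp)
    intro i hi1 hi2
    simp [initSeg, hi2]

theorem exists_isCauchyName_le (z : Z) :
    ∃ g, IsCauchyName g z ∧ ∀ i, d (pt (g i)) z < (1 / 2 : ℝ) ^ (i + 2) := by
  choose t ht using fun i : ℕ => dense z ((1 / 2 : ℝ) ^ (i + 2)) (by positivity)
  exact ⟨t, isCauchyName_of_le fun i => (ht i).le.trans
    (pow_le_pow_of_le_one (by norm_num) (by norm_num) (by omega)), ht⟩

/-- On its domain, a semidecidable predicate is a computable union of basic balls. -/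
theorem SemiDecOn.exists_balls {S : Set Z} {P : ℕ → Z → Prop} (hP : SemiDecOn S P) :
    ∃ W : ℕ → ℕ → Prop, SemiDec (fun (p : ℕ × ℕ) _ => W p.1 p.2) ∧
      ∀ z ∈ S, ∀ a, P a z ↔ ∃ b, W a b ∧ z ∈ basicBall b := by
  obtain ⟨Q, ⟨R, hR, -, hRQ⟩, hQ⟩ := hP
  have c0 : Computable fun p : List ℕ × ℕ => p.1.getD p.2 0 := (Primrec.list_getD 0).to_comp
  have s1 : SemiDec fun (p : (ℕ × ℕ) × List ℕ) _ => R p.2 p.1.1 = true :=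
    SemiDec.of_computable (hR.comp Computable.snd (Computable.fst.comp Computable.fst))
  have s2 : SemiDec fun (p : (ℕ × ℕ) × List ℕ) _ => ∀ j < p.2.length, ∀ i < j,
      d (pt (p.2.getD j 0) : Z) (pt (p.2.getD i 0)) < (1 / 2 : ℝ) ^ i := by
    obtain ⟨k, hk, hk'⟩ := RatFamily.half_pow (Computable.snd (α := ((ℕ × ℕ) × List ℕ) × ℕ)
      (β := ℕ))
    have l1 : Computable fun p : (((ℕ × ℕ) × List ℕ) × ℕ) × ℕ => p.1.1.2 :=
      Computable.snd.comp (Computable.fst.comp Computable.fst)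
    have q1 : SemiDec fun (p : (((ℕ × ℕ) × List ℕ) × ℕ) × ℕ) _ =>
        d (pt (p.1.1.2.getD p.1.2 0) : Z) (pt (p.1.1.2.getD p.2 0)) < rat (k p) :=
      (d_lt (Z := Z)).reindex (((c0.comp (l1.pair (Computable.snd.comp Computable.fst))).pair
        (c0.comp (l1.pair Computable.snd))).pair hk)
    have q2 := SemiDec.ball (Q := fun (p : ((ℕ × ℕ) × List ℕ) × ℕ) i _ =>
      d (pt (p.1.2.getD p.2 0) : Z) (pt (p.1.2.getD i 0)) < rat (k (p, i))) q1
      (n := fun p => p.2) Computable.snd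
    have q3 := SemiDec.ball (Q := fun (p : (ℕ × ℕ) × List ℕ) j _ => ∀ i < j,
      d (pt (p.2.getD j 0) : Z) (pt (p.2.getD i 0)) < rat (k ((p, j), i))) q2
      (n := fun p => p.2.length) (Computable.list_length.comp Computable.snd)
    simpa only [hk'] using q3
  have s3 : SemiDec fun (p : (ℕ × ℕ) × List ℕ) _ => ∀ i < p.2.length,
      d (pt p.1.2.unpair.1 : Z) (pt (p.2.getD i 0)) <
        (1 / 2 : ℝ) ^ i - posRat p.1.2.unpair.2 := by
    have u1 : Computable fun p : ((ℕ × ℕ) × List ℕ) × ℕ => p.1.1.2.unpair :=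
      Computable.unpair.comp (Computable.snd.comp (Computable.fst.comp Computable.fst))
    obtain ⟨k, hk, hk'⟩ := (RatFamily.half_pow (Computable.snd (α := ((ℕ × ℕ) × List ℕ))
      (β := ℕ))).sub (RatFamily.posRat (Computable.snd.comp u1))
    have q1 : SemiDec fun (p : ((ℕ × ℕ) × List ℕ) × ℕ) _ =>
        d (pt p.1.1.2.unpair.1 : Z) (pt (p.1.2.getD p.2 0)) < rat (k p) :=
      (d_lt (Z := Z)).reindex (((Computable.fst.comp u1).pair
        (c0.comp ((Computable.snd.comp Computable.fst).pair Computable.snd))).pair hk)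
    have q2 := SemiDec.ball (Q := fun (p : (ℕ × ℕ) × List ℕ) i _ =>
      d (pt p.1.2.unpair.1 : Z) (pt (p.2.getD i 0)) < rat (k (p, i))) q1
      (n := fun p => p.2.length) (Computable.list_length.comp Computable.snd)
    simpa only [hk'] using q2
  have s4 := SemiDec.exList (Q := fun (p : ℕ × ℕ) σ _ => (R σ p.1 = true ∧
    ∀ j < σ.length, ∀ i < j, d (pt (σ.getD j 0) : Z) (pt (σ.getD i 0)) < (1 / 2 : ℝ) ^ i) ∧
    ∀ i < σ.length, d (pt p.2.unpair.1 : Z) (pt (σ.getD i 0)) <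
      (1 / 2 : ℝ) ^ i - posRat p.2.unpair.2) ((s1.and s2).and s3)
  -- The ball `b` is listed if some accepted `σ` is an initial segment of a name of every point of
  -- `b`: its entries are compatible with each other and, by the triangle inequality, with all of
  -- `b`. On `S` the truth of `P` depends on the point and not on its name, so one accepted name
  -- suffices.
  refine ⟨fun a b => ∃ σ : List ℕ, (R σ a = true ∧
    ∀ j < σ.length, ∀ i < j, d (pt (σ.getD j 0) : Z) (pt (σ.getD i 0)) < (1 / 2 : ℝ) ^ i) ∧
    ∀ i < σ.length, d (pt b.unpair.1 : Z) (pt (σ.getD i 0)) <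
      (1 / 2 : ℝ) ^ i - posRat b.unpair.2, s4, fun z hz a => ⟨fun ha => ?_, ?_⟩⟩
  -- The name is faster than required, with errors below `2^{-(i+2)}`, and the radius is below
  -- `2^{-(k+2)}`; this leaves all the required inequalities strict.
  · obtain ⟨g, hg1, hg2⟩ := exists_isCauchyName_le z
    obtain ⟨k, hk⟩ := (hRQ a g).1 ((hQ z hz g hg1 a).1 ha)
    obtain ⟨r, hr⟩ := exists_posRat_lt (ε := (1 / 2 : ℝ) ^ (k + 2)) (by positivity)
    obtain ⟨c, hc⟩ := dense z (posRat r) (posRat_pos r)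
    have hget : ∀ i < k, (initSeg g k).getD i 0 = g i := by
      intro i hi
      simp [initSeg, hi]
    have hp : ∀ i : ℕ, (1 / 2 : ℝ) ^ (i + 2) = (1 / 2 : ℝ) ^ i / 4 := fun i => by
      rw [pow_add]; norm_num; ring
    have hpos : ∀ i : ℕ, 0 < (1 / 2 : ℝ) ^ i := fun i => by positivity
    have hle : ∀ i j : ℕ, i ≤ j → (1 / 2 : ℝ) ^ j ≤ (1 / 2 : ℝ) ^ i := fun i j hij =>
      pow_le_pow_of_le_one (by norm_num) (by norm_num) hij
    refine ⟨Nat.pair c r, ⟨initSeg g k, ⟨hk, ?_⟩, ?_⟩, ?_⟩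
    · simp only [length_initSeg]
      intro j hj i hij
      rw [hget j hj, hget i (hij.trans hj)]
      have h1 := d_triangle (pt (g j)) z (pt (g i))
      rw [d_comm z] at h1
      linarith [hg2 i, hg2 j, hp i, hp j, hpos i, hle i j hij.le]
    · simp only [length_initSeg, Nat.unpair_pair]
      intro i hi
      rw [hget i hi]
      have h1 := d_triangle (pt c) z (pt (g i))
      rw [d_comm z] at h1
      linarith [hg2 i, hp i, hp k, hpos i, hle i k hi.le]
    · change d z (pt (Nat.pair c r).unpair.1) < posRat (Nat.pair c r).unpair.2
      rw [Nat.unpair_pair, d_comm]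
      exact hc
  · rintro ⟨b, ⟨σ, ⟨h1, h2⟩, h3⟩, hb⟩
    obtain ⟨g, hg1, hg2⟩ := exists_isCauchyName_extending (z := z) h2 fun i hi => by
      have h4 := d_triangle z (pt b.unpair.1) (pt (σ.getD i 0))
      have h5 : d z (pt b.unpair.1) < posRat b.unpair.2 := hb
      have h6 := h3 i hi
      linarith
    exact (hQ z hz g hg1 a).2 ((hRQ a g).2 ⟨σ.length, by rw [hg2]; exact h1⟩)

/-! ## Instances -/

instance {X : Type*} [MetricSpace X] [ComputableMetricSpace X] : EffectivePresentation X where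
  d_self := dist_self
  d_comm := dist_comm
  d_triangle := dist_triangle
  dense z ε hε := by
    obtain ⟨i, hi⟩ := (ComputableMetricSpace.dense (X := X)).exists_dist_lt z hε
    exact ⟨i, by rw [dist_comm] at hi; exact hi⟩
  lt_d := by
    obtain ⟨c, hc, h⟩ := ComputableMetricSpace.computable_dist (X := X)
    have c1 : Computable fun p : ((ℕ × ℕ) × ℕ) × ℕ => c (Nat.pair p.1.1.1 p.1.1.2) p.2 :=
      hc.comp ((Primrec₂.natPair.to_comp).comp
        (Computable.fst.comp (Computable.fst.comp Computable.fst))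
        (Computable.snd.comp (Computable.fst.comp Computable.fst))) Computable.snd
    refine (SemiDec.ex (Q := fun (p : (ℕ × ℕ) × ℕ) i _ => rat p.2 <
      rat (c (Nat.pair p.1.1 p.1.2) i) - (1 / 2 : ℝ) ^ i) (SemiDec.lt
        (RatFamily.rat (Computable.snd.comp Computable.fst))
        ((RatFamily.rat c1).sub (RatFamily.half_pow Computable.snd)))).of_eq fun p _ => ?_
    have hn := h (Nat.pair p.1.1 p.1.2)
    simp only [Nat.unpair_pair] at hn
    have key : ∀ i, |rat (c (Nat.pair p.1.1 p.1.2) i) - d (pt p.1.1 : X) (pt p.1.2)| ≤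
      (1 / 2 : ℝ) ^ i := fun i => hn.d_le i
    constructor
    · intro hlt
      obtain ⟨i, hi⟩ := exists_half_pow_lt
        (ε := (d (pt p.1.1 : X) (pt p.1.2) - rat p.2) / 2) (by linarith)
      exact ⟨i, by linarith [(abs_le.1 (key i)).1]⟩
    · rintro ⟨i, hi⟩
      linarith [(abs_le.1 (key i)).2]
  d_lt := by
    obtain ⟨c, hc, h⟩ := ComputableMetricSpace.computable_dist (X := X)
    have c1 : Computable fun p : ((ℕ × ℕ) × ℕ) × ℕ => c (Nat.pair p.1.1.1 p.1.1.2) p.2 :=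
      hc.comp ((Primrec₂.natPair.to_comp).comp
        (Computable.fst.comp (Computable.fst.comp Computable.fst))
        (Computable.snd.comp (Computable.fst.comp Computable.fst))) Computable.snd
    refine (SemiDec.ex (Q := fun (p : (ℕ × ℕ) × ℕ) i _ =>
      rat (c (Nat.pair p.1.1 p.1.2) i) + (1 / 2 : ℝ) ^ i < rat p.2) (SemiDec.lt
        ((RatFamily.rat c1).add (RatFamily.half_pow Computable.snd))
        (RatFamily.rat (Computable.snd.comp Computable.fst)))).of_eq fun p _ => ?_
    have hn := h (Nat.pair p.1.1 p.1.2)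
    simp only [Nat.unpair_pair] at hn
    have key : ∀ i, |rat (c (Nat.pair p.1.1 p.1.2) i) - d (pt p.1.1 : X) (pt p.1.2)| ≤
      (1 / 2 : ℝ) ^ i := fun i => hn.d_le i
    constructor
    · intro hlt
      obtain ⟨i, hi⟩ := exists_half_pow_lt
        (ε := (rat p.2 - d (pt p.1.1 : X) (pt p.1.2)) / 2) (by linarith)
      exact ⟨i, by linarith [(abs_le.1 (key i)).2]⟩
    · rintro ⟨i, hi⟩
      linarith [(abs_le.1 (key i)).1]

instance [EffectivePresentation Y] : EffectivePresentation (Y × Z) where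
  dense z ε hε := by
    obtain ⟨i, hi⟩ := dense z.1 ε hε
    obtain ⟨j, hj⟩ := dense z.2 ε hε
    refine ⟨Nat.pair i j, ?_⟩
    change max (d (pt (Nat.pair i j).unpair.1) z.1) (d (pt (Nat.pair i j).unpair.2) z.2) < ε
    rw [Nat.unpair_pair]
    exact max_lt hi hj
  lt_d := by
    have u1 : Computable fun p : (ℕ × ℕ) × ℕ => p.1.1.unpair :=
      Computable.unpair.comp (Computable.fst.comp Computable.fst)
    have u2 : Computable fun p : (ℕ × ℕ) × ℕ => p.1.2.unpair :=
      Computable.unpair.comp (Computable.snd.comp Computable.fst)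
    exact (((lt_d (Z := Y)).reindex (((Computable.fst.comp u1).pair
      (Computable.fst.comp u2)).pair Computable.snd)).or ((lt_d (Z := Z)).reindex
      (((Computable.snd.comp u1).pair (Computable.snd.comp u2)).pair Computable.snd))).of_eq
      fun _ _ => lt_max_iff
  d_lt := by
    have u1 : Computable fun p : (ℕ × ℕ) × ℕ => p.1.1.unpair :=
      Computable.unpair.comp (Computable.fst.comp Computable.fst)
    have u2 : Computable fun p : (ℕ × ℕ) × ℕ => p.1.2.unpair :=
      Computable.unpair.comp (Computable.snd.comp Computable.fst)
    exact (((d_lt (Z := Y)).reindex (((Computable.fst.comp u1).pair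
      (Computable.fst.comp u2)).pair Computable.snd)).and ((d_lt (Z := Z)).reindex
      (((Computable.snd.comp u1).pair (Computable.snd.comp u2)).pair Computable.snd))).of_eq
      fun _ _ => max_lt_iff

end Effective

/-! ## A distance on real sequences -/

section SeqDist

/-- The distance of real sequences which defines the distance of measures. -/
def seqDist (u v : ℕ → ℝ) : ℝ := ∑' i : ℕ, (1 / 2 : ℝ) ^ i * (1 - Real.exp (-|u i - v i|))

theorem seqDist_term_nonneg (u v : ℕ → ℝ) (i : ℕ) :
    0 ≤ (1 / 2 : ℝ) ^ i * (1 - Real.exp (-|u i - v i|)) :=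
  mul_nonneg (by positivity) (by
    rw [sub_nonneg, Real.exp_le_one_iff]
    exact neg_nonpos.2 (abs_nonneg _))

theorem seqDist_term_le (u v : ℕ → ℝ) (i : ℕ) :
    (1 / 2 : ℝ) ^ i * (1 - Real.exp (-|u i - v i|)) ≤ (1 / 2 : ℝ) ^ i :=
  mul_le_of_le_one_right (by positivity) (by linarith [Real.exp_pos (-|u i - v i|)])

theorem summable_seqDist (u v : ℕ → ℝ) :
    Summable fun i : ℕ => (1 / 2 : ℝ) ^ i * (1 - Real.exp (-|u i - v i|)) :=
  Summable.of_nonneg_of_le (seqDist_term_nonneg u v) (seqDist_term_le u v) summable_geometric_two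

theorem seqDist_self (u : ℕ → ℝ) : seqDist u u = 0 := by simp [seqDist]

theorem seqDist_comm (u v : ℕ → ℝ) : seqDist u v = seqDist v u := by
  simp only [seqDist, abs_sub_comm]

/-- This is `(1 - e^{-x}) (1 - e^{-y}) ≥ 0`, and it yields the triangle inequality for `seqDist`. -/
theorem one_sub_exp_neg_add_le {x y : ℝ} (hx : 0 ≤ x) (hy : 0 ≤ y) :
    1 - Real.exp (-(x + y)) ≤ (1 - Real.exp (-x)) + (1 - Real.exp (-y)) := by
  rw [neg_add, Real.exp_add]
  have h1 : Real.exp (-x) ≤ 1 := Real.exp_le_one_iff.2 (by linarith)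
  have h2 : Real.exp (-y) ≤ 1 := Real.exp_le_one_iff.2 (by linarith)
  nlinarith

theorem seqDist_triangle (u v w : ℕ → ℝ) : seqDist u w ≤ seqDist u v + seqDist v w := by
  rw [seqDist, seqDist, seqDist, ← (summable_seqDist u v).tsum_add (summable_seqDist v w)]
  refine (summable_seqDist u w).tsum_le_tsum (fun i => ?_)
    ((summable_seqDist u v).add (summable_seqDist v w))
  rw [← mul_add]
  refine mul_le_mul_of_nonneg_left ?_ (by positivity)
  refine le_trans ?_ (one_sub_exp_neg_add_le (abs_nonneg _) (abs_nonneg _))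
  have : Real.exp (-(|u i - v i| + |v i - w i|)) ≤ Real.exp (-|u i - w i|) :=
    Real.exp_le_exp.2 (neg_le_neg (abs_sub_le _ _ _))
  linarith

theorem sum_le_seqDist (u v : ℕ → ℝ) (n : ℕ) :
    ∑ i ∈ Finset.range n, (1 / 2 : ℝ) ^ i * (1 - Real.exp (-|u i - v i|)) ≤ seqDist u v :=
  (summable_seqDist u v).sum_le_tsum _ fun i _ => seqDist_term_nonneg u v i

theorem seqDist_le_sum_add (u v : ℕ → ℝ) (n : ℕ) :
    seqDist u v ≤ ∑ i ∈ Finset.range n, (1 / 2 : ℝ) ^ i * (1 - Real.exp (-|u i - v i|)) +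
      2 * (1 / 2 : ℝ) ^ n := by
  rw [seqDist, ← (summable_seqDist u v).sum_add_tsum_nat_add n]
  gcongr
  have h1 : Summable fun i : ℕ => (1 / 2 : ℝ) ^ (i + n) :=
    (summable_nat_add_iff n).2 summable_geometric_two
  refine (((summable_nat_add_iff n).2 (summable_seqDist u v)).tsum_le_tsum
    (fun i => seqDist_term_le u v (i + n)) h1).trans_eq ?_
  simp only [pow_add]
  rw [tsum_mul_right, tsum_geometric_two]

theorem half_le_one_sub_exp_neg {x : ℝ} (h0 : 0 ≤ x) (h1 : x ≤ 1) : x / 2 ≤ 1 - Real.exp (-x) := by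
  have h2 : x + 1 ≤ Real.exp x := Real.add_one_le_exp x
  have h3 : Real.exp (-x) * Real.exp x = 1 := by rw [← Real.exp_add]; simp
  have h4 : 0 < Real.exp (-x) := Real.exp_pos _
  nlinarith

/-- On `[0, 1]` one has `1 - e^{-x} ≥ x / 2`; a difference above `2^{-j}` in coordinate `i` would by
itself contribute more than `2^{-i} · 2^{-j} / 2`. -/
theorem abs_sub_le_of_seqDist_le {u v : ℕ → ℝ} {i j : ℕ}
    (h : seqDist u v ≤ (1 / 2 : ℝ) ^ (i + 1 + j)) : |u i - v i| ≤ (1 / 2 : ℝ) ^ j := by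
  by_contra! hlt
  have h1 : (1 / 2 : ℝ) ^ i * (1 - Real.exp (-|u i - v i|)) ≤ seqDist u v :=
    (summable_seqDist u v).le_tsum i fun k _ => seqDist_term_nonneg u v k
  have h2 := half_le_one_sub_exp_neg (x := (1 / 2 : ℝ) ^ j) (by positivity)
    (pow_le_one₀ (by norm_num) (by norm_num))
  have h3 : Real.exp (-|u i - v i|) < Real.exp (-(1 / 2 : ℝ) ^ j) :=
    Real.exp_lt_exp.2 (neg_lt_neg hlt)
  have h4 : (0 : ℝ) < (1 / 2 : ℝ) ^ i := by positivity
  have h5 : (1 / 2 : ℝ) ^ (i + 1 + j) = (1 / 2 : ℝ) ^ i * ((1 / 2 : ℝ) ^ j / 2) := by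
    rw [pow_add, pow_succ]; ring
  nlinarith

theorem seqDist_lt_of_abs_sub_le {u v : ℕ → ℝ} {n : ℕ} {δ : ℝ} 
    (h : ∀ i < n, |u i - v i| ≤ δ) (hδ : 0 ≤ δ) :
    seqDist u v ≤ 2 * δ + 2 * (1 / 2 : ℝ) ^ n := by
  refine (seqDist_le_sum_add u v n).trans ?_
  gcongr
  have h1 : ∀ i ∈ Finset.range n, (1 / 2 : ℝ) ^ i * (1 - Real.exp (-|u i - v i|)) ≤
      (1 / 2 : ℝ) ^ i * δ := fun i hi => by
    refine mul_le_mul_of_nonneg_left ?_ (by positivity)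
    have := Real.add_one_le_exp (-|u i - v i|)
    linarith [h i (Finset.mem_range.1 hi)]
  refine (Finset.sum_le_sum h1).trans ?_
  rw [← Finset.sum_mul]
  exact mul_le_mul_of_nonneg_right (sum_geometric_two_le n) hδ

end SeqDist

/-! ## Computable reals as limits of rational approximations with error bounds -/

section Approx

variable {α β : Type*} [Primcodable α] [Primcodable β]

/-- Reals with computable rational approximations and computable error bounds that tend to `0`. -/
def Approximable (f : α → ℝ) : Prop :=
  ∃ A E : α → ℕ → ℝ, RatFamily (fun p : α × ℕ => A p.1 p.2) ∧
    RatFamily (fun p : α × ℕ => E p.1 p.2) ∧ (∀ a s, |A a s - f a| ≤ E a s) ∧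
      ∀ a, Tendsto (E a) atTop (𝓝 0)

theorem RatFamily.approximable {f : α → ℝ} (hf : RatFamily f) : Approximable f :=
  ⟨fun a _ => f a, fun _ _ => 0, hf.reindex Computable.fst, RatFamily.zero, by simp,
    fun _ => tendsto_const_nhds⟩

variable {f g : α → ℝ}

theorem Approximable.reindex (hf : Approximable f) {k : β → α} (hk : Computable k) :
    Approximable fun b => f (k b) := by
  obtain ⟨A, E, hA, hE, h, h'⟩ := hf
  have hc : Computable fun p : β × ℕ => (k p.1, p.2) :=
    (hk.comp Computable.fst).pair Computable.snd
  exact ⟨fun b => A (k b), fun b => E (k b), hA.reindex hc, hE.reindex hc,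
    fun b => h (k b), fun b => h' (k b)⟩

theorem Approximable.sub (hf : Approximable f) (hg : Approximable g) :
    Approximable fun a => f a - g a := by
  obtain ⟨A, E, hA, hE, h, h'⟩ := hf
  obtain ⟨B, F, hB, hF, k, k'⟩ := hg
  refine ⟨fun a s => A a s - B a s, fun a s => E a s + F a s, hA.sub hB, hE.add hF,
    fun a s => ?_, fun a => by simpa using (h' a).add (k' a)⟩
  have h1 := abs_le.1 (h a s)
  have h2 := abs_le.1 (k a s)
  rw [abs_le]
  constructor <;> linarith

theorem Approximable.rat_mul {r : α → ℝ} (hr : RatFamily r) (hf : Approximable f) :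
    Approximable fun a => r a * f a := by
  obtain ⟨A, E, hA, hE, h, h'⟩ := hf
  have hr' : RatFamily fun p : α × ℕ => r p.1 := hr.reindex Computable.fst
  refine ⟨fun a s => r a * A a s, fun a s => |r a| * E a s, hr'.mul hA, hr'.abs.mul hE,
    fun a s => ?_, fun a => by simpa using (h' a).const_mul |r a|⟩
  rw [← mul_sub, abs_mul]
  exact mul_le_mul_of_nonneg_left (h a s) (abs_nonneg _)

theorem Approximable.sum {f : α → ℕ → ℝ} (hf : Approximable fun p : α × ℕ => f p.1 p.2) {n : α → ℕ}
    (hn : Computable n) : Approximable fun a => ∑ i ∈ Finset.range (n a), f a i := by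
  obtain ⟨A, E, hA, hE, h, h'⟩ := hf
  have hc : Computable fun p : (α × ℕ) × ℕ => ((p.1.1, p.2), p.1.2) :=
    ((Computable.fst.comp Computable.fst).pair Computable.snd).pair
      (Computable.snd.comp Computable.fst)
  have hn' : Computable fun p : α × ℕ => n p.1 := hn.comp Computable.fst
  refine ⟨fun a s => ∑ i ∈ Finset.range (n a), A (a, i) s,
    fun a s => ∑ i ∈ Finset.range (n a), E (a, i) s,
    RatFamily.sum (f := fun (p : α × ℕ) i => A (p.1, i) p.2) (hA.reindex hc) hn',
    RatFamily.sum (f := fun (p : α × ℕ) i => E (p.1, i) p.2) (hE.reindex hc) hn',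
    fun a s => ?_, fun a => ?_⟩
  · rw [← Finset.sum_sub_distrib]
    exact (Finset.abs_sum_le_sum_abs _ _).trans (Finset.sum_le_sum fun i _ => h (a, i) s)
  · simpa using tendsto_finsetSum (Finset.range (n a)) fun i _ => h' (a, i)

theorem abs_exp_neg_sub_exp_neg_le {x y : ℝ} (hx : 0 ≤ x) (hy : 0 ≤ y) :
    |Real.exp (-x) - Real.exp (-y)| ≤ |x - y| := by
  wlog hxy : x ≤ y generalizing x y
  · rw [abs_sub_comm, abs_sub_comm x]
    exact this hy hx (not_le.1 hxy).le
  have h1 : Real.exp (-y) ≤ Real.exp (-x) := Real.exp_le_exp.2 (by linarith)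
  rw [abs_of_nonneg (by linarith), abs_of_nonpos (by linarith)]
  have h2 : Real.exp (-y) = Real.exp (-x) * Real.exp (-(y - x)) := by
    rw [← Real.exp_add]; congr 1; ring
  have h3 := Real.add_one_le_exp (-(y - x))
  have h4 : Real.exp (-x) ≤ 1 := Real.exp_le_one_iff.2 (by linarith)
  have h5 : 0 < Real.exp (-x) := Real.exp_pos _
  rw [h2]
  nlinarith

/-- An explicit rate for Euler's limit, so that the exponential has rational approximations with
computable error. Write `N = n + 1` and `y = x / N ≤ 1`. From above, `1 - y ≤ e^{-y}`. From below,
Bernoulli gives `(1 - y)^N (1 + y)^N ≥ 1 - N y^2`, and `(1 + y)^N ≤ e^x`. If `y ≥ 1`, the power is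
`0` and the error bound is at least `1`. -/
theorem abs_pow_sub_exp_neg_le {x : ℝ} (hx : 0 ≤ x) (n : ℕ) :
    |(max 0 (1 - x * ((n : ℝ) + 1)⁻¹)) ^ (n + 1) - Real.exp (-x)| ≤ x * x * ((n : ℝ) + 1)⁻¹ := by
  have hn : (0 : ℝ) < (n : ℝ) + 1 := by positivity
  have hi : (0 : ℝ) < ((n : ℝ) + 1)⁻¹ := by positivity
  have hni : ((n : ℝ) + 1) * ((n : ℝ) + 1)⁻¹ = 1 := mul_inv_cancel₀ hn.ne'
  set r := ((n : ℝ) + 1)⁻¹ with hr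
  have he1 : Real.exp (-x) ≤ 1 := Real.exp_le_one_iff.2 (by linarith)
  have he0 : 0 < Real.exp (-x) := Real.exp_pos _
  have hxx : 0 ≤ x * x * r := by positivity
  rcases le_total (x * r) 1 with h | h
  · rw [max_eq_right (by linarith)]
    have h1 : (1 - x * r) ^ (n + 1) ≤ Real.exp (-x) := by
      have h2 : 1 - x * r ≤ Real.exp (-(x * r)) := by linarith [Real.add_one_le_exp (-(x * r))]
      calc (1 - x * r) ^ (n + 1) ≤ Real.exp (-(x * r)) ^ (n + 1) :=
            pow_le_pow_left₀ (by linarith) h2 _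
        _ = Real.exp (-x) := by
            rw [← Real.exp_nat_mul]; congr 1; push_cast; linear_combination (-x) * hni
    have h2 : (1 + x * r) ^ (n + 1) ≤ Real.exp x := by
      have h2 : 1 + x * r ≤ Real.exp (x * r) := by linarith [Real.add_one_le_exp (x * r)]
      calc (1 + x * r) ^ (n + 1) ≤ Real.exp (x * r) ^ (n + 1) :=
            pow_le_pow_left₀ (by positivity) h2 _
        _ = Real.exp x := by
            rw [← Real.exp_nat_mul]; congr 1; push_cast; linear_combination x * hni
    have h3 : 1 - x * x * r ≤ (1 - x * r) ^ (n + 1) * (1 + x * r) ^ (n + 1) := by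
      rw [← mul_pow]
      have h4 := one_add_mul_le_pow (a := -(x * r) ^ 2) (by nlinarith [mul_nonneg hx hi.le]) (n + 1)
      have h5 : (1 - x * r) * (1 + x * r) = 1 + -(x * r) ^ 2 := by ring
      rw [h5]
      refine le_trans (le_of_eq ?_) h4
      push_cast
      linear_combination (-(x * x * r)) * (-hni)
    have h6 : Real.exp x * Real.exp (-x) = 1 := by rw [← Real.exp_add]; simp
    have h7 : 0 ≤ (1 - x * r) ^ (n + 1) := pow_nonneg (by linarith) _
    have h8 : (1 - x * x * r) ≤ (1 - x * r) ^ (n + 1) * Real.exp x :=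
      h3.trans (mul_le_mul_of_nonneg_left h2 h7)
    have h9 : (1 - x * x * r) * Real.exp (-x) ≤ (1 - x * r) ^ (n + 1) := by
      calc (1 - x * x * r) * Real.exp (-x) ≤ (1 - x * r) ^ (n + 1) * Real.exp x * Real.exp (-x) :=
            mul_le_mul_of_nonneg_right h8 he0.le
        _ = (1 - x * r) ^ (n + 1) := by rw [mul_assoc, h6, mul_one]
    rw [abs_le]
    constructor <;> nlinarith
  · rw [max_eq_left (by linarith), zero_pow (by omega), zero_sub, abs_neg, abs_of_pos he0]
    have h1 : 1 ≤ (n : ℝ) + 1 := by linarith [(Nat.cast_nonneg n : (0 : ℝ) ≤ n)]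
    have h2 : r ≤ 1 := by nlinarith
    have h3 : 1 ≤ x := by nlinarith
    nlinarith

theorem Approximable.one_sub_exp_neg_abs (hf : Approximable f) :
    Approximable fun a => 1 - Real.exp (-|f a|) := by
  obtain ⟨A, E, hA, hE, h, h'⟩ := hf
  have r1 : RatFamily fun p : α × ℕ => ((p.2 : ℝ) + 1)⁻¹ := RatFamily.inv_nat_succ Computable.snd
  refine ⟨fun a s => 1 - (max 0 (1 - |A a s| * ((s : ℝ) + 1)⁻¹)) ^ (s + 1),
    fun a s => |A a s| * |A a s| * ((s : ℝ) + 1)⁻¹ + E a s, ?_, ?_, fun a s => ?_, fun a => ?_⟩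
  · exact RatFamily.one.sub ((RatFamily.zero.max (RatFamily.one.sub (hA.abs.mul r1))).pow
      (Computable.succ.comp Computable.snd))
  · exact ((hA.abs.mul hA.abs).mul r1).add hE
  · have h1 := abs_pow_sub_exp_neg_le (abs_nonneg (A a s)) s
    have h2 := abs_exp_neg_sub_exp_neg_le (abs_nonneg (A a s)) (abs_nonneg (f a))
    have h3 := (abs_abs_sub_abs_le_abs_sub (A a s) (f a)).trans (h a s)
    have h4 := abs_le.1 h1
    have h5 := abs_le.1 (h2.trans h3)
    rw [abs_le]
    constructor <;> linarith [h4.1, h4.2, h5.1, h5.2]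
  · have h1 : Tendsto (A a) atTop (𝓝 (f a)) := by
      rw [tendsto_iff_norm_sub_tendsto_zero]
      exact squeeze_zero (fun _ => norm_nonneg _) (h a) (h' a)
    have h2 : Tendsto (fun s : ℕ => ((s : ℝ) + 1)⁻¹) atTop (𝓝 0) := by
      simpa using tendsto_one_div_add_atTop_nhds_zero_nat (𝕜 := ℝ)
    simpa using ((h1.abs.mul h1.abs).mul h2).add (h' a)

theorem Approximable.semiDec_rat_lt (hf : Approximable f) {r : α → ℝ} (hr : RatFamily r) :
    SemiDec fun a _ => r a < f a := by
  obtain ⟨A, E, hA, hE, h, h'⟩ := hf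
  refine (SemiDec.ex (Q := fun a s _ => r a < A a s - E a s) (SemiDec.lt
    (hr.reindex Computable.fst) (hA.sub hE))).of_eq fun a _ => ⟨fun hlt => ?_, ?_⟩
  · obtain ⟨s, hs⟩ := ((h' a).eventually_lt_const (show 0 < (f a - r a) / 2 by linarith)).exists
    exact ⟨s, by linarith [(abs_le.1 (h a s)).1]⟩
  · rintro ⟨s, hs⟩
    linarith [(abs_le.1 (h a s)).2]

theorem Approximable.semiDec_lt_rat (hf : Approximable f) {r : α → ℝ} (hr : RatFamily r) :
    SemiDec fun a _ => f a < r a := by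
  obtain ⟨A, E, hA, hE, h, h'⟩ := hf
  refine (SemiDec.ex (Q := fun a s _ => A a s + E a s < r a) (SemiDec.lt
    (hA.add hE) (hr.reindex Computable.fst))).of_eq fun a _ => ⟨fun hlt => ?_, ?_⟩
  · obtain ⟨s, hs⟩ := ((h' a).eventually_lt_const (show 0 < (r a - f a) / 2 by linarith)).exists
    exact ⟨s, by linarith [(abs_le.1 (h a s)).2]⟩
  · rintro ⟨s, hs⟩
    linarith [(abs_le.1 (h a s)).1]

end Approx

/-! ## Basic functions are bounded and continuous -/

section Basic

variable {X : Type*} [MetricSpace X] [ComputableMetricSpace X]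

theorem continuous_bump (c : X) {r s : ℝ} (hrs : r < s) : Continuous (bump c r s) := by
  have h1 : Continuous fun y : X => (d c y : ℝ) := continuous_const.dist continuous_id
  have h2 : bump c r s = fun y => max 0 (min 1 ((s - r)⁻¹ * (s - d c y))) :=
    funext (bump_eq c hrs)
  rw [h2]
  fun_prop

theorem IsBasicFun.continuous {f : X → ℝ} (hf : IsBasicFun f) : Continuous f := by
  induction hf with
  | one => exact continuous_const
  | bump i r s hr hs => exact continuous_bump _ (by exact_mod_cast hs)
  | max _ _ h1 h2 => exact h1.max h2
  | min _ _ h1 h2 => exact h1.min h2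
  | lin p q _ _ h1 h2 => fun_prop

theorem IsBasicFun.bounded {f : X → ℝ} (hf : IsBasicFun f) : ∃ C, ∀ y, |f y| ≤ C := by
  induction hf with
  | one => exact ⟨1, fun _ => by simp⟩
  | bump i r s hr hs =>
    have hs' : (r : ℝ) < s := by exact_mod_cast hs
    exact ⟨1, fun y => abs_le.2 ⟨by linarith [bump_nonneg (pt i) hs' y], bump_le_one _ hs' y⟩⟩
  | max _ _ h1 h2 =>
    obtain ⟨C, hC⟩ := h1
    obtain ⟨D, hD⟩ := h2
    exact ⟨Max.max C D, fun y => abs_max_le_max_abs_abs.trans (max_le_max (hC y) (hD y))⟩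
  | min _ _ h1 h2 =>
    obtain ⟨C, hC⟩ := h1
    obtain ⟨D, hD⟩ := h2
    exact ⟨Max.max C D, fun y => abs_min_le_max_abs_abs.trans (max_le_max (hC y) (hD y))⟩
  | lin p q _ _ h1 h2 =>
    obtain ⟨C, hC⟩ := h1
    obtain ⟨D, hD⟩ := h2
    refine ⟨|(p : ℝ)| * C + |(q : ℝ)| * D, fun y => (abs_add_le _ _).trans ?_⟩
    rw [abs_mul, abs_mul]
    exact add_le_add (mul_le_mul_of_nonneg_left (hC y) (abs_nonneg _))
      (mul_le_mul_of_nonneg_left (hD y) (abs_nonneg _))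

theorem isBasicFun_basicFun (e : ℕ) : IsBasicFun (basicFun e : X → ℝ) :=
  (isBasicFun_iff _).2 ⟨e, rfl⟩

variable [MeasurableSpace X] [BorelSpace X]

theorem integrable_of_continuous_of_bounded {f : X → ℝ} (hf : Continuous f) {C : ℝ}
    (hC : ∀ y, |f y| ≤ C) (μ : Measure X) [IsFiniteMeasure μ] : Integrable f μ :=
  Integrable.of_bound hf.measurable.aestronglyMeasurable C (.of_forall hC)

theorem integrable_basicFun (e : ℕ) (μ : Measure X) [IsFiniteMeasure μ] :
    Integrable (basicFun e) μ := by
  obtain ⟨C, hC⟩ := (isBasicFun_basicFun (X := X) e).bounded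
  exact integrable_of_continuous_of_bounded (isBasicFun_basicFun e).continuous hC μ

/-! ## Basic measures are dense -/

/-- The integrals of the basic functions. -/
def basicIntegrals (μ : FiniteMeasure X) (e : ℕ) : ℝ := ∫ x, basicFun e x ∂(μ : Measure X)

theorem d_finiteMeasure (μ ν : FiniteMeasure X) :
    d μ ν = seqDist (basicIntegrals μ) (basicIntegrals ν) := rfl

theorem integral_sum_pointMass (e : ℕ) (l : List (ℕ × ℕ)) :
    ∫ x, basicFun e x ∂(((l.map fun p => posRat p.1 • pointMass (pt p.2 : X)).sum :
      FiniteMeasure X) : Measure X) = (l.map fun p => (posRat p.1 : ℝ) * basicFun e (pt p.2 : X)).sum := by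
  induction l with
  | nil => simp
  | cons p l ih =>
    rw [List.map_cons, List.sum_cons, List.map_cons, List.sum_cons, FiniteMeasure.toMeasure_add,
      integral_add_measure (integrable_basicFun e _) (integrable_basicFun e _), ih,
      FiniteMeasure.toMeasure_smul, integral_smul_nnreal_measure]
    congr 1
    change posRat p.1 • ∫ x, basicFun e x ∂(Measure.dirac (pt p.2 : X)) = _
    rw [integral_dirac, NNReal.smul_def, smul_eq_mul]

theorem List.sum_map_eq_sum_range {γ : Type*} (l : List γ) (f : γ → ℝ) (c : γ) :
    (l.map f).sum = ∑ i ∈ Finset.range l.length, f (l.getD i c) := by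
  induction l with
  | nil => simp
  | cons x l ih => simp [Finset.sum_range_succ', ih, add_comm]

theorem basicIntegrals_basicMeasure (n e : ℕ) :
    basicIntegrals (basicMeasure n : FiniteMeasure X) e =
      ∑ i ∈ Finset.range (Denumerable.ofNat (List (ℕ × ℕ)) n).length,
        (posRat ((Denumerable.ofNat (List (ℕ × ℕ)) n).getD i (0, 0)).1 : ℝ) *
          basicFun e (pt ((Denumerable.ofNat (List (ℕ × ℕ)) n).getD i (0, 0)).2 : X) := by
  rw [basicIntegrals, basicMeasure, integral_sum_pointMass,
    List.sum_map_eq_sum_range _ _ (0, 0)]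

theorem exists_basicMeasure (w : ℕ → ℝ) (hw : ∀ k, 0 ≤ w k) (n : ℕ) (δ : ℝ) (hδ : 0 < δ) :
    ∃ (m : ℕ) (v : ℕ → ℝ), (∀ k, |v k - w k| ≤ δ) ∧ ∀ e,
      basicIntegrals (basicMeasure m : FiniteMeasure X) e =
        ∑ k ∈ Finset.range n, v k * basicFun e (pt k : X) := by
  have h1 : ∀ k, ∃ a, |(posRat a : ℝ) - w k| ≤ δ := by
    intro k
    obtain ⟨q, hq1, hq2⟩ := exists_rat_btwn (show w k < w k + δ by linarith)
    obtain ⟨a, ha⟩ := exists_posRat (q := q) (by exact_mod_cast (hw k).trans_lt hq1)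
    exact ⟨a, by rw [ha, abs_le]; constructor <;> linarith⟩
  choose a ha using h1
  refine ⟨Encodable.encode ((List.range n).map fun k => (a k, k)), fun k => posRat (a k), ha,
    fun e => ?_⟩
  rw [basicIntegrals, basicMeasure, Denumerable.ofNat_encode, integral_sum_pointMass,
    List.map_map]
  induction n with
  | zero => simp
  | succ n ih => simp [List.range_succ, Finset.sum_range_succ, ← ih]

/-- Only finitely many basic functions matter up to `ε`. Moving all mass to the nearest of the basic
points `0, …, n` changes their integrals arbitrarily little for large `n`, by dominated convergence.
The result is a finite sum of point masses, whose real weights are then made rational. -/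
theorem dense_basicMeasure (μ : FiniteMeasure X) (ε : ℝ) (hε : 0 < ε) :
    ∃ i, d (pt i) μ < ε := by
  obtain ⟨M, hM⟩ := exists_half_pow_lt (ε := ε / 4) (by linarith)
  have hden : ∀ x : X, x ∈ closure (range (pt : ℕ → X)) :=
    (ComputableMetricSpace.dense (X := X))
  have hlim : ∀ e, Tendsto (fun n => ∫ x, basicFun e (SimpleFunc.nearestPt (pt : ℕ → X) n x)
      ∂(μ : Measure X)) atTop (𝓝 (basicIntegrals μ e)) := by
    intro e
    obtain ⟨C, hC⟩ := (isBasicFun_basicFun (X := X) e).bounded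
    have hc := (isBasicFun_basicFun (X := X) e).continuous
    refine tendsto_integral_of_dominated_convergence (fun _ => C) (fun n => ?_)
      (integrable_const _) (fun n => .of_forall fun x => hC _) (.of_forall fun x => ?_)
    · exact (hc.measurable.comp (SimpleFunc.measurable _)).aestronglyMeasurable
    · exact (hc.tendsto x).comp (SimpleFunc.tendsto_nearestPt (hden x))
  have hev : ∀ᶠ n in atTop, ∀ e ∈ Finset.range M, |(∫ x, basicFun e
      (SimpleFunc.nearestPt (pt : ℕ → X) n x) ∂(μ : Measure X)) - basicIntegrals μ e| < ε / 16 := by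
    rw [Filter.eventually_all_finset]
    intro e _
    have := (Metric.tendsto_nhds.1 (hlim e)) (ε / 16) (by linarith)
    simpa [Real.dist_eq] using this
  obtain ⟨n, hn⟩ := hev.exists
  choose C hC using fun e => (isBasicFun_basicFun (X := X) e).bounded
  have hC0 : ∀ e, 0 ≤ C e := fun e => (abs_nonneg _).trans (hC e (pt 0))
  -- If each of the `n + 1` weights is changed by at most `ε / 16 / D`, each of the relevant
  -- integrals changes by at most `ε / 16`.
  set D := (∑ e ∈ Finset.range M, C e) * (n + 1) + 1 with hD
  have hD0 : 0 < D := by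
    have : 0 ≤ ∑ e ∈ Finset.range M, C e := Finset.sum_nonneg fun e _ => hC0 e
    positivity
  let ind := SimpleFunc.nearestPtInd (pt : ℕ → X) n
  have hint : ∀ e, ∫ x, basicFun e (SimpleFunc.nearestPt (pt : ℕ → X) n x) ∂(μ : Measure X) =
      ∑ k ∈ Finset.range (n + 1), (μ : Measure X).real (ind ⁻¹' {k}) * basicFun e (pt k : X) := by
    intro e
    have h1 : ∀ x, basicFun e (SimpleFunc.nearestPt (pt : ℕ → X) n x) =
        ∑ k ∈ Finset.range (n + 1), (ind ⁻¹' {k}).indicator (fun _ => basicFun e (pt k : X)) x := by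
      intro x
      rw [Finset.sum_eq_single (ind x)]
      · simp [SimpleFunc.nearestPt, ind]
      · intro k _ hk
        rw [indicator_of_notMem]
        simpa using hk.symm
      · intro h
        exact absurd (Finset.mem_range.2 (Nat.lt_succ_of_le (SimpleFunc.nearestPtInd_le _ _ _))) h
    simp only [h1]
    rw [integral_finsetSum _ fun k _ =>
      (integrable_const _).indicator (SimpleFunc.measurableSet_preimage _ _)]
    refine Finset.sum_congr rfl fun k _ => ?_
    rw [integral_indicator_const _ (SimpleFunc.measurableSet_preimage _ _), smul_eq_mul]
  obtain ⟨m, v, hv, hm⟩ := exists_basicMeasure (X := X)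
    (fun k => (μ : Measure X).real (ind ⁻¹' {k})) (fun _ => measureReal_nonneg) (n + 1)
    (ε / 16 / D) (by positivity)
  refine ⟨m, ?_⟩
  rw [d_finiteMeasure]
  refine (seqDist_lt_of_abs_sub_le (n := M) (δ := ε / 8) (fun e he => ?_) (by linarith)).trans_lt
    (by linarith)
  have he' := hn e (Finset.mem_range.2 he)
  have h2 : |basicIntegrals (pt m : FiniteMeasure X) e - ∫ x, basicFun e
      (SimpleFunc.nearestPt (pt : ℕ → X) n x) ∂(μ : Measure X)| ≤ ε / 16 := by
    change |basicIntegrals (basicMeasure m : FiniteMeasure X) e - _| ≤ _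
    rw [hm, hint, ← Finset.sum_sub_distrib]
    refine (Finset.abs_sum_le_sum_abs _ _).trans ?_
    have h3 : ∀ k ∈ Finset.range (n + 1), |v k * basicFun e (pt k : X) -
        (μ : Measure X).real (ind ⁻¹' {k}) * basicFun e (pt k : X)| ≤ ε / 16 / D * C e := by
      intro k _
      rw [← sub_mul, abs_mul]
      exact mul_le_mul (hv k) (hC e _) (abs_nonneg _) (by positivity)
    refine (Finset.sum_le_sum h3).trans ?_
    rw [Finset.sum_const, Finset.card_range, nsmul_eq_mul]
    have h4 : C e ≤ ∑ e ∈ Finset.range M, C e :=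
      Finset.single_le_sum (fun i _ => hC0 i) (Finset.mem_range.2 he)
    have h5 : C e * (n + 1) ≤ D := by
      rw [hD]
      have : C e * ((n : ℝ) + 1) ≤ (∑ e ∈ Finset.range M, C e) * (n + 1) :=
        mul_le_mul_of_nonneg_right h4 (by positivity)
      linarith
    calc ((n + 1 : ℕ) : ℝ) * (ε / 16 / D * C e) = ε / 16 / D * (C e * (n + 1)) := by
          push_cast; ring
      _ ≤ ε / 16 / D * D := mul_le_mul_of_nonneg_left h5 (by positivity)
      _ = ε / 16 := by field_simp
  have h6 := abs_le.1 h2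
  have h7 := abs_lt.1 he'
  rw [abs_le]
  constructor <;> linarith [h6.1, h6.2, h7.1, h7.2]

instance : PseudoMetricPresentation (FiniteMeasure X) where
  d_self μ := by rw [d_finiteMeasure, seqDist_self]
  d_comm μ ν := by rw [d_finiteMeasure, d_finiteMeasure, seqDist_comm]
  d_triangle μ ν ρ := seqDist_triangle _ _ _

end Basic

/-! ## The values of the basic functions at the basic points are computable -/

section Stack

variable {X : Type*} [MetricSpace X] [ComputableMetricSpace X]

theorem approximable_dist :
    Approximable fun p : ℕ × ℕ => (d (pt p.1 : X) (pt p.2) : ℝ) := by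
  obtain ⟨c, hc, h⟩ := ComputableMetricSpace.computable_dist (X := X)
  refine ⟨fun p s => rat (c (Nat.pair p.1 p.2) s), fun _ s => (1 / 2 : ℝ) ^ s,
    RatFamily.rat (hc.comp ((Primrec₂.natPair.to_comp).comp (Computable.fst.comp Computable.fst)
      (Computable.snd.comp Computable.fst)) Computable.snd),
    RatFamily.half_pow Computable.snd, fun p s => ?_,
    fun _ => tendsto_pow_atTop_nhds_zero_of_lt_one (by norm_num) (by norm_num)⟩
  have hn := h (Nat.pair p.1 p.2)
  simp only [Nat.unpair_pair] at hn
  exact hn.d_le s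

theorem approximable_bump : Approximable fun p : ℕ × ℕ =>
    bump (pt p.1.unpair.1 : X) (posRat p.1.unpair.2.unpair.1)
      (posRat p.1.unpair.2.unpair.1 + posRat p.1.unpair.2.unpair.2) (pt p.2) := by
  have u1 : Computable fun p : ℕ × ℕ => p.1.unpair := Computable.unpair.comp Computable.fst
  have u2 : Computable fun p : ℕ × ℕ => p.1.unpair.2.unpair :=
    Computable.unpair.comp (Computable.snd.comp u1)
  have c1 := Computable.fst.comp u2
  have c2 := Computable.snd.comp u2
  obtain ⟨A, E, hA, hE, h, h'⟩ := ((RatFamily.posRat c1).add (RatFamily.posRat c2)).approximable.sub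
    ((approximable_dist (X := X)).reindex (k := fun p : ℕ × ℕ => (p.1.unpair.1, p.2))
      ((Computable.fst.comp u1).pair Computable.snd)) |>.rat_mul (RatFamily.inv_posRat c2)
  refine ⟨fun p s => max 0 (min 1 (A p s)), E, RatFamily.zero.max (RatFamily.one.min hA), hE,
    fun p s => ?_, h'⟩
  have h4 := posRat_pos p.1.unpair.2.unpair.2
  beta_reduce
  rw [bump_eq _ (by linarith), add_sub_cancel_left]
  refine le_trans ?_ (h p s)
  refine (abs_max_sub_max_le_max _ _ _ _).trans ?_
  rw [sub_self, abs_zero]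
  refine max_le (abs_nonneg _) ((abs_min_sub_min_le_max _ _ _ _).trans ?_)
  rw [sub_self, abs_zero]
  exact max_le (abs_nonneg _) le_rfl

/-- The binary operations of the stack machine. -/
def stackOp (κ m : ℕ) (x y : ℝ) : ℝ :=
  if κ = 2 then max x y else if κ = 3 then min x y else
    rat m.unpair.1 * x + rat m.unpair.2 * y

theorem polishStack_zero (m : ℕ) (w : List (ℕ × ℕ)) :
    (polishStack ((0, m) :: w) : List (X → ℝ)) = (fun _ => 1) :: polishStack w := by
  rw [polishStack]

theorem polishStack_one (m : ℕ) (w : List (ℕ × ℕ)) :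
    (polishStack ((1, m) :: w) : List (X → ℝ)) =
      bump (pt m.unpair.1) (posRat m.unpair.2.unpair.1)
        (posRat m.unpair.2.unpair.1 + posRat m.unpair.2.unpair.2) :: polishStack w := by
  rw [polishStack]

theorem polishStack_op (κ m : ℕ) (w : List (ℕ × ℕ)) :
    (polishStack ((κ + 2, m) :: w) : List (X → ℝ)) =
      match (polishStack w : List (X → ℝ)) with
      | f :: g :: l => (fun y => stackOp (κ + 2) m (f y) (g y)) :: l
      | l => l := by
  rcases κ with _ | _ | κ <;> rw [polishStack] <;>
    rcases (polishStack w : List (X → ℝ)) with _ | ⟨f, _ | ⟨g, l⟩⟩ <;> simp [stackOp]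

/-- `F` is a sequence of codes of rational approximations with error bounds of `v`. -/
def Approximates (F : ℕ → ℕ × ℕ) (v : ℝ) : Prop :=
  (∀ s, |rat (F s).1 - v| ≤ rat (F s).2) ∧ Tendsto (fun s => rat (F s).2) atTop (𝓝 0)

theorem Approximable.exists_code {α : Type*} [Primcodable α] {f : α → ℝ} (hf : Approximable f) :
    ∃ c : α × ℕ → ℕ × ℕ, Computable c ∧ ∀ a, Approximates (fun s => c (a, s)) (f a) := by
  obtain ⟨A, E, ⟨c, hc, hA⟩, ⟨e, he, hE⟩, h, h'⟩ := hf
  exact ⟨fun p => (c p, e p), hc.pair he, fun a => ⟨fun s => by simpa [hA, hE] using h a s,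
    by simpa [hE] using h' a⟩⟩

/-- Approximate values and error bounds are propagated together: under `max` and `min` the errors
combine to their maximum, and under a linear combination they are weighted by the absolute values of
the coefficients. -/
theorem exists_stackOp_code : ∃ op : (ℕ × ℕ) × (ℕ × ℕ) × (ℕ × ℕ) → ℕ × ℕ, Computable op ∧
    ∀ κ m F G u v, Approximates F u → Approximates G v →
      Approximates (fun s => op ((κ, m), F s, G s)) (stackOp κ m u v) := by
  let γ := (ℕ × ℕ) × (ℕ × ℕ) × (ℕ × ℕ)
  have c1 : Computable fun p : γ => p.2.1.1 := Computable.fst.comp (Computable.fst.comp Computable.snd)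
  have c2 : Computable fun p : γ => p.2.1.2 := Computable.snd.comp (Computable.fst.comp Computable.snd)
  have c3 : Computable fun p : γ => p.2.2.1 := Computable.fst.comp (Computable.snd.comp Computable.snd)
  have c4 : Computable fun p : γ => p.2.2.2 := Computable.snd.comp (Computable.snd.comp Computable.snd)
  have c5 : Computable fun p : γ => p.1.2.unpair :=
    Computable.unpair.comp (Computable.snd.comp Computable.fst)
  have ck : Computable fun p : γ => p.1.1 := Computable.fst.comp Computable.fst
  have hp := RatFamily.rat (Computable.fst.comp c5)
  have hq := RatFamily.rat (Computable.snd.comp c5)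
  obtain ⟨amax, hamax, hamax'⟩ := (RatFamily.rat c1).max (RatFamily.rat c3)
  obtain ⟨amin, hamin, hamin'⟩ := (RatFamily.rat c1).min (RatFamily.rat c3)
  obtain ⟨alin, halin, halin'⟩ := (hp.mul (RatFamily.rat c1)).add (hq.mul (RatFamily.rat c3))
  obtain ⟨e1, he1, he1'⟩ := (RatFamily.rat c2).max (RatFamily.rat c4)
  obtain ⟨e2, he2, he2'⟩ := (hp.abs.mul (RatFamily.rat c2)).add (hq.abs.mul (RatFamily.rat c4))
  have heq : ∀ n, Computable fun p : γ => decide (p.1.1 = n) := by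
    intro n
    have : Primrec fun m : ℕ => decide (m = n) :=
      PrimrecPred.decide (Primrec.eq.comp Primrec.id (Primrec.const n))
    exact this.to_comp.comp ck
  refine ⟨fun p => bif decide (p.1.1 = 2) then (amax p, e1 p) else
    bif decide (p.1.1 = 3) then (amin p, e1 p) else (alin p, e2 p),
    Computable.cond (heq 2) (hamax.pair he1) (Computable.cond (heq 3) (hamin.pair he1)
      (halin.pair he2)), fun κ m F G u v hF hG => ?_⟩
  have ht := hF.2.max hG.2
  rw [max_self] at ht
  by_cases h2 : κ = 2
  · simp only [h2, decide_true, cond_true, stackOp, if_true, Approximates, hamax', he1']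
    exact ⟨fun s => (abs_max_sub_max_le_max _ _ _ _).trans (max_le_max (hF.1 s) (hG.1 s)), ht⟩
  by_cases h3 : κ = 3
  · subst h3
    simp only [stackOp, Approximates, hamin', he1', decide_true, cond_true,
      show ((3 : ℕ) = 2) = False by simp, decide_false, cond_false, if_false, if_true]
    exact ⟨fun s => (abs_min_sub_min_le_max _ _ _ _).trans (max_le_max (hF.1 s) (hG.1 s)), ht⟩
  · simp only [stackOp, h2, h3, decide_false, cond_false, if_false, Approximates, halin', he2']
    refine ⟨fun s => ?_, by simpa using (hF.2.const_mul _).add (hG.2.const_mul _)⟩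
    have : rat m.unpair.1 * rat (F s).1 + rat m.unpair.2 * rat (G s).1 -
        (rat m.unpair.1 * u + rat m.unpair.2 * v) =
        rat m.unpair.1 * (rat (F s).1 - u) + rat m.unpair.2 * (rat (G s).1 - v) := by ring
    rw [this]
    refine (abs_add_le _ _).trans ?_
    rw [abs_mul, abs_mul]
    exact add_le_add (mul_le_mul_of_nonneg_left (hF.1 s) (abs_nonneg _))
      (mul_le_mul_of_nonneg_left (hG.1 s) (abs_nonneg _))

/-- The machine of `polishStack` is run on codes of approximations instead of functions. Its control
flow depends on the word alone, so at every precision the stack has the same shape, and an induction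
on the word relates it entry by entry to the stack of functions. An empty stack yields the default
`1`, as in `basicFun`. -/
theorem approximable_basicFun :
    Approximable fun p : ℕ × ℕ => basicFun p.1 (pt p.2 : X) := by
  obtain ⟨b, hb, hb'⟩ := (approximable_bump (X := X)).exists_code
  obtain ⟨op, hop, hop'⟩ := exists_stackOp_code
  obtain ⟨o, ho, ho'⟩ := (RatFamily.one (α := Unit)).approximable.exists_code
  let step : ℕ × ℕ → ℕ × ℕ → List (ℕ × ℕ) → List (ℕ × ℕ) := fun a x st =>
    bif decide (x.1 = 0) then o ((), a.2) :: st else bif decide (x.1 = 1) then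
      b ((x.2, a.1), a.2) :: st else
      Option.casesOn (motive := fun _ => List (ℕ × ℕ)) (st[0]?) st fun y =>
        Option.casesOn (motive := fun _ => List (ℕ × ℕ)) (st[1]?) st fun z =>
          op (x, y, z) :: st.drop 2
  have hstep : Computable fun p : ((ℕ × ℕ) × ℕ) × (ℕ × ℕ) × List (ℕ × ℕ) =>
      step (p.1.1.2, p.1.2) p.2.1 p.2.2 := by
    let γ := ((ℕ × ℕ) × ℕ) × (ℕ × ℕ) × List (ℕ × ℕ)
    have cx : Computable fun p : γ => p.2.1 := Computable.fst.comp Computable.snd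
    have cst : Computable fun p : γ => p.2.2 := Computable.snd.comp Computable.snd
    have cs : Computable fun p : γ => p.1.2 := Computable.snd.comp Computable.fst
    have ck : Computable fun p : γ => p.1.1.2 :=
      Computable.snd.comp (Computable.fst.comp Computable.fst)
    have heq : ∀ n, Computable fun p : γ => decide (p.2.1.1 = n) := by
      intro n
      have : Primrec fun m : ℕ => decide (m = n) :=
        PrimrecPred.decide (Primrec.eq.comp Primrec.id (Primrec.const n))
      exact this.to_comp.comp (Computable.fst.comp cx)
    refine Computable.cond (heq 0) (Computable.list_cons.comp (ho.comp ((Computable.const ()).pair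
      cs)) cst) (Computable.cond (heq 1) (Computable.list_cons.comp (hb.comp
      (((Computable.snd.comp cx).pair ck).pair cs)) cst) ?_)
    refine Computable.option_casesOn (Computable.list_getElem?.comp cst (Computable.const 0)) cst ?_
    refine Computable.option_casesOn (Computable.list_getElem?.comp (cst.comp Computable.fst)
      (Computable.const 1)) (cst.comp Computable.fst) ?_
    have c1 : Computable fun p : (γ × (ℕ × ℕ)) × (ℕ × ℕ) => (p.1.1.2.1, p.1.2, p.2) :=
      (cx.comp (Computable.fst.comp Computable.fst)).pair
        ((Computable.snd.comp Computable.fst).pair Computable.snd)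
    exact Computable.list_cons.comp (hop.comp c1) ((Primrec.list_drop.to_comp).comp
      (Computable.const 2) (cst.comp (Computable.fst.comp Computable.fst)))
  have key : ∀ (k : ℕ) (w : List (ℕ × ℕ)), ∃ L : List (ℕ → ℕ × ℕ),
      (∀ s, w.foldr (step (k, s)) [] = L.map fun F => F s) ∧
        List.Forall₂ (fun F f => Approximates F (f (pt k))) L (polishStack w : List (X → ℝ)) := by
    intro k w
    induction w with
    | nil => exact ⟨[], fun s => rfl, by rw [polishStack]; exact .nil⟩
    | cons x w ih =>
      obtain ⟨L, hL, hF⟩ := ih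
      obtain ⟨κ, m⟩ := x
      rcases κ with _ | _ | κ
      · refine ⟨(fun s => o ((), s)) :: L, fun s => ?_, ?_⟩
        · rw [List.foldr_cons, hL]
          rfl
        · rw [polishStack_zero]
          exact .cons (ho' ()) hF
      · refine ⟨(fun s => b ((m, k), s)) :: L, fun s => ?_, ?_⟩
        · rw [List.foldr_cons, hL]
          rfl
        · rw [zero_add, polishStack_one]
          exact .cons (hb' (m, k)) hF
      · rw [polishStack_op]
        simp only [List.foldr_cons, hL]
        generalize (polishStack w : List (X → ℝ)) = l at hF ⊢
        rcases hF with _ | ⟨h1, _ | ⟨h2, h3⟩⟩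
        · exact ⟨[], fun s => rfl, .nil⟩
        · exact ⟨[_], fun s => rfl, .cons h1 .nil⟩
        · exact ⟨_ :: _, fun s => rfl, .cons (hop' (κ + 2) m _ _ _ _ h1 h2) h3⟩
  let val : (ℕ × ℕ) × ℕ → ℕ × ℕ := fun p =>
    (((Denumerable.ofNat (List (ℕ × ℕ)) p.1.1).foldr (step (p.1.2, p.2)) [])[0]?).getD
      (o ((), p.2))
  have hval : Computable val :=
    Computable.option_getD (Computable.list_getElem?.comp (computable_list_foldr
      (f := fun (p : (ℕ × ℕ) × ℕ) x st => step (p.1.2, p.2) x st)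
      ((Computable.ofNat (List (ℕ × ℕ))).comp (Computable.fst.comp Computable.fst))
      (Computable.const []) hstep) (Computable.const 0))
      (ho.comp ((Computable.const ()).pair Computable.snd))
  have happ : ∀ p, Approximates (fun s => val (p, s)) (basicFun p.1 (pt p.2 : X)) := by
    intro p
    obtain ⟨L, hL, hF⟩ := key p.2 (Denumerable.ofNat (List (ℕ × ℕ)) p.1)
    simp only [val, hL, basicFun]
    generalize (polishStack _ : List (X → ℝ)) = l at hF ⊢
    rcases hF with _ | ⟨h1, h2⟩
    · exact ho' ()
    · exact h1
  exact ⟨fun p s => rat (val (p, s)).1, fun p s => rat (val (p, s)).2,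
    RatFamily.rat (Computable.fst.comp hval), RatFamily.rat (Computable.snd.comp hval),
    fun p => (happ p).1, fun p => (happ p).2⟩

-- Finite measures as an effectively presented space

variable [MeasurableSpace X] [BorelSpace X]

theorem approximable_basicIntegrals : Approximable fun p : ℕ × ℕ =>
    basicIntegrals (basicMeasure p.1 : FiniteMeasure X) p.2 := by
  simp only [basicIntegrals_basicMeasure]
  let l : ℕ → List (ℕ × ℕ) := Denumerable.ofNat (List (ℕ × ℕ))
  have hl : Computable fun p : ℕ × ℕ => l p.1 :=
    (Computable.ofNat (List (ℕ × ℕ))).comp Computable.fst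
  have hget : Computable fun q : (ℕ × ℕ) × ℕ => (l q.1.1).getD q.2 (0, 0) :=
    ((Primrec.list_getD (0, 0)).to_comp).comp (hl.comp Computable.fst) Computable.snd
  refine Approximable.sum (f := fun (p : ℕ × ℕ) i => (posRat ((l p.1).getD i (0, 0)).1 : ℝ) *
    basicFun p.2 (pt ((l p.1).getD i (0, 0)).2 : X)) ?_ (n := fun p => (l p.1).length)
    (Computable.list_length.comp hl)
  exact ((approximable_basicFun (X := X)).reindex (k := fun q : (ℕ × ℕ) × ℕ =>
    (q.1.2, ((l q.1.1).getD q.2 (0, 0)).2)) ((Computable.snd.comp Computable.fst).pair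
      (Computable.snd.comp hget))).rat_mul (RatFamily.posRat (Computable.fst.comp hget))

theorem approximable_seqDist_sum : Approximable fun p : (ℕ × ℕ) × ℕ =>
    ∑ i ∈ Finset.range p.2, (1 / 2 : ℝ) ^ i *
      (1 - Real.exp (-|basicIntegrals (pt p.1.1 : FiniteMeasure X) i -
        basicIntegrals (pt p.1.2 : FiniteMeasure X) i|)) := by
  have h1 : Approximable fun q : ((ℕ × ℕ) × ℕ) × ℕ =>
      basicIntegrals (pt q.1.1.1 : FiniteMeasure X) q.2 :=
    (approximable_basicIntegrals (X := X)).reindex (k := fun q : ((ℕ × ℕ) × ℕ) × ℕ =>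
      (q.1.1.1, q.2)) ((Computable.fst.comp (Computable.fst.comp Computable.fst)).pair
        Computable.snd)
  have h2 : Approximable fun q : ((ℕ × ℕ) × ℕ) × ℕ =>
      basicIntegrals (pt q.1.1.2 : FiniteMeasure X) q.2 :=
    (approximable_basicIntegrals (X := X)).reindex (k := fun q : ((ℕ × ℕ) × ℕ) × ℕ =>
      (q.1.1.2, q.2)) ((Computable.snd.comp (Computable.fst.comp Computable.fst)).pair
        Computable.snd)
  exact Approximable.sum (f := fun (p : (ℕ × ℕ) × ℕ) i => (1 / 2 : ℝ) ^ i *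
    (1 - Real.exp (-|basicIntegrals (pt p.1.1 : FiniteMeasure X) i -
      basicIntegrals (pt p.1.2 : FiniteMeasure X) i|)))
    ((h1.sub h2).one_sub_exp_neg_abs.rat_mul (RatFamily.half_pow Computable.snd)) Computable.snd

/-- The partial sums of the distance are approximable and increase to it, which gives the lower cut;
the tail is at most `2 · 2^{-n}`, which gives the upper cut. -/
instance : EffectivePresentation (FiniteMeasure X) where
  dense := dense_basicMeasure
  lt_d := by
    have h1 := (approximable_seqDist_sum (X := X)).reindex
      (k := fun q : ((ℕ × ℕ) × ℕ) × ℕ => (q.1.1, q.2))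
      ((Computable.fst.comp Computable.fst).pair Computable.snd)
    have h2 := h1.semiDec_rat_lt (RatFamily.rat (Computable.snd.comp Computable.fst))
    refine (SemiDec.ex (Q := fun (p : (ℕ × ℕ) × ℕ) n _ => rat p.2 < ∑ i ∈ Finset.range n,
      (1 / 2 : ℝ) ^ i * (1 - Real.exp (-|basicIntegrals (pt p.1.1 : FiniteMeasure X) i -
        basicIntegrals (pt p.1.2 : FiniteMeasure X) i|))) h2).of_eq fun p _ => ?_
    rw [d_finiteMeasure]
    constructor
    · intro hlt
      obtain ⟨n, hn⟩ := exists_half_pow_lt (ε := (seqDist (basicIntegrals (pt p.1.1 :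
        FiniteMeasure X)) (basicIntegrals (pt p.1.2 : FiniteMeasure X)) - rat p.2) / 2)
        (by linarith)
      exact ⟨n, by linarith [seqDist_le_sum_add (basicIntegrals (pt p.1.1 :
        FiniteMeasure X)) (basicIntegrals (pt p.1.2 : FiniteMeasure X)) n]⟩
    · rintro ⟨n, hn⟩
      exact hn.trans_le (sum_le_seqDist _ _ n)
  d_lt := by
    have h1 := (approximable_seqDist_sum (X := X)).reindex
      (k := fun q : ((ℕ × ℕ) × ℕ) × ℕ => (q.1.1, q.2))
      ((Computable.fst.comp Computable.fst).pair Computable.snd)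
    have h0 : RatFamily fun q : ((ℕ × ℕ) × ℕ) × ℕ => (2 : ℝ) := by
      simpa using RatFamily.const (α := ((ℕ × ℕ) × ℕ) × ℕ) 2
    have h2 := h1.semiDec_lt_rat ((RatFamily.rat (Computable.snd.comp Computable.fst)).sub
      (h0.mul (RatFamily.half_pow Computable.snd)))
    refine (SemiDec.ex (Q := fun (p : (ℕ × ℕ) × ℕ) n _ => ∑ i ∈ Finset.range n,
      (1 / 2 : ℝ) ^ i * (1 - Real.exp (-|basicIntegrals (pt p.1.1 : FiniteMeasure X) i -
        basicIntegrals (pt p.1.2 : FiniteMeasure X) i|)) < rat p.2 - 2 * (1 / 2 : ℝ) ^ n)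
      h2).of_eq fun p _ => ?_
    rw [d_finiteMeasure]
    constructor
    · intro hlt
      obtain ⟨n, hn⟩ := exists_half_pow_lt (ε := (rat p.2 - seqDist (basicIntegrals (pt p.1.1 :
        FiniteMeasure X)) (basicIntegrals (pt p.1.2 : FiniteMeasure X))) / 2) (by linarith)
      exact ⟨n, by linarith [sum_le_seqDist (basicIntegrals (pt p.1.1 :
        FiniteMeasure X)) (basicIntegrals (pt p.1.2 : FiniteMeasure X)) n]⟩
    · rintro ⟨n, hn⟩
      linarith [seqDist_le_sum_add (basicIntegrals (pt p.1.1 :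
        FiniteMeasure X)) (basicIntegrals (pt p.1.2 : FiniteMeasure X)) n]

/-- The integrals of the basic functions are computable functions of the measure. -/
theorem realComputableOn_basicIntegrals :
    RealComputableOn (univ : Set (FiniteMeasure X)) fun (e : ℕ) μ => basicIntegrals μ e := by
  -- The integral of the `e`-th function has weight `2^{-e}` in the distance, so entry `e + 1 + j`
  -- of the name is needed for precision `2^{-j}`.
  have key : ∀ h (μ : FiniteMeasure X), IsCauchyName h μ → ∀ e j,
      |basicIntegrals (basicMeasure (h (e + 1 + j)) : FiniteMeasure X) e - basicIntegrals μ e| ≤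
        (1 / 2 : ℝ) ^ j := by
    intro h μ hμ e j
    exact abs_sub_le_of_seqDist_le (hμ.d_le (e + 1 + j))
  have cq : Computable fun q : ((ℕ × ℕ) × ℕ) × ℕ => (q.2, q.1.1.1) :=
    Computable.snd.pair (Computable.fst.comp (Computable.fst.comp Computable.fst))
  have ap := (approximable_basicIntegrals (X := X)).reindex
    (k := fun q : ((ℕ × ℕ) × ℕ) × ℕ => (q.2, q.1.1.1)) cq
  have rc : RatFamily fun q : ((ℕ × ℕ) × ℕ) × ℕ => rat q.1.1.2 :=
    RatFamily.rat (Computable.snd.comp (Computable.fst.comp Computable.fst))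
  have rj : RatFamily fun q : ((ℕ × ℕ) × ℕ) × ℕ => (1 / 2 : ℝ) ^ q.1.2 :=
    RatFamily.half_pow (Computable.snd.comp Computable.fst)
  have hi : Computable fun p : (ℕ × ℕ) × ℕ => p.1.1 + 1 + p.2 :=
    nat_add' (Computable.succ.comp (Computable.fst.comp Computable.fst)) Computable.snd
  have h1 := SemiDec.oracle (Q := fun (p : (ℕ × ℕ) × ℕ) m _ => rat p.1.2 + (1 / 2 : ℝ) ^ p.2 <
    basicIntegrals (basicMeasure m : FiniteMeasure X) p.1.1) (ap.semiDec_rat_lt (rc.add rj)) hi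
  have h2 := SemiDec.oracle (Q := fun (p : (ℕ × ℕ) × ℕ) m _ => basicIntegrals (basicMeasure m :
    FiniteMeasure X) p.1.1 < rat p.1.2 - (1 / 2 : ℝ) ^ p.2) (ap.semiDec_lt_rat (rc.sub rj)) hi
  have h3 := SemiDec.ex (Q := fun (p : ℕ × ℕ) j h => rat p.2 + (1 / 2 : ℝ) ^ j <
    basicIntegrals (basicMeasure (h (p.1 + 1 + j)) : FiniteMeasure X) p.1) h1
  have h4 := SemiDec.ex (Q := fun (p : ℕ × ℕ) j h => basicIntegrals (basicMeasure
    (h (p.1 + 1 + j)) : FiniteMeasure X) p.1 < rat p.2 - (1 / 2 : ℝ) ^ j) h2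
  refine ⟨⟨_, h3, fun μ _ h hμ p => ⟨fun hp => ?_, ?_⟩⟩, ⟨_, h4, fun μ _ h hμ p =>
    ⟨fun hp => ?_, ?_⟩⟩⟩
  · beta_reduce at hp
    obtain ⟨j, hj⟩ := exists_half_pow_lt (ε := (basicIntegrals μ p.1 - rat p.2) / 2) (by linarith)
    exact ⟨j, by linarith [(abs_le.1 (key h μ hμ p.1 j)).1]⟩
  · rintro ⟨j, hj⟩
    beta_reduce
    linarith [(abs_le.1 (key h μ hμ p.1 j)).2]
  · beta_reduce at hp
    obtain ⟨j, hj⟩ := exists_half_pow_lt (ε := (rat p.2 - basicIntegrals μ p.1) / 2) (by linarith)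
    exact ⟨j, by linarith [(abs_le.1 (key h μ hμ p.1 j)).2]⟩
  · rintro ⟨j, hj⟩
    beta_reduce
    linarith [(abs_le.1 (key h μ hμ p.1 j)).1]

end Stack

/-! ## Maxima of truncated bump functions -/

/-- Computable data of a sequence of multiples of bump functions. -/
structure BumpFamily where
  /-- the coefficients -/
  coeff : ℕ → ℝ
  /-- the indices of the centres -/
  center : ℕ → ℕ
  /-- the codes of the inner radii -/
  rad : ℕ → ℕ
  /-- the codes of the differences of the radii -/
  gap : ℕ → ℕ
  coeff_nonneg : ∀ k, 0 ≤ coeff k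
  ratFamily_coeff : RatFamily coeff
  computable_center : Computable center
  computable_rad : Computable rad
  computable_gap : Computable gap

section MaxFun

variable {X : Type*} [MetricSpace X] [ComputableMetricSpace X]

/-- The `k`-th bump function of the family. -/
def BumpFamily.bump (B : BumpFamily) (k : ℕ) (x : X) : ℝ :=
  UniformSchnorr.bump (pt (B.center k)) (posRat (B.rad k)) (posRat (B.rad k) + posRat (B.gap k)) x

/-- The maximum of the first `n` bump functions of the family, after truncation at `u k`. -/
def BumpFamily.maxFun (B : BumpFamily) (u : ℕ → ℝ) (n : ℕ) (x : X) : ℝ :=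
  maxUpTo (fun k => B.coeff k * min (u k) (B.bump k x)) n

variable (B : BumpFamily)

theorem BumpFamily.bump_nonneg (k : ℕ) (x : X) : 0 ≤ B.bump k x :=
  UniformSchnorr.bump_nonneg _ (by linarith [posRat_pos (B.gap k)]) x

theorem BumpFamily.bump_le_one (k : ℕ) (x : X) : B.bump k x ≤ 1 :=
  UniformSchnorr.bump_le_one _ (by linarith [posRat_pos (B.gap k)]) x

theorem BumpFamily.maxFun_nonneg (u : ℕ → ℝ) (n : ℕ) (x : X) : 0 ≤ B.maxFun u n x :=
  maxUpTo_nonneg _ _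

theorem BumpFamily.maxFun_le (u : ℕ → ℝ) (n : ℕ) (x : X) : B.maxFun u n x ≤ maxUpTo B.coeff n :=
  maxUpTo_le (maxUpTo_nonneg _ _) fun k hk => le_trans (mul_le_of_le_one_right (B.coeff_nonneg k)
    ((min_le_right _ _).trans (B.bump_le_one k x))) (le_maxUpTo _ hk)

theorem BumpFamily.abs_maxFun_le (u : ℕ → ℝ) (n : ℕ) (x : X) :
    |B.maxFun u n x| ≤ maxUpTo B.coeff n := by
  rw [abs_of_nonneg (B.maxFun_nonneg u n x)]
  exact B.maxFun_le u n x

theorem BumpFamily.maxFun_mono_right (u : ℕ → ℝ) (x : X) : Monotone fun n => B.maxFun u n x :=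
  maxUpTo_mono _

/-- Truncation is nonexpansive in the level and a maximum of functions is nonexpansive, so only the
largest coefficient enters. This controls the replacement of real levels `u k` by rational ones. -/
theorem BumpFamily.maxFun_le_add {u v : ℕ → ℝ} {n : ℕ} {ε : ℝ} (hε : 0 ≤ ε)
    (h : ∀ k < n, u k ≤ v k + ε) (x : X) :
    B.maxFun u n x ≤ B.maxFun v n x + maxUpTo B.coeff n * ε := by
  have h0 : 0 ≤ maxUpTo B.coeff n * ε := mul_nonneg (maxUpTo_nonneg _ _) hε
  refine maxUpTo_le (add_nonneg (B.maxFun_nonneg _ _ _) h0) fun k hk => ?_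
  have h1 : min (u k) (B.bump k x) ≤ min (v k) (B.bump k x) + ε := by
    rw [← min_add_add_right]
    exact min_le_min (h k hk) (by linarith)
  have h2 : B.coeff k * min (v k) (B.bump k x) ≤ B.maxFun v n x :=
    le_maxUpTo (fun k => B.coeff k * min (v k) (B.bump k x)) hk
  have h3 : B.coeff k * ε ≤ maxUpTo B.coeff n * ε :=
    mul_le_mul_of_nonneg_right (le_maxUpTo _ hk) hε
  have h4 := mul_le_mul_of_nonneg_left h1 (B.coeff_nonneg k)
  linarith

theorem BumpFamily.maxFun_mono_left {u v : ℕ → ℝ} {n : ℕ} (h : ∀ k < n, u k ≤ v k) (x : X) :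
    B.maxFun u n x ≤ B.maxFun v n x := by
  simpa using B.maxFun_le_add le_rfl (by simpa using h) x

theorem BumpFamily.maxFun_succ_of_eq_zero {u : ℕ → ℝ} {n : ℕ} (h : u n = 0) (x : X) :
    B.maxFun u (n + 1) x = B.maxFun u n x := by
  rw [maxFun, maxUpTo, h, min_eq_left (B.bump_nonneg n x), mul_zero]
  exact max_eq_right (B.maxFun_nonneg u n x)

theorem BumpFamily.continuous_maxFun (u : ℕ → ℝ) (n : ℕ) :
    Continuous (B.maxFun u n : X → ℝ) := by
  induction n with
  | zero => exact continuous_const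
  | succ n ih =>
    have h : Continuous (B.bump n : X → ℝ) :=
      continuous_bump _ (by linarith [posRat_pos (B.gap n)])
    exact (continuous_const.mul (continuous_const.min h)).max ih

/-- A term for `B.maxFun u n` if `l` lists codes of the numbers `u k`; `o` and `q` are codes of `0`
and of the coefficients. -/
def BumpFamily.word (o : ℕ) (q : ℕ → ℕ) (l : List ℕ) : ℕ → List (ℕ × ℕ)
  | 0 => [(4, Nat.pair o o), (0, 0), (0, 0)]
  | n + 1 => (2, 0) :: (4, Nat.pair (q n) o) :: (3, 0) :: (4, Nat.pair (l.getD n 0) o) :: (0, 0) ::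
      (0, 0) :: (1, Nat.pair (B.center n) (Nat.pair (B.rad n) (B.gap n))) :: (0, 0) ::
        BumpFamily.word o q l n

/-- The linear operation is binary, so every scalar multiple carries the constant `1` as a dummy
second argument with coefficient `0`. -/
theorem BumpFamily.polishStack_word {o : ℕ} {q : ℕ → ℕ} (ho : rat o = 0)
    (hq : ∀ k, rat (q k) = B.coeff k) (l : List ℕ) (n : ℕ) :
    (polishStack (B.word o q l n) : List (X → ℝ)) = [B.maxFun (fun k => rat (l.getD k 0)) n] := by
  induction n with
  | zero =>
    simp only [word, polishStack, Nat.unpair_pair, ho]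
    congr 1
    funext x
    simp [maxFun, maxUpTo]
  | succ n ih =>
    simp only [word, polishStack, ih, Nat.unpair_pair, ho, hq, mul_one, add_zero]
    rfl

theorem BumpFamily.exists_basicFun : ∃ E : ℕ × List ℕ → ℕ, Computable E ∧ ∀ p,
    (basicFun (E p) : X → ℝ) = B.maxFun (fun k => rat (p.2.getD k 0)) p.1 := by
  obtain ⟨o, ho⟩ := exists_rat 0
  obtain ⟨q, hqc, hq⟩ := B.ratFamily_coeff
  refine ⟨fun p => Encodable.encode (B.word o q p.2 p.1), Computable.encode.comp ?_, fun p => ?_⟩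
  · let γ := (ℕ × List ℕ) × ℕ × List (ℕ × ℕ)
    have cn : Computable fun p : γ => p.2.1 := Computable.fst.comp Computable.snd
    have cw : Computable fun p : γ => p.2.2 := Computable.snd.comp Computable.snd
    have cl : Computable fun p : γ => p.1.2.getD p.2.1 0 :=
      ((Primrec.list_getD 0).to_comp).comp (Computable.snd.comp Computable.fst) cn
    have hpair : Computable₂ Nat.pair := Primrec₂.natPair.to_comp
    have hc : ∀ {f g : γ → ℕ} {w : γ → List (ℕ × ℕ)}, Computable f → Computable g → Computable w →
        Computable fun p => (f p, g p) :: w p :=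
      fun hf hg hw => Computable.list_cons.comp (hf.pair hg) hw
    have h0 : ∀ n : ℕ, Computable fun _ : γ => n := fun n => Computable.const n
    refine (Computable.nat_rec (f := fun p : ℕ × List ℕ => p.1)
      (g := fun _ => [(4, Nat.pair o o), (0, 0), (0, 0)])
      (h := fun p y => (2, 0) :: (4, Nat.pair (q y.1) o) :: (3, 0) ::
        (4, Nat.pair (p.2.getD y.1 0) o) :: (0, 0) :: (0, 0) ::
        (1, Nat.pair (B.center y.1) (Nat.pair (B.rad y.1) (B.gap y.1))) :: (0, 0) :: y.2)
      Computable.fst (Computable.const _) ?_).of_eq fun p => ?_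
    · exact hc (h0 2) (h0 0) (hc (h0 4) (hpair.comp (hqc.comp cn) (h0 o)) (hc (h0 3) (h0 0)
        (hc (h0 4) (hpair.comp cl (h0 o)) (hc (h0 0) (h0 0) (hc (h0 0) (h0 0) (hc (h0 1)
          (hpair.comp (B.computable_center.comp cn) (hpair.comp (B.computable_rad.comp cn)
            (B.computable_gap.comp cn))) (hc (h0 0) (h0 0) cw)))))))
    · induction p.1 with
      | zero => rfl
      | succ n ih => simp only [ih, word]
  · rw [basicFun, Denumerable.ofNat_encode, B.polishStack_word (by simpa using ho) hq]
    rfl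

-- Integrals of the maxima are computable in the parameter and the measure

variable [MeasurableSpace X] [BorelSpace X]

theorem BumpFamily.integrable_maxFun (u : ℕ → ℝ) (n : ℕ) (μ : FiniteMeasure X) :
    Integrable (B.maxFun u n) (μ : Measure X) :=
  integrable_of_continuous_of_bounded (B.continuous_maxFun u n) (B.abs_maxFun_le u n) _

theorem BumpFamily.integral_maxFun_le_add {u v : ℕ → ℝ} {n : ℕ} {ε : ℝ} (hε : 0 ≤ ε)
    (h : ∀ k < n, u k ≤ v k + ε) (μ : FiniteMeasure X) :
    ∫ x, B.maxFun u n x ∂(μ : Measure X) ≤ (∫ x, B.maxFun v n x ∂(μ : Measure X)) +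
      (μ : Measure X).real univ * maxUpTo B.coeff n * ε := by
  have h1 := integral_mono (B.integrable_maxFun u n μ) ((B.integrable_maxFun v n μ).add
    (integrable_const (maxUpTo B.coeff n * ε))) (fun x => B.maxFun_le_add hε h x)
  rw [integral_add' (B.integrable_maxFun v n μ) (integrable_const _), integral_const,
    smul_eq_mul] at h1
  linarith

theorem BumpFamily.integral_maxFun_mono {u v : ℕ → ℝ} {n : ℕ} (h : ∀ k < n, u k ≤ v k)
    (μ : FiniteMeasure X) :
    ∫ x, B.maxFun u n x ∂(μ : Measure X) ≤ ∫ x, B.maxFun v n x ∂(μ : Measure X) :=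
  integral_mono (B.integrable_maxFun u n μ) (B.integrable_maxFun v n μ)
    (fun x => B.maxFun_mono_left h x)

theorem exists_list_getD (n : ℕ) (P : ℕ → ℕ → Prop) (h : ∀ k < n, ∃ c, P k c) :
    ∃ l : List ℕ, ∀ k < n, P k (l.getD k 0) := by
  choose! c hc using h
  refine ⟨(List.range n).map c, fun k hk => ?_⟩
  simpa [hk] using hc k hk

variable {A : Type*} [MetricSpace A] [ComputableMetricSpace A]

theorem realComputableOn_snd_basicIntegrals :
    RealComputableOn (univ : Set (A × FiniteMeasure X)) fun (e : ℕ) z => basicIntegrals z.2 e :=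
  (realComputableOn_basicIntegrals (X := X)).comap (k := Prod.snd)
    (φ := fun n => n.unpair.2) (Primrec.snd.comp Primrec.unpair)
    fun _ _ h => (isCauchyName_prod.1 h).2

/-- For rational levels the maximum is a basic function with a computable index, so its integral is
computable. The integral is monotone in the levels, so rational levels below (above) the `u k z`
certify lower (upper) bounds. Levels within `ε` lose at most mass times largest coefficient times
`ε`, so every strict bound is certified. -/
theorem BumpFamily.realComputableOn_integral {u : ℕ → A × FiniteMeasure X → ℝ}
    (hu : RealComputableOn univ u) : RealComputableOn univ fun (n : ℕ) (z : A × FiniteMeasure X) =>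
      ∫ x, B.maxFun (fun k => u k z) n x ∂(z.2 : Measure X) := by
  obtain ⟨E, hE, hE'⟩ := B.exists_basicFun (X := X)
  have hint : ∀ (z : A × FiniteMeasure X) p, basicIntegrals z.2 (E p) =
      ∫ x, B.maxFun (fun k => rat (p.2.getD k 0)) p.1 x ∂(z.2 : Measure X) := fun z p => by
    rw [basicIntegrals, hE']
  have cE : Computable fun q : (ℕ × ℕ) × List ℕ => E (q.1.1, q.2) :=
    hE.comp ((Computable.fst.comp Computable.fst).pair Computable.snd)
  have hI := (realComputableOn_snd_basicIntegrals (A := A) (X := X)).reindex cE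
  have rp : RatFamily fun q : (ℕ × ℕ) × List ℕ => rat q.1.2 :=
    RatFamily.rat (Computable.snd.comp Computable.fst)
  have cn : Computable fun q : (ℕ × ℕ) × List ℕ => q.1.1 := Computable.fst.comp Computable.fst
  have rl : RatFamily fun q : ((ℕ × ℕ) × List ℕ) × ℕ => rat (q.1.2.getD q.2 0) :=
    RatFamily.rat (((Primrec.list_getD 0).to_comp).comp (Computable.snd.comp Computable.fst)
      Computable.snd)
  have hu' := hu.reindex (k := fun q : ((ℕ × ℕ) × List ℕ) × ℕ => q.2) Computable.snd
  have hb : ∀ δ > 0, ∀ (z : A × FiniteMeasure X) (n : ℕ), ∃ ε > 0,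
      (z.2 : Measure X).real univ * maxUpTo B.coeff n * ε < δ := by
    intro δ hδ z n
    have h0 : 0 ≤ (z.2 : Measure X).real univ * maxUpTo B.coeff n :=
      mul_nonneg measureReal_nonneg (maxUpTo_nonneg _ _)
    refine ⟨δ / ((z.2 : Measure X).real univ * maxUpTo B.coeff n + 1), by positivity, ?_⟩
    rw [mul_div_assoc', div_lt_iff₀ (by positivity)]
    nlinarith
  constructor
  · have h1 := SemiDecOn.ball (P := fun (q : (ℕ × ℕ) × List ℕ) k z => rat (q.2.getD k 0) < u k z)
      (hu'.rat_lt rl) cn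
    refine (SemiDecOn.exList (P := fun (q : ℕ × ℕ) l z => (∀ k < q.1, rat (l.getD k 0) < u k z) ∧
      rat q.2 < basicIntegrals z.2 (E (q.1, l))) (h1.and (hI.rat_lt rp))).congr
      fun z _ q => ⟨fun hq => ?_, ?_⟩
    · beta_reduce at hq
      obtain ⟨ε, hε, hlt⟩ := hb _ (sub_pos.2 hq) z q.1
      obtain ⟨l, hl⟩ := exists_list_getD q.1 (fun k c => u k z - ε < rat c ∧ rat c < u k z)
        fun k _ => exists_rat_btwn' (by linarith)
      refine ⟨l, fun k hk => (hl k hk).2, ?_⟩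
      rw [hint]
      have := B.integral_maxFun_le_add (u := fun k => u k z) (v := fun k => rat (l.getD k 0))
        hε.le (fun k hk => by linarith [(hl k hk).1]) z.2
      linarith
    · rintro ⟨l, hl, hlt⟩
      rw [hint] at hlt
      exact hlt.trans_le (B.integral_maxFun_mono (fun k hk => (hl k hk).le) z.2)
  · have h1 := SemiDecOn.ball (P := fun (q : (ℕ × ℕ) × List ℕ) k z => u k z < rat (q.2.getD k 0))
      (hu'.lt_rat rl) cn
    refine (SemiDecOn.exList (P := fun (q : ℕ × ℕ) l z => (∀ k < q.1, u k z < rat (l.getD k 0)) ∧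
      basicIntegrals z.2 (E (q.1, l)) < rat q.2) (h1.and (hI.lt_rat rp))).congr
      fun z _ q => ⟨fun hq => ?_, ?_⟩
    · beta_reduce at hq
      obtain ⟨ε, hε, hlt⟩ := hb _ (sub_pos.2 hq) z q.1
      obtain ⟨l, hl⟩ := exists_list_getD q.1 (fun k c => u k z < rat c ∧ rat c < u k z + ε)
        fun k _ => exists_rat_btwn' (by linarith)
      refine ⟨l, fun k hk => (hl k hk).1, ?_⟩
      rw [hint]
      have := B.integral_maxFun_le_add (u := fun k => rat (l.getD k 0)) (v := fun k => u k z)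
        hε.le (fun k hk => by linarith [(hl k hk).2]) z.2
      linarith
    · rintro ⟨l, hl, hlt⟩
      rw [hint] at hlt
      exact (B.integral_maxFun_mono (fun k hk => (hl k hk).le) z.2).trans_lt hlt

end MaxFun

open PseudoMetricPresentation

/-! ## Leaving an effectively closed set -/

section Exit

variable {Z : Type*} [MetricPresentation Z] [EffectivePresentation Z]

/-- A computable function which vanishes on an effectively closed set and which, off that set, is
eventually greater than `1`. -/
theorem EffectivelyClosed.exists_exit {K : Set Z} (hK : EffectivelyClosed K) :
    ∃ out : ℕ → Z → ℝ, RealComputableOn univ out ∧ (∀ z ∈ K, ∀ n, out n z = 0) ∧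
      (∀ z, Monotone fun n => out n z) ∧
        ∀ z, z ∉ K → ∃ n, 1 < out n z := by
  obtain ⟨I, ⟨_, hI⟩, hKI⟩ := hK
  let χ : ℕ → ℝ := fun i => if i ∈ I then 1 else 0
  have hχ : RatFamily χ := by
    obtain ⟨a, ha⟩ := exists_rat 0
    obtain ⟨b, hb⟩ := exists_rat 1
    refine ⟨fun i => bif decide (i ∈ I) then b else a,
      Computable.cond hI (Computable.const b) (Computable.const a), fun i => ?_⟩
    by_cases hi : i ∈ I <;> simp [hi, χ, ha, hb]
  have hχ0 : ∀ i, 0 ≤ χ i := fun i => by simp only [χ]; split_ifs <;> norm_num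
  -- Inside an enumerated ball the depth `radius - distance` is positive and its multiples by `n`
  -- grow beyond all bounds; a point of `K` lies in no such ball, so there the terms are nonpositive
  -- and the floor `0` of `maxUpTo` takes over.
  let term : ℕ → ℕ → Z → ℝ := fun n i z =>
    χ i * (n * (posRat i.unpair.2 - d (pt i.unpair.1) z))
  have hterm : RealComputableOn univ fun p : ℕ × ℕ => term p.1 p.2 := by
    have hu : Computable fun p : ℕ × ℕ => p.2.unpair := Computable.unpair.comp Computable.snd
    exact (((RealComputableOn.of_rat (RatFamily.posRat (Computable.snd.comp hu))).sub
      (realComputableOn_d.reindex (Computable.fst.comp hu))).rat_mul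
      (RatFamily.nat Computable.fst)).rat_mul (hχ.reindex Computable.snd)
  have hKc : ∀ z, z ∉ K ↔ ∃ i ∈ I, d z (pt i.unpair.1) < posRat i.unpair.2 := by
    intro z
    rw [← mem_compl_iff, hKI]
    simp [basicBall]
  refine ⟨fun n z => maxUpTo (fun i => term n i z) n,
    RealComputableOn.maxUpTo hterm Computable.id, fun z hz n => ?_,
    fun z => ?_, fun z hz => ?_⟩
  · refine le_antisymm (maxUpTo_le le_rfl fun i _ => ?_) (maxUpTo_nonneg _ _)
    by_cases hi : i ∈ I
    · have : (posRat i.unpair.2 : ℝ) ≤ d z (pt i.unpair.1) := by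
        by_contra! hlt
        exact (hKc z).2 ⟨i, hi, hlt⟩ hz
      rw [d_comm] at this
      exact mul_nonpos_of_nonneg_of_nonpos (hχ0 i)
        (mul_nonpos_of_nonneg_of_nonpos (Nat.cast_nonneg n) (by linarith))
    · simp [term, χ, hi]
  · intro m n hmn
    refine maxUpTo_le (maxUpTo_nonneg _ _) fun i hi => ?_
    rcases le_total 0 ((posRat i.unpair.2 : ℝ) - d (pt i.unpair.1) z) with h | h
    · refine le_trans ?_ (le_maxUpTo (fun i => term n i z) (hi.trans_le hmn))
      refine mul_le_mul_of_nonneg_left (mul_le_mul_of_nonneg_right ?_ h) (hχ0 i)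
      exact_mod_cast hmn
    · exact (mul_nonpos_of_nonneg_of_nonpos (hχ0 i)
        (mul_nonpos_of_nonneg_of_nonpos (Nat.cast_nonneg m) h)).trans (maxUpTo_nonneg _ _)
  · obtain ⟨i, hi, hlt⟩ := (hKc z).1 hz
    rw [d_comm] at hlt
    obtain ⟨n, hn⟩ := exists_nat_gt (1 / ((posRat i.unpair.2 : ℝ) - d (pt i.unpair.1) z))
    rw [div_lt_iff₀ (by linarith)] at hn
    -- The stage must both magnify the depth beyond `1` and be late enough to include ball `i`.
    refine ⟨max n (i + 1), lt_of_lt_of_le ?_ (le_maxUpTo _ (lt_max_of_lt_right (Nat.lt_succ_self i)))⟩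
    simp only [term, χ, if_pos hi, one_mul]
    refine hn.trans_le (mul_le_mul_of_nonneg_right ?_ (by linarith))
    exact_mod_cast le_max_left _ _

end Exit

/-! ## Extension of tests from an effectively closed set -/

section Extension

variable {A X : Type*} [MetricSpace A] [ComputableMetricSpace A]
  [MetricSpace X] [ComputableMetricSpace X] [MeasurableSpace X] [BorelSpace X]

theorem EReal.coe_iSup_ofReal (f : ℕ → ℝ) (hf : ∀ n, 0 ≤ f n) :
    ((⨆ n, ENNReal.ofReal (f n) : ℝ≥0∞) : EReal) = ⨆ n, (f n : EReal) := by
  have h : ∀ n, ((ENNReal.ofReal (f n) : ℝ≥0∞) : EReal) = (f n : EReal) := fun n => by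
    rw [EReal.coe_ennreal_ofReal, max_eq_left (hf n)]
  apply le_antisymm
  · have h0 : (0 : EReal) ≤ ⨆ n, (f n : EReal) :=
      (EReal.coe_nonneg.2 (hf 0)).trans (le_iSup (fun n => (f n : EReal)) 0)
    rw [← EReal.coe_toENNReal h0, EReal.coe_ennreal_le_coe_ennreal_iff]
    refine iSup_le fun n => ?_
    rw [← EReal.coe_ennreal_le_coe_ennreal_iff, EReal.coe_toENNReal h0, h]
    exact le_iSup (fun n => (f n : EReal)) n
  · refine iSup_le fun n => ?_
    rw [← h, EReal.coe_ennreal_le_coe_ennreal_iff]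
    exact le_iSup (fun n => ENNReal.ofReal (f n)) n

theorem lintegral_iSup_maxFun (B : BumpFamily) (u : ℕ → ℝ) (μ : FiniteMeasure X) :
    ∫⁻ x, ⨆ n, ENNReal.ofReal (B.maxFun u n x) ∂(μ : Measure X) =
      ⨆ n, ENNReal.ofReal (∫ x, B.maxFun u n x ∂(μ : Measure X)) := by
  rw [lintegral_iSup]
  · congr 1
    funext n
    rw [ofReal_integral_eq_lintegral_ofReal (B.integrable_maxFun u n μ)
      (.of_forall fun x => B.maxFun_nonneg u n x)]
  · exact fun n => (B.continuous_maxFun u n).measurable.ennreal_ofReal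
  · exact fun m n hmn x => ENNReal.ofReal_le_ofReal (B.maxFun_mono_right u x hmn)

variable {K : Set (A × FiniteMeasure X)}

theorem RealComputableOn.comap_fst {α : Type*} [Primcodable α] {f : α → A × FiniteMeasure X → ℝ} (hf : RealComputableOn K f) :
    RealComputableOn {p : A × FiniteMeasure X × X | (p.1, p.2.1) ∈ K}
      fun a p => f a (p.1, p.2.1) :=
  hf.comap (k := fun p : A × FiniteMeasure X × X => (p.1, p.2.1))
    (φ := fun n => Nat.pair n.unpair.1 n.unpair.2.unpair.1)
    (Primrec₂.natPair.comp (Primrec.fst.comp Primrec.unpair) (Primrec.fst.comp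
      (Primrec.unpair.comp (Primrec.snd.comp Primrec.unpair)))) fun h p hp => by
    obtain ⟨h1, h2⟩ := isCauchyName_prod.1 hp
    rw [isCauchyName_prod]
    simp only [Nat.unpair_pair]
    exact ⟨h1, (isCauchyName_prod.1 h2).1⟩

/-- The levels `u` are throttled to `v = min u κ`, which changes nothing on `K`. Everywhere else the
throttle keeps the integral finite and computable, although the supremum formed with `u` itself may
have infinite integral there. The total computability of `F` is essential: the throttle compares
with `F` off `K` too. -/
theorem BumpFamily.exists_test (hK : EffectivelyClosed K) (B : BumpFamily)
    {u : ℕ → A × FiniteMeasure X → ℝ} (hu : RealComputableOn univ u) (hu1 : ∀ k z, u k z ≤ 1)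
    (hu0 : ∀ k z, 0 ≤ u k z)
    {F : A × FiniteMeasure X → ℝ} (hF : RealComputableOn univ fun (_ : Unit) z => F z)
    (hF0 : ∀ z, 0 ≤ F z)
    (hint : ∀ z ∈ K, ∫⁻ x, ⨆ n, ENNReal.ofReal (B.maxFun (fun k => u k z) n x)
      ∂(z.2 : Measure X) = ENNReal.ofReal (F z)) :
    ∃ t : A → FiniteMeasure X → X → ℝ≥0∞, IsUniformSchnorrTest t ∧ ∀ a μ, (a, μ) ∈ K → ∀ x,
      t a μ x = ⨆ n, ENNReal.ofReal (B.maxFun (fun k => u k (a, μ)) n x) := by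
  obtain ⟨out, hout, hout0, hout_mono, hout2⟩ := hK.exists_exit
  let I : ℕ → A × FiniteMeasure X → ℝ := fun n z =>
    ∫ x, B.maxFun (fun k => u k z) n x ∂(z.2 : Measure X)
  have hI : RealComputableOn univ I := B.realComputableOn_integral hu
  have hF' : RealComputableOn univ fun (_ : ℕ) z => F z := hF.reindex (Computable.const ())
  -- The `k`-th bump function first enters the maximum of length `k + 1`, so `I (k + 1)` is tested
  -- before it is admitted. Excess `2^{-k}` over `F`, or an exit value of at least `1`, blocks it
  -- completely; the linear ramp in between keeps `κ` computable.
  let κ : ℕ → A × FiniteMeasure X → ℝ := fun k z =>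
    max 0 (min (1 - out k z) (1 - (2 : ℝ) ^ k * (I (k + 1) z - F z)))
  have hκ : RealComputableOn univ κ := by
    have r2 : RatFamily fun k : ℕ => (2 : ℝ) ^ k := by
      simpa using (RatFamily.const (α := ℕ) 2).pow Computable.id
    have r1 : RealComputableOn (univ : Set (A × FiniteMeasure X)) fun (_ : ℕ) _ => (1 : ℝ) :=
      .of_rat .one
    have r0 : RealComputableOn (univ : Set (A × FiniteMeasure X)) fun (_ : ℕ) _ => (0 : ℝ) :=
      .of_rat .zero
    exact r0.max ((r1.sub hout).min (r1.sub (((hI.reindex Computable.succ).sub hF').rat_mul r2)))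
  let v : ℕ → A × FiniteMeasure X → ℝ := fun k z => min (u k z) (κ k z)
  have hv : RealComputableOn univ v := hu.min hκ
  let J : ℕ → A × FiniteMeasure X → ℝ := fun n z =>
    ∫ x, B.maxFun (fun k => v k z) n x ∂(z.2 : Measure X)
  have hJ : RealComputableOn univ J := B.realComputableOn_integral hv
  have hJ_mono : ∀ z, Monotone fun n => J n z := fun z m n hmn =>
    integral_mono (B.integrable_maxFun _ _ _) (B.integrable_maxFun _ _ _)
      fun x => B.maxFun_mono_right _ x hmn
  have hJI : ∀ n z, J n z ≤ I n z := fun n z =>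
    B.integral_maxFun_mono (fun k _ => min_le_left _ _) z.2
  have hJ0 : ∀ n z, 0 ≤ J n z := fun n z => integral_nonneg fun x => B.maxFun_nonneg _ _ x
  have hJ_zero : ∀ z, J 0 z = 0 := fun z => integral_zero _ _
  have hsup : ∀ z ∈ K, ⨆ n, ENNReal.ofReal (I n z) = ENNReal.ofReal (F z) := fun z hz => by
    rw [← hint z hz, lintegral_iSup_maxFun]
  have hIF : ∀ z ∈ K, ∀ n, I n z ≤ F z := fun z hz n => by
    rw [← ENNReal.ofReal_le_ofReal_iff (hF0 z), ← hsup z hz]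
    exact le_iSup (fun n => ENNReal.ofReal (I n z)) n
  have hκK : ∀ z ∈ K, ∀ k, 1 ≤ κ k z := fun z hz k => by
    refine le_max_of_le_right (le_min (by rw [hout0 z hz]; simp) ?_)
    have : (2 : ℝ) ^ k * (I (k + 1) z - F z) ≤ 0 :=
      mul_nonpos_of_nonneg_of_nonpos (by positivity) (by linarith [hIF z hz (k + 1)])
    linarith
  have hvK : ∀ z ∈ K, (fun k => v k z) = fun k => u k z := fun z hz =>
    funext fun k => min_eq_left ((hu1 k z).trans (hκK z hz k))
  have hJ_succ : ∀ k z, κ k z = 0 → J (k + 1) z = J k z := fun k z h => by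
    have : v k z = 0 := by
      simp only [v, h]
      exact min_eq_right (hu0 k z)
    exact integral_congr_ae (.of_forall fun x =>
      B.maxFun_succ_of_eq_zero (u := fun k => v k z) this x)
  -- At each later stage `N ≥ n` either the throttle is closed and `J` does not grow, or it is
  -- partly open and then `J (N + 1) ≤ I (N + 1) < F + 2^{-N}`.
  have hJ_le : ∀ z n N, J N z ≤ max (J n z) (F z + (1 / 2 : ℝ) ^ n) := by
    intro z n N
    rcases le_total N n with h | h
    · exact (hJ_mono z h).trans (le_max_left _ _)
    induction N, h using Nat.le_induction with
    | base => exact le_max_left _ _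
    | succ N hN ih =>
      by_cases h0 : κ N z = 0
      · rw [hJ_succ N z h0]; exact ih
      · have h1 : 0 < 1 - (2 : ℝ) ^ N * (I (N + 1) z - F z) := by
          by_contra! hle
          exact h0 (max_eq_left ((min_le_right _ _).trans hle))
        have h2 : (1 / 2 : ℝ) ^ N * (2 : ℝ) ^ N = 1 := by rw [← mul_pow]; norm_num
        have h3 : (0 : ℝ) < (1 / 2 : ℝ) ^ N := by positivity
        have h4 : I (N + 1) z - F z < (1 / 2 : ℝ) ^ N := by nlinarith
        have h5 : (1 / 2 : ℝ) ^ N ≤ (1 / 2 : ℝ) ^ n :=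
          pow_le_pow_of_le_one (by norm_num) (by norm_num) hN
        exact le_max_of_le_right (by linarith [hJI (N + 1) z])
  -- Exit values increase with the stage, so the throttle stays closed from `n` on.
  have hJ_const : ∀ z n, 1 < out n z → ∀ N, J N z ≤ J n z := by
    intro z n h N
    rcases le_total N n with h' | h'
    · exact hJ_mono z h'
    induction N, h' using Nat.le_induction with
    | base => exact le_rfl
    | succ N hN ih =>
      rw [hJ_succ N z (max_eq_left ((min_le_left _ _).trans (by linarith [hout_mono z hN])))]
      exact ih
  have hJ_bdd : ∀ z n, J n z ≤ F z + 1 := fun z n => by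
    have := hJ_le z 0 n
    rw [hJ_zero, pow_zero, max_eq_right (by linarith [hF0 z])] at this
    exact this
  let t : A → FiniteMeasure X → X → ℝ≥0∞ := fun a μ x =>
    ⨆ n, ENNReal.ofReal (B.maxFun (fun k => v k (a, μ)) n x)
  have htint : ∀ (a : A) (μ : FiniteMeasure X), ∫⁻ x, t a μ x ∂(μ : Measure X) = ⨆ n, ENNReal.ofReal (J n (a, μ)) :=
    fun a μ => lintegral_iSup_maxFun B (fun k => v k (a, μ)) μ
  have htlt : ∀ (a : A) (μ : FiniteMeasure X), ∫⁻ x, t a μ x ∂(μ : Measure X) < ∞ := fun a μ => by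
    rw [htint]
    exact (iSup_le fun n => ENNReal.ofReal_le_ofReal (hJ_bdd (a, μ) n)).trans_lt
      ENNReal.ofReal_lt_top
  let L : A × FiniteMeasure X → ℝ := fun z => (∫⁻ x, t z.1 z.2 x ∂(z.2 : Measure X)).toReal
  have hL : ∀ z, ENNReal.ofReal (L z) = ⨆ n, ENNReal.ofReal (J n z) := fun z => by
    rw [ENNReal.ofReal_toReal (htlt _ _).ne, htint]
  have hL0 : ∀ z, 0 ≤ L z := fun z => ENNReal.toReal_nonneg
  have hJL : ∀ n z, J n z ≤ L z := fun n z => by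
    rw [← ENNReal.ofReal_le_ofReal_iff (hL0 z), hL]
    exact le_iSup (fun n => ENNReal.ofReal (J n z)) n
  have hLle : ∀ z b, 0 ≤ b → (∀ n, J n z ≤ b) → L z ≤ b := fun z b hb h => by
    rw [← ENNReal.ofReal_le_ofReal_iff hb, hL]
    exact iSup_le fun n => ENNReal.ofReal_le_ofReal (h n)
  have hLK : ∀ z ∈ K, L z = F z := fun z hz => by
    have h1 : ∀ n, J n z = I n z := fun n => by simp only [J, I, hvK z hz]
    have h2 : ENNReal.ofReal (L z) = ENNReal.ofReal (F z) := by
      rw [hL, ← hsup z hz]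
      simp only [h1]
    rw [← ENNReal.toReal_ofReal (hL0 z), h2, ENNReal.toReal_ofReal (hF0 z)]
  refine ⟨t, ⟨?_, htlt, ?_⟩, fun a μ h x => by simp only [t, hvK (a, μ) h]⟩
  · refine ⟨fun p => B.maxFun (fun k => v k (p.2.1, p.2.2.1)) p.1 p.2.2.2, ?_, fun p _ => ?_⟩
    · have hv' : RealComputableOn (univ : Set (A × FiniteMeasure X × X))
          fun (k : ℕ) p => v k (p.1, p.2.1) :=
        hv.comap_fst
      have hb : RealComputableOn (univ : Set (A × FiniteMeasure X × X))
          fun (k : ℕ) p => B.bump k p.2.2 :=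
        (realComputableOn_bump B.computable_center B.computable_rad B.computable_gap).comap
          (k := fun p : A × FiniteMeasure X × X => p.2.2)
          (φ := fun n => n.unpair.2.unpair.2) (Primrec.snd.comp
            (Primrec.unpair.comp (Primrec.snd.comp Primrec.unpair)))
          fun h p hp => (isCauchyName_prod.1 (isCauchyName_prod.1 hp).2).2
      have hm : RealComputableOn (univ : Set (A × FiniteMeasure X × X)) fun (n : ℕ) p =>
          maxUpTo (fun k => B.coeff k * min (v k (p.1, p.2.1)) (B.bump k p.2.2)) n :=
        RealComputableOn.maxUpTo (f := fun (n : ℕ) k (p : A × FiniteMeasure X × X) =>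
          B.coeff k * min (v k (p.1, p.2.1)) (B.bump k p.2.2))
          (((hv'.min hb).rat_mul B.ratFamily_coeff).reindex (k := fun q : ℕ × ℕ => q.2)
            Computable.snd) Computable.id
      exact hm.uncurry.computableFunOn
    · exact EReal.coe_iSup_ofReal _ fun n => B.maxFun_nonneg _ _ _
  · refine RealComputableOn.computableFunOn (f := L) ⟨?_, ?_⟩
    · have h1 : SemiDecOn univ fun (q : (Unit × ℕ) × ℕ) z => rat q.1.2 < J q.2 z :=
        (hJ.reindex (k := fun q : (Unit × ℕ) × ℕ => q.2) Computable.snd).rat_lt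
          (RatFamily.rat (Computable.snd.comp Computable.fst))
      have h0 : SemiDec fun (q : Unit × ℕ) _ => rat q.2 < 0 :=
        SemiDec.lt (RatFamily.rat Computable.snd) RatFamily.zero
      refine (h0.on.or (SemiDecOn.ex (P := fun (q : Unit × ℕ) n z => rat q.2 < J n z) h1)).congr
        fun z _ q => ⟨fun hq => ?_, ?_⟩
      · by_contra! hno
        exact (hLle z (rat q.2) hno.1 hno.2).not_gt hq
      · rintro (h | ⟨n, hn⟩)
        · exact h.trans_le (hL0 z)
        · exact hn.trans_le (hJL n z)
    · have rq : RatFamily fun q : (Unit × ℕ) × ℕ => rat q.1.2 :=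
        RatFamily.rat (Computable.snd.comp Computable.fst)
      have h1 : SemiDecOn univ fun (q : (Unit × ℕ) × ℕ) z => J q.2 z < rat q.1.2 :=
        (hJ.reindex (k := fun q : (Unit × ℕ) × ℕ => q.2) Computable.snd).lt_rat rq
      have h2 : SemiDecOn univ fun (q : (Unit × ℕ) × ℕ) z => 1 < out q.2 z :=
        (hout.reindex (k := fun q : (Unit × ℕ) × ℕ => q.2) Computable.snd).rat_lt .one
      have h3 : SemiDecOn univ fun (q : (Unit × ℕ) × ℕ) z => F z < rat q.1.2 - (1 / 2 : ℝ) ^ q.2 :=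
        (hF.reindex (k := fun _ : (Unit × ℕ) × ℕ => ()) (Computable.const ())).lt_rat
          (rq.sub (RatFamily.half_pow Computable.snd))
      -- The two disjuncts are the two reasons why `J` cannot climb past the bound later: the bound
      -- of `hJ_le` or the constancy of `hJ_const`. Each is sound at every point; the first is sure
      -- to succeed on `K`, where the integral is `F`, and the second off `K`.
      refine (SemiDecOn.ex (P := fun (q : Unit × ℕ) n z => J n z < rat q.2 ∧
        (F z < rat q.2 - (1 / 2 : ℝ) ^ n ∨ 1 < out n z)) (h1.and (h3.or h2))).congr
        fun z _ q => ⟨fun hq => ?_, ?_⟩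
      · beta_reduce at hq
        by_cases hz : z ∈ K
        · rw [hLK z hz] at hq
          obtain ⟨n, hn⟩ := exists_half_pow_lt (ε := rat q.2 - F z) (by linarith)
          exact ⟨n, ((hJL n z).trans_eq (hLK z hz)).trans_lt hq, .inl (by linarith)⟩
        · obtain ⟨n, hn⟩ := hout2 z hz
          exact ⟨n, (hJL n z).trans_lt hq, .inr hn⟩
      · rintro ⟨n, hn, h | h⟩
        · refine (hLle z _ (le_max_of_le_left (hJ0 n z)) (hJ_le z n)).trans_lt
            (max_lt hn (by linarith))
        · exact (hLle z _ (hJ0 n z) (hJ_const z n h)).trans_lt hn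

end Extension

/-! ## Lower semicomputable functions as suprema of bump functions -/

section Product

variable {Y Z : Type*} [MetricPresentation Y] [MetricPresentation Z]

theorem d_prod (p q : Y × Z) : d p q = max (d p.1 q.1) (d p.2 q.2) := rfl

theorem pt_prod (n : ℕ) : (pt n : Y × Z) = (pt n.unpair.1, pt n.unpair.2) := rfl

end Product

section BumpSupremum

variable {A X : Type*} [MetricSpace A] [ComputableMetricSpace A]
  [MetricSpace X] [ComputableMetricSpace X]

theorem BumpFamily.iSup_ofReal_maxFun (B : BumpFamily) (u : ℕ → ℝ) (x : X) :
    ⨆ n, ENNReal.ofReal (B.maxFun u n x) =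
      ⨆ k, ENNReal.ofReal (B.coeff k * min (u k) (B.bump k x)) := by
  apply le_antisymm
  · refine iSup_le fun n => ?_
    induction n with
    | zero => simp [maxFun, UniformSchnorr.maxUpTo]
    | succ n ih =>
      rw [maxFun, UniformSchnorr.maxUpTo, ENNReal.ofReal_max]
      exact max_le (le_iSup (fun k => ENNReal.ofReal (B.coeff k * min (u k) (B.bump k x))) n) ih
  · refine iSup_le fun k => le_trans (ENNReal.ofReal_le_ofReal ?_)
      (le_iSup (fun n => ENNReal.ofReal (B.maxFun u n x)) (k + 1))
    exact le_maxUpTo (fun k => B.coeff k * min (u k) (B.bump k x)) k.lt_succ_self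

theorem exists_posRat_btwn {a b : ℝ≥0∞} (h : a < b) :
    ∃ c, a < (posRat c : ℝ≥0∞) ∧ (posRat c : ℝ≥0∞) < b := by
  obtain ⟨q, hq, h1, h2⟩ := ENNReal.lt_iff_exists_rat_btwn.1 h
  have hq' : (0 : ℝ) < q := by
    by_contra! hle
    rw [Real.toNNReal_of_nonpos hle] at h1
    simp at h1
  obtain ⟨c, hc⟩ := exists_posRat (Rat.cast_pos.1 hq')
  have : posRat c = Real.toNNReal q := by rw [← hc, Real.toNNReal_coe]
  exact ⟨c, by rwa [this], by rwa [this]⟩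

variable [MeasurableSpace X] [BorelSpace X]

/-- On `S` the set `{T > c}` is an enumerated union of balls, and `T` is the supremum of `c` times
the indicators of these balls. A ball of the maximum metric is a product, so its indicator is the
supremum of minima of a bump function in `(a, μ)` and one in `x`. Unlike `T`, these functions make
sense outside `S`. -/
theorem exists_bumpFamily {S : Set (A × FiniteMeasure X × X)} {T : A × FiniteMeasure X × X → ℝ≥0∞}
    (hT : SemiDecOn S fun c p => (posRat c : ℝ≥0∞) < T p) :
    ∃ (B : BumpFamily) (u : ℕ → A × FiniteMeasure X → ℝ), RealComputableOn univ u ∧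
      (∀ k z, u k z ≤ 1) ∧ (∀ k z, 0 ≤ u k z) ∧ ∀ a μ x, (a, μ, x) ∈ S →
        ⨆ n, ENNReal.ofReal (B.maxFun (fun k => u k (a, μ)) n x) = T (a, μ, x) := by
  obtain ⟨W, hW, hWT⟩ := hT.exists_balls
  obtain ⟨R, hR, hRW⟩ := SemiDec.exists_stage hW
  let γ := (ℕ × ℕ) × ℕ × ℕ × ℕ
  obtain ⟨κ, hκ, hsurj⟩ : ∃ κ : ℕ → γ, Computable κ ∧ ∀ p, ∃ k, κ k = p :=
    ⟨Denumerable.ofNat γ, Computable.ofNat γ, fun p => ⟨_, Denumerable.ofNat_encode p⟩⟩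
  have cc : Computable fun k => (κ k).1.1 := Computable.fst.comp (Computable.fst.comp hκ)
  have cb : Computable fun k => (κ k).1.2 := Computable.snd.comp (Computable.fst.comp hκ)
  have cs : Computable fun k => (κ k).2.1 := Computable.fst.comp (Computable.snd.comp hκ)
  have cr : Computable fun k => (κ k).2.2.1 :=
    Computable.fst.comp (Computable.snd.comp (Computable.snd.comp hκ))
  have cg : Computable fun k => (κ k).2.2.2 :=
    Computable.snd.comp (Computable.snd.comp (Computable.snd.comp hκ))
  have cu : ∀ {f : ℕ → ℕ}, Computable f → Computable fun k => (f k).unpair :=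
    fun hf => Computable.unpair.comp hf
  have cb1 : Computable fun k => (κ k).1.2.unpair.1 := Computable.fst.comp (cu cb)
  have cb2 : Computable fun k => (κ k).1.2.unpair.2 := Computable.snd.comp (cu cb)
  have cb12 : Computable fun k => (κ k).1.2.unpair.1.unpair.2 := Computable.snd.comp (cu cb1)
  have cA : Computable fun k => (κ k).1.2.unpair.1.unpair.1 := Computable.fst.comp (cu cb1)
  have cM : Computable fun k => (κ k).1.2.unpair.1.unpair.2.unpair.1 :=
    Computable.fst.comp (cu cb12)
  have cX : Computable fun k => (κ k).1.2.unpair.1.unpair.2.unpair.2 :=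
    Computable.snd.comp (cu cb12)
  -- An index codes a threshold and a ball, a stage and two radii. It gets a nonzero coefficient
  -- only if the ball has been enumerated for this threshold by that stage and the outer radius fits
  -- inside the ball; then its product vanishes off the ball, and never exceeds `T` on `S`.
  let active : ℕ → Bool := fun k => R (κ k).1 (κ k).2.1 &&
    !decide ((posRat (κ k).1.2.unpair.2 : ℝ) < posRat (κ k).2.2.1 + posRat (κ k).2.2.2)
  have hactive : Computable active := computable_and (hR.comp (Computable.fst.comp hκ) cs)
    (Primrec.not.to_comp.comp ((RatFamily.posRat cb2).computable_lt
      ((RatFamily.posRat cr).add (RatFamily.posRat cg))))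
  have hactive' : ∀ k, active k = true ↔ R (κ k).1 (κ k).2.1 = true ∧
      (posRat (κ k).2.2.1 + posRat (κ k).2.2.2 : ℝ) ≤ posRat (κ k).1.2.unpair.2 := fun k => by
    simp [active]
  let coeff : ℕ → ℝ := fun k => if active k then posRat (κ k).1.1 else 0
  have hcoeff : RatFamily coeff := by
    obtain ⟨p, hp, hp'⟩ := RatFamily.posRat cc
    obtain ⟨o, ho⟩ := exists_rat 0
    refine ⟨fun k => bif active k then p k else o,
      Computable.cond hactive hp (Computable.const o), fun k => ?_⟩
    cases h : active k <;> simp [coeff, h, ho, hp']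
  let B : BumpFamily :=
    { coeff := coeff
      center := fun k => (κ k).1.2.unpair.1.unpair.2.unpair.2
      rad := fun k => (κ k).2.2.1
      gap := fun k => (κ k).2.2.2
      coeff_nonneg := fun k => by
        simp only [coeff]
        split_ifs
        exacts [NNReal.coe_nonneg _, le_rfl]
      ratFamily_coeff := hcoeff
      computable_center := cX
      computable_rad := cr
      computable_gap := cg }
  have hlt : ∀ k, (posRat (κ k).2.2.1 : ℝ) < posRat (κ k).2.2.1 + posRat (κ k).2.2.2 :=
    fun k => by linarith [posRat_pos (κ k).2.2.2]
  let u : ℕ → A × FiniteMeasure X → ℝ := fun k z =>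
    UniformSchnorr.bump (pt (Nat.pair (κ k).1.2.unpair.1.unpair.1
      (κ k).1.2.unpair.1.unpair.2.unpair.1)) (posRat (κ k).2.2.1)
      (posRat (κ k).2.2.1 + posRat (κ k).2.2.2) z
  have hd : ∀ (a : A) (μ : FiniteMeasure X) (x : X) i ρ,
      d (a, μ, x) (pt i : A × FiniteMeasure X × X) < ρ ↔
        d (pt (Nat.pair i.unpair.1 i.unpair.2.unpair.1) : A × FiniteMeasure X) (a, μ) < ρ ∧
          d (pt i.unpair.2.unpair.2 : X) x < ρ := by
    intro a μ x i ρ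
    rw [d_comm (pt (Nat.pair _ _) : A × FiniteMeasure X), d_comm (pt _ : X)]
    simp only [pt_prod, d_prod, Nat.unpair_pair, max_lt_iff, and_assoc]
  refine ⟨B, u, realComputableOn_bump (Primrec₂.natPair.to_comp.comp cA cM) cr cg,
    fun k z => bump_le_one _ (hlt k) z, fun k z => bump_nonneg _ (hlt k) z,
    fun a μ x hS => ?_⟩
  rw [B.iSup_ofReal_maxFun]
  apply le_antisymm
  · refine iSup_le fun k => ?_
    by_cases hk : active k = true
    · obtain ⟨hk1, hk2⟩ := (hactive' k).1 hk
      by_cases h0 : 0 < min (u k (a, μ)) (B.bump k x)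
      · obtain ⟨h1, h2⟩ := lt_min_iff.1 h0
        have h1' : d (pt (Nat.pair (κ k).1.2.unpair.1.unpair.1
            (κ k).1.2.unpair.1.unpair.2.unpair.1) : A × FiniteMeasure X) (a, μ) <
            posRat (κ k).1.2.unpair.2 := by
          by_contra! hle
          exact h1.ne' (bump_eq_zero (hlt k) (hk2.trans hle))
        have h2' : d (pt (κ k).1.2.unpair.1.unpair.2.unpair.2 : X) x <
            posRat (κ k).1.2.unpair.2 := by
          by_contra! hle
          exact h2.ne' (bump_eq_zero (hlt k) (hk2.trans hle))
        have h3 := (hWT (a, μ, x) hS (κ k).1.1).2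
          ⟨(κ k).1.2, (hRW (κ k).1).2 ⟨_, hk1⟩, (hd a μ x _ _).2 ⟨h1', h2'⟩⟩
        refine le_trans (ENNReal.ofReal_le_ofReal (q := posRat (κ k).1.1) ?_) ?_
        · simp only [B, coeff, hk, if_true]
          exact mul_le_of_le_one_right (NNReal.coe_nonneg _)
            ((min_le_right _ _).trans (B.bump_le_one k x))
        · rw [ENNReal.ofReal_coe_nnreal]
          exact h3.le
      · have : B.coeff k * min (u k (a, μ)) (B.bump k x) ≤ 0 :=
          mul_nonpos_of_nonneg_of_nonpos (B.coeff_nonneg k) (not_lt.1 h0)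
        rw [ENNReal.ofReal_of_nonpos this]
        exact zero_le
    · simp [B, coeff, hk]
  · refine le_of_forall_lt fun y hy => ?_
    obtain ⟨c, hc1, hc2⟩ := exists_posRat_btwn hy
    obtain ⟨b, hb, hball⟩ := (hWT (a, μ, x) hS c).1 hc2
    obtain ⟨s, hs⟩ := (hRW (c, b)).1 hb
    obtain ⟨h1, h2⟩ := (hd a μ x _ _).1 hball
    set ρ : ℝ := (posRat b.unpair.2 : ℝ) with hρ
    set δ : ℝ := max (d (pt (Nat.pair b.unpair.1.unpair.1
      b.unpair.1.unpair.2.unpair.1) : A × FiniteMeasure X) (a, μ))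
      (d (pt b.unpair.1.unpair.2.unpair.2 : X) x) with hδ
    have hδρ : δ < ρ := max_lt h1 h2
    have hδ0 : 0 ≤ δ := le_max_of_le_right (d_nonneg _ _)
    -- The inner radius lies beyond both coordinates of the point, so both bump functions equal `1`
    -- there, and the gap still fits into the ball.
    obtain ⟨q, hq1, hq2⟩ := exists_rat_btwn hδρ
    obtain ⟨r, hr⟩ := exists_posRat (q := q) (by exact_mod_cast hδ0.trans_lt hq1)
    obtain ⟨g, hg⟩ := exists_posRat_lt (sub_pos.2 hq2)
    obtain ⟨k, hk⟩ := hsurj ((c, b), s, r, g)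
    have hka : active k = true := by
      rw [hactive', hk]
      exact ⟨hs, by linarith⟩
    have hu1 : u k (a, μ) = 1 := by
      refine bump_eq_one ?_
      rw [hk, hr]
      exact (le_max_left _ _).trans hq1.le
    have hb1 : B.bump k x = 1 := by
      refine bump_eq_one ?_
      simp only [B]
      rw [hk, hr]
      exact (le_max_right _ _).trans hq1.le
    refine hc1.trans_le (le_trans (le_of_eq ?_)
      (le_iSup (fun k => ENNReal.ofReal (B.coeff k * min (u k (a, μ)) (B.bump k x))) k))
    simp only [hu1, hb1, min_self, mul_one, B, coeff, hka, if_true, hk]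
    exact ENNReal.ofReal_coe_nnreal.symm

end BumpSupremum

/-! ## Normalized tests -/

section Normalization

variable {α : Type*} [Primcodable α] {Z : Type*} [MetricPresentation Z]

theorem RealComputableOn.sqrt {S : Set Z} {f : α → Z → ℝ} (hf : RealComputableOn S f) :
    RealComputableOn S fun a z => √(f a z) := by
  have hr : RatFamily fun p : α × ℕ => rat p.2 := RatFamily.rat Computable.snd
  have hf' := hf.reindex (k := fun p : α × ℕ => p.1) Computable.fst
  constructor
  · refine ((SemiDec.lt hr .zero).on.or (hf'.rat_lt (hr.mul hr))).congr fun z _ p => ?_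
    rcases lt_or_ge (rat p.2) 0 with h | h
    · simp only [h, true_or, iff_true]
      exact h.trans_le (Real.sqrt_nonneg _)
    · simp only [h.not_gt, false_or]
      rw [Real.lt_sqrt h, sq]
  · refine ((SemiDec.lt .zero hr).on.and (hf'.lt_rat (hr.mul hr))).congr fun z _ p => ?_
    constructor
    · intro h
      have h0 := (Real.sqrt_nonneg _).trans_lt h
      exact ⟨h0, by rwa [Real.sqrt_lt' h0, sq] at h⟩
    · rintro ⟨h0, h⟩
      rwa [Real.sqrt_lt' h0, sq]

/-- The value of the normalized test: `s` is the square root of the mass, `I` the integral of the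
test and `t` its value. -/
def normalized (s I : ℝ) (t : ℝ≥0∞) : ℝ≥0∞ :=
  (ENNReal.ofReal s * t + (ENNReal.ofReal s)⁻¹) / (1 + ENNReal.ofReal I)

theorem normalized_zero (I : ℝ) (t : ℝ≥0∞) : normalized 0 I t = ∞ := by
  rw [normalized, ENNReal.ofReal_zero, ENNReal.inv_zero, add_top, ENNReal.top_div_of_ne_top]
  exact ENNReal.add_ne_top.2 ⟨ENNReal.one_ne_top, ENNReal.ofReal_ne_top⟩

theorem normalized_top {s : ℝ} (hs : 0 ≤ s) (I : ℝ) : normalized s I ∞ = ∞ := by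
  rcases hs.eq_or_lt with rfl | h
  · exact normalized_zero I ∞
  · rw [normalized, ENNReal.mul_top (ENNReal.ofReal_pos.2 h).ne', top_add,
      ENNReal.top_div_of_ne_top]
    exact ENNReal.add_ne_top.2 ⟨ENNReal.one_ne_top, ENNReal.ofReal_ne_top⟩

/-- Multiplication by `s (1 + I)` turns the condition into `q (1 + I) s < t s^2 + 1`, which is free
of division and reads `0 < 1` for `s = 0`, where the normalized value is indeed `∞`. It improves as
`t` grows and as `I` shrinks, so a rational below `t` and one above `I` witness it. The maximum with
`0` admits negative `rat b`, needed when `t = 0`. -/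
theorem lt_normalized_iff {q : ℝ≥0} (hq : 0 < q) {s I : ℝ} (hs : 0 ≤ s) (hI : 0 ≤ I) (t : ℝ≥0∞) :
    (q : ℝ≥0∞) < normalized s I t ↔ ∃ b c, I < rat c ∧ ((rat b : ℝ) : EReal) < (t : EReal) ∧
      q * (1 + rat c) * s < max (rat b) 0 * (s * s) + 1 := by
  have hq' : (0 : ℝ) < q := hq
  rcases hs.eq_or_lt with rfl | hs
  · simp only [normalized_zero, ENNReal.coe_lt_top, true_iff, mul_zero, zero_add, zero_lt_one,
      and_true]
    obtain ⟨c, hc, -⟩ := exists_rat_btwn' (lt_add_one I)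
    obtain ⟨b, hb⟩ := exists_rat (-1)
    refine ⟨b, c, hc, lt_of_lt_of_le ?_ (EReal.coe_ennreal_nonneg t)⟩
    rw [hb]
    exact EReal.coe_lt_coe_iff.2 (by norm_num)
  have key : ∀ τ : ℝ, 0 ≤ τ → ((ENNReal.ofReal (q * (1 + I)) <
      ENNReal.ofReal s * ENNReal.ofReal τ + (ENNReal.ofReal s)⁻¹) ↔
        q * (1 + I) * s < τ * (s * s) + 1) := fun τ hτ => by
    rw [← ENNReal.ofReal_inv_of_pos hs, ← ENNReal.ofReal_mul hs.le,
      ← ENNReal.ofReal_add (by positivity) (by positivity),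
      ENNReal.ofReal_lt_ofReal_iff_of_nonneg (by positivity), ← mul_lt_mul_iff_left₀ hs,
      add_mul, inv_mul_cancel₀ hs.ne', show s * τ * s = τ * (s * s) by ring]
  have hlt : (q : ℝ≥0∞) < normalized s I t ↔
      ENNReal.ofReal (q * (1 + I)) < ENNReal.ofReal s * t + (ENNReal.ofReal s)⁻¹ := by
    rw [normalized, ENNReal.lt_div_iff_mul_lt (.inl (by simp))
      (.inl (ENNReal.add_ne_top.2 ⟨ENNReal.one_ne_top, ENNReal.ofReal_ne_top⟩)),
      ENNReal.ofReal_mul hq'.le, ENNReal.ofReal_add zero_le_one hI, ENNReal.ofReal_one,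
      ENNReal.ofReal_coe_nnreal]
  rw [hlt]
  constructor
  · intro h
    obtain ⟨τ, hτ0, hτt, hτ⟩ : ∃ τ : ℝ, 0 ≤ τ ∧ ENNReal.ofReal τ ≤ t ∧
        q * (1 + I) * s < τ * (s * s) + 1 := by
      rcases eq_or_ne t ∞ with rfl | ht
      -- With this `τ` the term `τ * (s * s)` already equals the left side, and the summand `1`
      -- makes the inequality strict.
      · refine ⟨q * (1 + I) / s, by positivity, le_top, ?_⟩
        have : q * (1 + I) / s * (s * s) = q * (1 + I) * s := by field_simp
        linarith
      · refine ⟨t.toReal, ENNReal.toReal_nonneg, (ENNReal.ofReal_toReal ht).le, ?_⟩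
        rwa [← key _ ENNReal.toReal_nonneg, ENNReal.ofReal_toReal ht]
    obtain ⟨c, hc1, hc2⟩ := exists_rat_btwn' (x := I) (y := (τ * (s * s) + 1) / (q * s) - 1) (by
      rw [lt_sub_iff_add_lt, lt_div_iff₀ (by positivity)]
      linarith)
    rw [lt_sub_iff_add_lt, lt_div_iff₀ (by positivity)] at hc2
    obtain ⟨b, hb1, hb2⟩ := exists_rat_btwn' (x := (q * (1 + rat c) * s - 1) / (s * s)) (y := τ) (by
      rw [div_lt_iff₀ (by positivity)]
      linarith)
    rw [div_lt_iff₀ (by positivity)] at hb1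
    refine ⟨b, c, hc1, (EReal.coe_lt_coe_iff.2 hb2).trans_le ?_, ?_⟩
    · rw [← EReal.coe_ennreal_le_coe_ennreal_iff, EReal.coe_ennreal_ofReal, max_eq_left hτ0] at hτt
      exact hτt
    · have := mul_le_mul_of_nonneg_right (le_max_left (rat b) 0) (mul_pos hs hs).le
      linarith
  · rintro ⟨b, c, hc, hb, h⟩
    have hbt : ENNReal.ofReal (max (rat b) 0) ≤ t := by
      rw [← EReal.coe_ennreal_le_coe_ennreal_iff, EReal.coe_ennreal_ofReal,
        max_eq_left (le_max_right _ _), EReal.coe_strictMono.monotone.map_max]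
      exact max_le hb.le (EReal.coe_ennreal_nonneg t)
    refine ((key _ (le_max_right _ _)).2 (lt_trans ?_ h)).trans_le
      (add_le_add_left (mul_le_mul_right hbt _) _)
    exact mul_lt_mul_of_pos_right (mul_lt_mul_of_pos_left (by linarith) hq') hs

/-- Since `s^2` is the mass, the numerator has integral `s I + s^2 / s = s (1 + I)`. For the null
measure both sides are `0`, although the integrand is `∞` everywhere. -/
theorem lintegral_normalized {X : Type*} [MeasurableSpace X] (μ : FiniteMeasure X) {t : X → ℝ≥0∞}
    (ht : ∫⁻ x, t x ∂(μ : Measure X) < ∞) :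
    ∫⁻ x, normalized (√((μ : Measure X).real univ)) (∫⁻ x, t x ∂(μ : Measure X)).toReal (t x)
      ∂(μ : Measure X) = ENNReal.ofReal (√((μ : Measure X).real univ)) := by
  set I := ∫⁻ x, t x ∂(μ : Measure X)
  set m := (μ : Measure X).real univ with hm
  have hmu : (μ : Measure X) univ = ENNReal.ofReal m := by
    rw [hm, measureReal_def, ENNReal.ofReal_toReal (measure_ne_top _ _)]
  have hm0 : 0 ≤ m := measureReal_nonneg
  rcases hm0.eq_or_lt with h | h
  · have h0 : (μ : Measure X) = 0 := by
      rw [← Measure.measure_univ_eq_zero, hmu, ← h, ENNReal.ofReal_zero]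
    rw [h0, lintegral_zero_measure, ← h, Real.sqrt_zero, ENNReal.ofReal_zero]
  · have hs : ENNReal.ofReal (√m) ≠ 0 := (ENNReal.ofReal_pos.2 (Real.sqrt_pos.2 h)).ne'
    have hs' : ENNReal.ofReal (√m) ≠ ∞ := ENNReal.ofReal_ne_top
    have hsm : ENNReal.ofReal m = ENNReal.ofReal (√m) * ENNReal.ofReal (√m) := by
      rw [← ENNReal.ofReal_mul (Real.sqrt_nonneg _), Real.mul_self_sqrt h.le]
    have h1 : 1 + I ≠ 0 := by simp
    have h2 : 1 + I ≠ ∞ := ENNReal.add_ne_top.2 ⟨ENNReal.one_ne_top, ht.ne⟩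
    simp only [normalized, ENNReal.ofReal_toReal ht.ne, div_eq_mul_inv]
    rw [lintegral_mul_const' _ _ (ENNReal.inv_ne_top.2 h1),
      lintegral_add_right _ measurable_const, lintegral_const_mul' _ _ hs', lintegral_const, hmu,
      hsm, ← mul_assoc, ENNReal.inv_mul_cancel hs hs', one_mul]
    rw [← mul_add_one, mul_assoc, add_comm, ENNReal.mul_inv_cancel h1 h2, mul_one]

end Normalization

-- The normalized test is lower semicomputable and extends to a total test

section Main

variable {A X : Type*} [MetricSpace A] [ComputableMetricSpace A]
  [MetricSpace X] [ComputableMetricSpace X] [MeasurableSpace X] [BorelSpace X]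

theorem realComputableOn_mass : RealComputableOn (univ : Set (A × FiniteMeasure X))
    fun (_ : Unit) z => (z.2 : Measure X).real univ := by
  obtain ⟨e, he⟩ := (isBasicFun_iff fun _ : X => 1).1 IsBasicFun.one
  refine (realComputableOn_snd_basicIntegrals.reindex (k := fun _ : Unit => e)
    (Computable.const e)).congr fun z _ _ => ?_
  simp [basicIntegrals, he]

theorem IsUniformSchnorrTestOn.semiDecOn_lt_normalized {K : Set (A × FiniteMeasure X)}
    {t : A → FiniteMeasure X → X → ℝ≥0∞} (ht : IsUniformSchnorrTestOn K t) :
    SemiDecOn {p : A × FiniteMeasure X × X | (p.1, p.2.1) ∈ K} fun (c : ℕ) p =>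
      (posRat c : ℝ≥0∞) < normalized (√((p.2.1 : Measure X).real univ))
        (∫⁻ x, t p.1 p.2.1 x ∂(p.2.1 : Measure X)).toReal (t p.1 p.2.1 p.2.2) := by
  obtain ⟨g, hg, hgt⟩ := ht.lowerSemicomputable
  have hg' := hg.realComputableOn.curry
  have hm : RealComputableOn {p : A × FiniteMeasure X × X | (p.1, p.2.1) ∈ K}
      fun (_ : Unit) p => (p.2.1 : Measure X).real univ :=
    (realComputableOn_mass.mono (subset_univ K)).comap_fst
  have hI : RealComputableOn {p : A × FiniteMeasure X × X | (p.1, p.2.1) ∈ K}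
      fun (_ : Unit) p => (∫⁻ x, t p.1 p.2.1 x ∂(p.2.1 : Measure X)).toReal :=
    ht.computable_integral.realComputableOn.comap_fst
  let γ := (ℕ × ℕ) × ℕ
  have c0 : Computable fun _ : γ => () := Computable.const ()
  have rb : RatFamily fun p : γ => rat p.1.2 :=
    RatFamily.rat (Computable.snd.comp Computable.fst)
  have rc : RatFamily fun p : γ => rat p.2 := RatFamily.rat Computable.snd
  have rq : RatFamily fun p : γ => (posRat p.1.1 : ℝ) :=
    RatFamily.posRat (Computable.fst.comp Computable.fst)
  have h1 : SemiDecOn {p : A × FiniteMeasure X × X | (p.1, p.2.1) ∈ K} fun (q : γ) p =>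
      (∫⁻ x, t p.1 p.2.1 x ∂(p.2.1 : Measure X)).toReal < rat q.2 := (hI.reindex c0).lt_rat rc
  have h2 : SemiDecOn {p : A × FiniteMeasure X × X | (p.1, p.2.1) ∈ K} fun (q : γ) p =>
      ((rat q.1.2 : ℝ) : EReal) < (t p.1 p.2.1 p.2.2 : EReal) := by
    refine (SemiDecOn.ex (P := fun (q : γ) n p => rat q.1.2 < g (n, p))
      ((hg'.reindex (k := fun q : γ × ℕ => q.2) Computable.snd).rat_lt
        (rb.reindex Computable.fst))).congr fun p hp q => ?_
    have hgt' : (t p.1 p.2.1 p.2.2 : EReal) = ⨆ n, (g (n, p) : EReal) := hgt p hp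
    rw [hgt', lt_iSup_iff]
    simp only [EReal.coe_lt_coe_iff]
  -- Here `s * s` has become the mass itself, and the inequality is written as positivity of a
  -- single computable real, which is semidecidable.
  have h3 : SemiDecOn {p : A × FiniteMeasure X × X | (p.1, p.2.1) ∈ K} fun (q : γ) p =>
      0 < max (rat q.1.2) 0 * (p.2.1 : Measure X).real univ + 1 -
        posRat q.1.1 * (1 + rat q.2) * √((p.2.1 : Measure X).real univ) :=
    ((((hm.reindex c0).rat_mul (rb.max .zero)).add (.of_rat .one)).sub
      ((hm.sqrt.reindex c0).rat_mul (rq.mul (RatFamily.one.add rc)))).rat_lt .zero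
  refine (SemiDecOn.ex (P := fun (q b : ℕ) (p : A × FiniteMeasure X × X) => ∃ c,
    (∫⁻ x, t p.1 p.2.1 x ∂(p.2.1 : Measure X)).toReal < rat c ∧
      ((rat b : ℝ) : EReal) < (t p.1 p.2.1 p.2.2 : EReal) ∧
        0 < max (rat b) 0 * (p.2.1 : Measure X).real univ + 1 -
          posRat q * (1 + rat c) * √((p.2.1 : Measure X).real univ))
    (SemiDecOn.ex (P := fun (q : ℕ × ℕ) c (p : A × FiniteMeasure X × X) =>
    (∫⁻ x, t p.1 p.2.1 x ∂(p.2.1 : Measure X)).toReal < rat c ∧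
      ((rat q.2 : ℝ) : EReal) < (t p.1 p.2.1 p.2.2 : EReal) ∧
        0 < max (rat q.2) 0 * (p.2.1 : Measure X).real univ + 1 -
          posRat q.1 * (1 + rat c) * √((p.2.1 : Measure X).real univ))
    (h1.and (h2.and h3)))).congr fun p _ q => ?_
  rw [lt_normalized_iff (posRat_pos q) (Real.sqrt_nonneg _) ENNReal.toReal_nonneg,
    Real.mul_self_sqrt measureReal_nonneg]
  simp only [sub_pos]

theorem IsUniformSchnorrTest.isUniformSchnorrTestOn {t : A → FiniteMeasure X → X → ℝ≥0∞}
    (ht : IsUniformSchnorrTest t) (K : Set (A × FiniteMeasure X)) :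
    IsUniformSchnorrTestOn K t := by
  refine ⟨?_, fun a μ _ => ht.integral_lt_top a μ, ?_⟩
  · obtain ⟨g, ⟨F, hF, hF'⟩, hg⟩ := ht.lowerSemicomputable
    exact ⟨g, ⟨F, hF, fun p hp => hF' p ⟨hp.1, trivial⟩⟩, fun p _ => hg p trivial⟩
  · obtain ⟨F, hF, hF'⟩ := ht.computable_integral
    exact ⟨F, hF, fun p _ => hF' p trivial⟩

/-- A test restricted to an effectively closed set is dominated, as far as the value `∞` is
concerned, by a test which is defined everywhere. -/
theorem IsUniformSchnorrTestOn.exists_isUniformSchnorrTest {K : Set (A × FiniteMeasure X)}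
    (hK : EffectivelyClosed K) {t : A → FiniteMeasure X → X → ℝ≥0∞}
    (ht : IsUniformSchnorrTestOn K t) :
    ∃ t' : A → FiniteMeasure X → X → ℝ≥0∞, IsUniformSchnorrTest t' ∧
      ∀ a μ, (a, μ) ∈ K → ∀ x, t a μ x = ∞ → t' a μ x = ∞ := by
  obtain ⟨B, u, hu, hu1, hu0, hB⟩ := exists_bumpFamily
    (T := fun p : A × FiniteMeasure X × X => normalized (√((p.2.1 : Measure X).real univ))
        (∫⁻ x, t p.1 p.2.1 x ∂(p.2.1 : Measure X)).toReal (t p.1 p.2.1 p.2.2))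
    ht.semiDecOn_lt_normalized
  -- The target integral is the square root of the mass: it agrees on `K` with the integral of the
  -- normalized test and is computable for all measures.
  obtain ⟨t', ht', h⟩ := B.exists_test hK hu hu1 hu0 realComputableOn_mass.sqrt
    (fun z => Real.sqrt_nonneg _) fun z hz => by
      rw [← lintegral_normalized z.2 (ht.integral_lt_top z.1 z.2 hz)]
      exact lintegral_congr fun x => hB z.1 z.2 x hz
  refine ⟨t', ht', fun a μ haμ x hx => ?_⟩
  rw [h a μ haμ x, hB a μ x haμ]
  simp only [hx]
  exact normalized_top (Real.sqrt_nonneg _) _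

end Main

end UniformSchnorr

end

theorem mainTheorem1 {A X : Type*} [MetricSpace A] [ComputableMetricSpace A]
    [MetricSpace X] [ComputableMetricSpace X] [MeasurableSpace X] [BorelSpace X]
    (K : Set (A × FiniteMeasure X)) (hK : EffectivelyClosed K)
    (a : A) (μ : FiniteMeasure X) (haμ : (a, μ) ∈ K) (x : X) :
    UniformlySchnorrRandom a μ x ↔
      ∀ t : A → FiniteMeasure X → X → ℝ≥0∞, IsUniformSchnorrTestOn K t → t a μ x < ∞ := by
  refine ⟨fun h t ht => ?_, fun h t ht => h t (ht.isUniformSchnorrTestOn K)⟩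
  obtain ⟨t', ht', htt'⟩ := ht.exists_isUniformSchnorrTest hK
  by_contra hx
  exact (h t' ht').ne (htt' a μ haμ x (not_lt_top_iff.1 hx))
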